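/- Conventions: $b^{g}=g^{-1}bg$, $[a,b]=a^{-1}b^{-1}ab$, and commutators are left-normed. A subset $X$ of a group $G$ is a sandwich set if $\langle a,b^{g}\rangle$ is nilpotent of class at most $2$ for all $a,b\in X$ and $g\in\langle X\rangle$. The free sandwich group $R=\langle x,y,z\rangle$ of rank $3$ is the largest group generated by a sandwich set $\{x,y,z\}$, that is, the quotient of the free group $F$ on $x,y,z$ by the normal closure of all $[u,v,w]$ with $u,v,w\in\langle a,b^{g}\rangle$, $a,b\in\{x,y,z\}$, $g\in F$. **Theorem.** (1) If a group $G$ is generated by a sandwich set $\{x,y,z\}$ whose elements have odd (finite) order, then $G$ is nilpotent of class at most $3$. (2) $R$ is nilpotent of class exactly $5$. Moreover, for all even integers $l,m,n\ge 0$, the quotient of $R$ by the normal closure of $\{x^{l},y^{m},z^{n}\}$ (the largest sandwich group $\langle x,y,z\rangle$ with $x^{l}=y^{m}=z^{n}=1$) is nilpotent of class exactly $5$. (3) Let $P$ be the group with generators $x_1,\dots,x_{14}$ and relations $$x_1^2=x_2^2=x_3^2=1,\qquad x_4^2=x_5^2=x_6^2=x_3x_2x_1,$$ $$x_4^{x_{12}}=x_4x_3,\quad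 x_4^{x_{13}}=x_4x_1,\quad x_5^{x_{13}}=x_5x_1,\quad x_5^{x_{14}}=x_5x_2,\quad x_6^{x_{12}}=x_6x_3,\quad x_6^{x_{14}}=x_6x_2,$$ $$x_7^{x_9}=x_7x_2x_3,\quad x_7^{x_{10}}=x_7x_1,\quad x_7^{x_{11}}=x_7x_1,\quad x_7^{x_{12}}=x_7x_5x_3x_2,\quad x_7^{x_{13}}=x_7x_1,\quad x_7^{x_{14}}=x_7x_4x_3x_2,$$ $$x_8^{x_9}=x_8x_3,\quad x_8^{x_{10}}=x_8x_2x_1,\quad x_8^{x_{11}}=x_8x_3,\quad x_8^{x_{12}}=x_8x_3,\quad x_8^{x_{13}}=x_8x_6x_3,\quad x_8^{x_{14}}=x_8x_4x_3,$$ $$x_9^{x_{10}}=x_9x_4,\quad x_9^{x_{11}}=x_9x_5,\quad x_9^{x_{13}}=x_9x_7,\quad x_{10}^{x_{11}}=x_{10}x_6,\quad x_{10}^{x_{12}}=x_{10}x_8,$$ $$x_{11}^{x_{14}}=x_{11}x_8x_7^{-1}x_6x_5x_4x_3,\quad x_{12}^{x_{13}}=x_{12}x_{11},\quad x_{12}^{x_{14}}=x_{12}x_9^{-1},\quad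 x_{13}^{x_{14}}=x_{13}x_{10}^{-1},$$ and $x_i^{x_j}=x_i$ for all other pairs $i<j$. This presentation is consistent: every element of $P$ can be written in exactly one way as $x_{14}^{e_{14}}x_{13}^{e_{13}}\cdots x_1^{e_1}$ with $e_1,\dots,e_6\in\{0,1\}$ and $e_7,\dots,e_{14}\in\mathbb Z$. There is an isomorphism $P\to R$ under which $$x_1\mapsto[z,x,y,y],\quad x_2\mapsto[x,y,z,z],\quad x_3\mapsto[y,z,x,x],$$ $$x_4\mapsto[[z,x],[z,y]],\quad x_5\mapsto[[x,y],[x,z]],\quad x_6\mapsto[[y,z],[y,x]],\quad x_7\mapsto[z,x,y],\quad x_8\mapsto[z,y,x],$$ $$x_9\mapsto[z,x],\quad x_{10}\mapsto[z,y],\quad x_{11}\mapsto[x,y],\quad x_{12}\mapsto x,\quad x_{13}\mapsto y,\quad x_{14}\mapsto z.$$ -/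

import Mathlib

open scoped commutatorElement

/-- `G` is nilpotent of class at most `n`. -/
def NilpotentOfClassLE (G : Type*) [Group G] (n : ℕ) : Prop :=
  Group.IsNilpotent G ∧ Group.nilpotencyClass G ≤ n

/-- `X` is a sandwich set: `⟨a, b ^ g⟩` is nilpotent of class at most `2` for all `a, b ∈ X` and
`g ∈ ⟨X⟩`, where `b ^ g = g⁻¹ * b * g`. -/
def IsSandwichSet {G : Type*} [Group G] (X : Set G) : Prop :=
  ∀ a ∈ X, ∀ b ∈ X, ∀ g ∈ Subgroup.closure X,
    NilpotentOfClassLE (Subgroup.closure ({a, g⁻¹ * b * g} : Set G)) 2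

/-- The relators `[[u, v], w]` with `u, v, w ∈ ⟨a, b ^ g⟩`, where `a` and `b` are free generators
and `g` is an arbitrary element of the free group. -/
def sandwichRels (ι : Type*) : Set (FreeGroup ι) :=
  {r | ∃ (i j : ι) (g : FreeGroup ι),
    ∃ u ∈ Subgroup.closure ({FreeGroup.of i, g⁻¹ * FreeGroup.of j * g} : Set (FreeGroup ι)),
    ∃ v ∈ Subgroup.closure ({FreeGroup.of i, g⁻¹ * FreeGroup.of j * g} : Set (FreeGroup ι)),
    ∃ w ∈ Subgroup.closure ({FreeGroup.of i, g⁻¹ * FreeGroup.of j * g} : Set (FreeGroup ι)),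
      r = ⁅⁅u, v⁆, w⁆}

/-- The free (largest) sandwich group generated by a sandwich set indexed by `ι`: it is generated
by a sandwich set (`isSandwichSet_range_of`, `closure_range_of`), and every group generated
by a sandwich set indexed by `ι` is a quotient of it (`exists_hom`). -/
abbrev FreeSandwichGroup (ι : Type*) : Type _ := PresentedGroup (sandwichRels ι)

/-- The standard generators of the free sandwich group. -/
def FreeSandwichGroup.of {ι : Type*} (i : ι) : FreeSandwichGroup ι := PresentedGroup.of i

theorem nilpotentOfClassLE_two_iff (G : Type*) [Group G] :
    NilpotentOfClassLE G 2 ↔ ∀ u v w : G, ⁅⁅u, v⁆, w⁆ = 1 := by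
  have key : Subgroup.upperCentralSeries G 2 = ⊤ ↔ ∀ u v w : G, ⁅⁅u, v⁆, w⁆ = 1 := by
    rw [Subgroup.eq_top_iff']
    simp only [Subgroup.mem_upperCentralSeries_succ_iff, Subgroup.upperCentralSeries_zero,
      Subgroup.mem_bot]
  rw [← key]
  constructor
  · rintro ⟨h, h2⟩
    exact Subgroup.upperCentralSeries_eq_top_iff_nilpotencyClass_le.2 h2
  · intro h
    have : Group.IsNilpotent G := ⟨⟨2, h⟩⟩
    exact ⟨this, Subgroup.upperCentralSeries_eq_top_iff_nilpotencyClass_le.1 h⟩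

theorem FreeSandwichGroup.closure_range_of (ι : Type*) :
    Subgroup.closure (Set.range (FreeSandwichGroup.of : ι → FreeSandwichGroup ι)) = ⊤ :=
  PresentedGroup.closure_range_of _

theorem FreeSandwichGroup.isSandwichSet_range_of (ι : Type*) :
    IsSandwichSet (Set.range (FreeSandwichGroup.of : ι → FreeSandwichGroup ι)) := by
  rintro _ ⟨i, rfl⟩ _ ⟨j, rfl⟩ g -
  obtain ⟨g, rfl⟩ := PresentedGroup.mk_surjective _ g
  rw [nilpotentOfClassLE_two_iff]
  have himg : Subgroup.closure ({FreeSandwichGroup.of i, (PresentedGroup.mk (sandwichRels ι) g)⁻¹ *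
      FreeSandwichGroup.of j * PresentedGroup.mk (sandwichRels ι) g} :
        Set (FreeSandwichGroup ι)) =
      (Subgroup.closure ({FreeGroup.of i, g⁻¹ * FreeGroup.of j * g} : Set (FreeGroup ι))).map
        (PresentedGroup.mk (sandwichRels ι)) := by
    rw [MonoidHom.map_closure, Set.image_pair, map_mul, map_mul, map_inv]
    rfl
  rintro ⟨u, hu⟩ ⟨v, hv⟩ ⟨w, hw⟩
  rw [himg] at hu hv hw
  obtain ⟨u, hu₁, rfl⟩ := hu
  obtain ⟨v, hv₁, rfl⟩ := hv
  obtain ⟨w, hw₁, rfl⟩ := hw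
  apply Subtype.ext
  have h1 : PresentedGroup.mk (sandwichRels ι) ⁅⁅u, v⁆, w⁆ = 1 :=
    PresentedGroup.one_of_mem ⟨i, j, g, u, hu₁, v, hv₁, w, hw₁, rfl⟩
  rw [map_commutatorElement, map_commutatorElement] at h1
  exact h1

theorem FreeSandwichGroup.exists_hom {ι G : Type*} [Group G] (f : ι → G)
    (hf : IsSandwichSet (Set.range f)) :
    ∃ φ : FreeSandwichGroup ι →* G, ∀ i, φ (FreeSandwichGroup.of i) = f i := by
  have h : ∀ r ∈ sandwichRels ι, FreeGroup.lift f r = 1 := by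
    rintro _ ⟨i, j, g, u, hu, v, hv, w, hw, rfl⟩
    have hg : FreeGroup.lift f g ∈ Subgroup.closure (Set.range f) := by
      rw [← FreeGroup.range_lift_eq_closure]
      exact ⟨g, rfl⟩
    have hn := hf (f i) ⟨i, rfl⟩ (f j) ⟨j, rfl⟩ _ hg
    rw [nilpotentOfClassLE_two_iff] at hn
    have hm : ∀ t ∈ Subgroup.closure ({FreeGroup.of i, g⁻¹ * FreeGroup.of j * g} : Set (FreeGroup ι)),
        FreeGroup.lift f t ∈
          Subgroup.closure ({f i, (FreeGroup.lift f g)⁻¹ * f j * FreeGroup.lift f g} : Set G) := by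
      intro t ht
      have := Subgroup.mem_map_of_mem (FreeGroup.lift f) ht
      rw [MonoidHom.map_closure, Set.image_pair] at this
      simpa using this
    have := congrArg Subtype.val (hn ⟨_, hm u hu⟩ ⟨_, hm v hv⟩ ⟨_, hm w hw⟩)
    rw [map_commutatorElement, map_commutatorElement]
    exact this
  exact ⟨PresentedGroup.toGroup h, fun i => PresentedGroup.toGroup.of h⟩

/-- The normal closure of `x ^ l`, `y ^ m`, `z ^ n` in the free sandwich group `⟨x, y, z⟩`. The
quotient by it is the largest sandwich group on three generators `x`, `y`, `z` that satisfy
`x ^ l = y ^ m = z ^ n = 1`; an exponent `0` prescribes nothing. -/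
abbrev FreeSandwichGroup.powerClosure (l m n : ℕ) : Subgroup (FreeSandwichGroup (Fin 3)) :=
  Subgroup.normalClosure {FreeSandwichGroup.of 0 ^ l, FreeSandwichGroup.of 1 ^ m,
    FreeSandwichGroup.of 2 ^ n}

/-- The commutator `[a, b] = a⁻¹ b⁻¹ a b`. -/
def gcomm {G : Type*} [Group G] (a b : G) : G := a⁻¹ * b⁻¹ * a * b

/-- The free generator `x_k`, for `1 ≤ k ≤ 14`; it has index `k - 1` in `Fin 14`. -/
def pcGen (k : ℕ) : FreeGroup (Fin 14) := FreeGroup.of (Fin.ofNat 14 (k - 1))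

/-- The right-hand sides of the power relations `x_k ^ 2 = pcPower k`, for `1 ≤ k ≤ 6`. -/
def pcPower : ℕ → FreeGroup (Fin 14)
  | 4 => pcGen 3 * pcGen 2 * pcGen 1
  | 5 => pcGen 3 * pcGen 2 * pcGen 1
  | 6 => pcGen 3 * pcGen 2 * pcGen 1
  | _ => 1

/-- The right-hand sides of the conjugate relations `x_k ^ x_l = pcConj k l`, for
`1 ≤ k < l ≤ 14`. The last line says that the remaining pairs of generators commute. -/
def pcConj : ℕ → ℕ → FreeGroup (Fin 14)
  | 4, 12 => pcGen 4 * pcGen 3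
  | 4, 13 => pcGen 4 * pcGen 1
  | 5, 13 => pcGen 5 * pcGen 1
  | 5, 14 => pcGen 5 * pcGen 2
  | 6, 12 => pcGen 6 * pcGen 3
  | 6, 14 => pcGen 6 * pcGen 2
  | 7, 9 => pcGen 7 * pcGen 2 * pcGen 3
  | 7, 10 => pcGen 7 * pcGen 1
  | 7, 11 => pcGen 7 * pcGen 1
  | 7, 12 => pcGen 7 * pcGen 5 * pcGen 3 * pcGen 2
  | 7, 13 => pcGen 7 * pcGen 1
  | 7, 14 => pcGen 7 * pcGen 4 * pcGen 3 * pcGen 2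
  | 8, 9 => pcGen 8 * pcGen 3
  | 8, 10 => pcGen 8 * pcGen 2 * pcGen 1
  | 8, 11 => pcGen 8 * pcGen 3
  | 8, 12 => pcGen 8 * pcGen 3
  | 8, 13 => pcGen 8 * pcGen 6 * pcGen 3
  | 8, 14 => pcGen 8 * pcGen 4 * pcGen 3
  | 9, 10 => pcGen 9 * pcGen 4
  | 9, 11 => pcGen 9 * pcGen 5
  | 9, 13 => pcGen 9 * pcGen 7
  | 10, 11 => pcGen 10 * pcGen 6
  | 10, 12 => pcGen 10 * pcGen 8
  | 11, 14 => pcGen 11 * pcGen 8 * (pcGen 7)⁻¹ * pcGen 6 * pcGen 5 * pcGen 4 * pcGen 3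
  | 12, 13 => pcGen 12 * pcGen 11
  | 12, 14 => pcGen 12 * (pcGen 9)⁻¹
  | 13, 14 => pcGen 13 * (pcGen 10)⁻¹
  | k, _ => pcGen k

/-- The relators of the power-conjugate presentation on `x_1, …, x_14`. -/
def pcRels : Set (FreeGroup (Fin 14)) :=
  {r | ∃ k : ℕ, 1 ≤ k ∧ k ≤ 6 ∧ r = (pcGen k) ^ 2 * (pcPower k)⁻¹} ∪
  {r | ∃ k l : ℕ, 1 ≤ k ∧ k < l ∧ l ≤ 14 ∧
    r = (pcGen l)⁻¹ * pcGen k * pcGen l * (pcConj k l)⁻¹}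

/-- The group defined by the power-conjugate presentation. -/
abbrev PCGroup : Type := PresentedGroup pcRels

/-- The generator `x_k` of the presented group, for `1 ≤ k ≤ 14`. -/
def PCGroup.gen (k : ℕ) : PCGroup := PresentedGroup.mk pcRels (pcGen k)

/-- The normal word `x_14 ^ e_14 * ⋯ * x_1 ^ e_1`, where `e_k` is `e (k - 1)`. -/
def PCGroup.normalWord (e : Fin 14 → ℤ) : PCGroup :=
  ((List.finRange 14).reverse.map fun i => PCGroup.gen (i.val + 1) ^ e i).prod

/-- The presentation is consistent: every element is represented by exactly one normal word
`x_14 ^ e_14 * ⋯ * x_1 ^ e_1` with `e_k ∈ {0, 1}` for the generators `x_1, …, x_6` that have a power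
relation, and `e_k ∈ ℤ` for the others. -/
def PCGroup.Consistent : Prop :=
  ∀ h : PCGroup, ∃! e : Fin 14 → ℤ,
    (∀ i : Fin 14, (i : ℕ) < 6 → e i = 0 ∨ e i = 1) ∧ h = PCGroup.normalWord e

/-- The elements `x_1, …, x_14` (in this order) as commutators in `x`, `y`, `z`. -/
def commutatorList {G : Type*} [Group G] (x y z : G) : Fin 14 → G :=
  ![gcomm (gcomm (gcomm z x) y) y,
    gcomm (gcomm (gcomm x y) z) z,
    gcomm (gcomm (gcomm y z) x) x,
    gcomm (gcomm z x) (gcomm z y),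
    gcomm (gcomm x y) (gcomm x z),
    gcomm (gcomm y z) (gcomm y x),
    gcomm (gcomm z x) y,
    gcomm (gcomm z y) x,
    gcomm z x,
    gcomm z y,
    gcomm x y,
    x, y, z]

/-! Upper bounds. If `X` is a sandwich set generating `G`, the set `S` of all conjugates of elements
of `X` and of their inverses is closed under inversion and conjugation, and every `a ∈ S` commutes
with `[a, b]` for `b ∈ S`. Everything is squeezed out of this one fact by substituting conjugates
such as `a ^ b = a * [a, b]`, or inverses, for the entries. With `p = [a, b]`, `q = [a, c]`, the
commutator `[p, c]` splits as `w * D`, where `w = [p, q]` and `D` commutes with `c`. When `a`, `b`,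
`c` generate `G`, the elements `s = [w, c]` and `m = [p, D]` are central, `s ^ 2 = 1`, `m` is a
product of two elements of type `s` (`cross_eq`), and `w ^ 2` is the product of the three elements
of type `s` (`pair_sq`). Hence `w` lies in the second centre, `[a, b, c]` in the third, and `G` has
class at most 5. If the generators have odd order, then `s`, `w` and `m` are trivial and the class
is at most 3. The same formulas, with a Hall–Witt identity for `[b, c, a]`, are exactly the
relations of `P`, so `P` maps onto `R` (`lift_commutatorList`).

Faithfulness. Collection shows that normal words exhaust `P`. Uniqueness comes from explicit models:
the normal closure of `z` is a central extension given by a bilinear cocycle with values in `ℤ/4`,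
and the Heisenberg group generated by `x` and `y` acts on it. One model identifies `x_1`, `x_2`,
`x_3` with multiples of `2` in `ℤ/4`; three models together separate all normal words, so `P` embeds
in their product.

Isomorphism. In the models a parity invariant of the conjugates of `z` shows that each of them
commutes with its own conjugates by `x`, `y`, `z`. An endomorphism of `P` that permutes the
generators cyclically carries this over to `x` and `y`. So `P` is generated by a sandwich set, which
gives the map `R → P` inverse to `P → R`.

Lower bound. Three involutions on sixteen points satisfy the relations of `P`, and `[z, x, y, z, x]`
acts nontrivially. This gives class 5 for `R` and for all the quotients with even exponents at once.
-/

open scoped commutatorElement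

/-! ### Commutator identities -/

section GcommBasics
variable {G : Type*} [Group G]

theorem conj_eq_mul_gcomm (a b : G) : b⁻¹ * a * b = a * gcomm a b := by
  simp only [gcomm]; group

theorem gcomm_inv (a b : G) : (gcomm a b)⁻¹ = gcomm b a := by
  simp only [gcomm]; group

theorem gcomm_eq_one_iff {a b : G} : gcomm a b = 1 ↔ Commute a b := by
  constructor
  · intro h
    have : a * b = b * a * gcomm a b := by simp only [gcomm]; group
    rw [h, mul_one] at this
    exact this
  · intro h
    simp only [gcomm]
    rw [mul_assoc, h.eq]; group

theorem gcomm_mul_left (a b c : G) : gcomm (a * b) c = b⁻¹ * gcomm a c * b * gcomm b c := by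
  simp only [gcomm]; group

theorem gcomm_mul_right (a b c : G) : gcomm a (b * c) = gcomm a c * (c⁻¹ * gcomm a b * c) := by
  simp only [gcomm]; group

theorem Commute.gcomm_right {a b c : G} (h : Commute a b) (h' : Commute a c) :
    Commute a (gcomm b c) :=
  ((h.inv_right.mul_right h'.inv_right).mul_right h).mul_right h'

theorem gcomm_inv_right {a b : G} (h : Commute b (gcomm a b)) : gcomm a b⁻¹ = (gcomm a b)⁻¹ := by
  have h1 : gcomm a b⁻¹ = b * (gcomm a b)⁻¹ * b⁻¹ := by simp only [gcomm]; group
  rw [h1, h.inv_right.eq]; group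

theorem gcomm_inv_left {a b : G} (h : Commute a (gcomm a b)) : gcomm a⁻¹ b = (gcomm a b)⁻¹ := by
  have h1 : gcomm a⁻¹ b = a * (gcomm a b)⁻¹ * a⁻¹ := by simp only [gcomm]; group
  rw [h1, h.inv_right.eq]; group

theorem Commute.conj_conj {a b : G} (h : Commute a b) (g : G) :
    Commute (g⁻¹ * a * g) (g⁻¹ * b * g) := by
  calc _ = g⁻¹ * (a * b) * g := by group
    _ = g⁻¹ * (b * a) * g := by rw [h.eq]
    _ = _ := by group

theorem Commute.of_mul_left {a b c : G} (h : Commute (a * b) c) (h' : Commute a c) :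
    Commute b c := by
  have := h'.inv_left.mul_left h
  rwa [inv_mul_cancel_left] at this

theorem Commute.of_mul_right {a b c : G} (h : Commute c (a * b)) (h' : Commute c a) :
    Commute c b :=
  (Commute.of_mul_left h.symm h'.symm).symm

theorem Commute.of_mul_right' {a b c : G} (h : Commute c (a * b)) (h' : Commute c b) :
    Commute c a := by
  have := h.mul_right h'.inv_right
  rwa [mul_inv_cancel_right] at this

end GcommBasics

/-! ### Commutators of three elements of a sandwich-closed set -/

/-- A set of group elements closed under inversion and conjugation in which every element commutes
with its conjugates by elements of the set. -/
structure IsSandwichClosed {G : Type*} [Group G] (S : Set G) : Prop where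
  inv_mem : ∀ a ∈ S, a⁻¹ ∈ S
  conj_mem : ∀ a ∈ S, ∀ g, g⁻¹ * a * g ∈ S
  commute_conj : ∀ a ∈ S, ∀ b ∈ S, Commute a (b⁻¹ * a * b)

namespace IsSandwichClosed
variable {G : Type*} [Group G] {S : Set G} (h : IsSandwichClosed S) {a b c : G}

/-- The commutator `[[a, b], [a, c]]`. -/
def pairComm (a b c : G) : G := gcomm (gcomm a b) (gcomm a c)

/-- The part of `[a, b, c]` that commutes with `c`. -/
def reducedComm (a b c : G) : G := (pairComm a b c)⁻¹ * gcomm (gcomm a b) c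

/-- The central commutator `[[a, b], [a, c], c]`. -/
def topComm (a b c : G) : G := gcomm (pairComm a b c) c

/-- The commutator `[[a, b], D]` where `D` is the reduced form of `[a, b, c]`. -/
def crossComm (a b c : G) : G := gcomm (gcomm a b) (reducedComm a b c)

theorem gcomm_eq_pair_mul_reduced (a b c : G) :
    gcomm (gcomm a b) c = pairComm a b c * reducedComm a b c := by
  simp [reducedComm]

theorem pairComm_swap (a b c : G) : pairComm a c b = (pairComm a b c)⁻¹ := by
  simp only [pairComm, gcomm_inv]

theorem comm_left (h : IsSandwichClosed S) (ha : a ∈ S) (hb : b ∈ S) : Commute a (gcomm a b) := by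
  have := h.commute_conj a ha b hb
  rw [conj_eq_mul_gcomm] at this
  exact this.of_mul_right (Commute.refl a)

theorem comm_right (h : IsSandwichClosed S) (ha : a ∈ S) (hb : b ∈ S) : Commute b (gcomm a b) := by
  rw [← gcomm_inv b a]
  exact (h.comm_left hb ha).inv_right

theorem mul_gcomm_mem (h : IsSandwichClosed S) (ha : a ∈ S) (b : G) : a * gcomm a b ∈ S := by
  rw [← conj_eq_mul_gcomm]
  exact h.conj_mem a ha b

theorem left_pair (h : IsSandwichClosed S) (ha : a ∈ S) (hb : b ∈ S) (hc : c ∈ S) :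
    Commute a (pairComm a b c) :=
  (h.comm_left ha hb).gcomm_right (h.comm_left ha hc)

/-- The conjugates `a ^ b` and `a ^ c` lie in `S` and their commutator is again `w = [[a, b], [a,
c]]`. So `a * [a, b]` commutes with `w`, and so does `a`. -/
theorem gcomm_pair (h : IsSandwichClosed S) (ha : a ∈ S) (hb : b ∈ S) (hc : c ∈ S) :
    Commute (gcomm a b) (pairComm a b c) := by
  have h1 := h.comm_left (h.mul_gcomm_mem ha b) (h.mul_gcomm_mem ha c)
  have hp := h.comm_left ha hb
  have hq := h.comm_left ha hc
  have e1 : gcomm (a * gcomm a b) (a * gcomm a c) = pairComm a b c := by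
    rw [gcomm_mul_left, gcomm_eq_one_iff.2 ((Commute.refl a).mul_right hq), gcomm_mul_right,
      gcomm_eq_one_iff.2 hp.symm]
    simp [pairComm]
  rw [e1] at h1
  exact h1.of_mul_left (h.left_pair ha hb hc)

theorem gcomm_pair_right (h : IsSandwichClosed S) (ha : a ∈ S) (hb : b ∈ S) (hc : c ∈ S) :
    Commute (gcomm a c) (pairComm a b c) := by
  have := h.gcomm_pair ha hc hb
  rw [pairComm_swap] at this
  simpa using this.inv_right

theorem gcomm_mul_gcomm (a b c : G) :
    gcomm (a * gcomm a b) c = gcomm a c * reducedComm a b c := by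
  rw [gcomm_mul_left, reducedComm, pairComm]
  generalize gcomm a b = p
  generalize gcomm a c = q
  generalize gcomm p c = r
  simp only [gcomm]; group

/-- By `gcomm_mul_gcomm`, `[a ^ b, c] = [a, c] * D`. Here `c` commutes with the left side and with
`[a, c]`, which is the reason for splitting `D` off from `[a, b, c]`. -/
theorem right_reduced (h : IsSandwichClosed S) (ha : a ∈ S) (hc : c ∈ S) :
    Commute c (reducedComm a b c) := by
  have := h.comm_right (h.mul_gcomm_mem ha b) hc
  rw [gcomm_mul_gcomm] at this
  exact this.of_mul_right (h.comm_right ha hc)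

theorem mul_gcomm_commute (h : IsSandwichClosed S) (ha : a ∈ S) (hc : c ∈ S) :
    Commute (a * gcomm a b) (gcomm a c * reducedComm a b c) := by
  have := h.comm_left (h.mul_gcomm_mem ha b) hc
  rwa [gcomm_mul_gcomm] at this

theorem gcomm_inv_right' (h : IsSandwichClosed S) (ha : a ∈ S) (hb : b ∈ S) :
    gcomm a b⁻¹ = (gcomm a b)⁻¹ := gcomm_inv_right (h.comm_right ha hb)

theorem gcomm_inv_left' (h : IsSandwichClosed S) (ha : a ∈ S) (hb : b ∈ S) :
    gcomm a⁻¹ b = (gcomm a b)⁻¹ := gcomm_inv_left (h.comm_left ha hb)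

theorem pairComm_inv_mid (h : IsSandwichClosed S) (ha : a ∈ S) (hb : b ∈ S) (hc : c ∈ S) :
    pairComm a b⁻¹ c = (pairComm a b c)⁻¹ := by
  rw [pairComm, h.gcomm_inv_right' ha hb]
  exact gcomm_inv_left (h.gcomm_pair ha hb hc)

theorem pairComm_inv_right (h : IsSandwichClosed S) (ha : a ∈ S) (hb : b ∈ S) (hc : c ∈ S) :
    pairComm a b c⁻¹ = (pairComm a b c)⁻¹ := by
  rw [pairComm, h.gcomm_inv_right' ha hc]
  exact gcomm_inv_right (h.gcomm_pair_right ha hb hc)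

theorem pairComm_inv_left (h : IsSandwichClosed S) (ha : a ∈ S) (hb : b ∈ S) (hc : c ∈ S) :
    pairComm a⁻¹ b c = pairComm a b c := by
  have e : pairComm a b c⁻¹ = _ := h.pairComm_inv_right ha hb hc
  rw [pairComm, h.gcomm_inv_right' ha hc] at e
  rw [pairComm, h.gcomm_inv_left' ha hb, h.gcomm_inv_left' ha hc, gcomm_inv_left, e, inv_inv]
  rw [e]
  exact (h.gcomm_pair ha hb hc).inv_right

/-- `c` commutes with the conjugate of `D` by `([a, b] w)⁻¹`, where `w = [[a, b], [a, c]]`. -/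
theorem right_conj_reduced (h : IsSandwichClosed S) (ha : a ∈ S) (hb : b ∈ S) (hc : c ∈ S) :
    Commute c (pairComm a b c * gcomm a b * (reducedComm a b c) *
      -- Replacing `b` by `b⁻¹` turns `D` into the inverse of the stated conjugate.
      (pairComm a b c * gcomm a b)⁻¹) := by
  have h1 : Commute c (reducedComm a b⁻¹ c) := h.right_reduced ha hc
  have e : reducedComm a b⁻¹ c = (pairComm a b c * gcomm a b * (reducedComm a b c) *
      (pairComm a b c * gcomm a b)⁻¹)⁻¹ := by
    rw [reducedComm, h.pairComm_inv_mid ha hb hc, h.gcomm_inv_right' ha hb, reducedComm]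
    have hw : pairComm a b c * (gcomm a b)⁻¹ * (pairComm a b c)⁻¹ = (gcomm a b)⁻¹ := by
      rw [(h.gcomm_pair ha hb hc).inv_left.symm.eq]; group
    generalize pairComm a b c = w at *
    generalize gcomm a b = p at *
    have e1 : gcomm p⁻¹ c = p * (gcomm p c)⁻¹ * p⁻¹ := by simp only [gcomm]; group
    rw [e1]
    generalize gcomm p c = r
    calc w⁻¹⁻¹ * (p * r⁻¹ * p⁻¹) = w * p * r⁻¹ * p⁻¹ := by group
      _ = w * p * r⁻¹ * (w * p⁻¹ * w⁻¹) := by rw [hw]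
      _ = _ := by group
  rw [e] at h1
  simpa using h1.inv_right

/-- The properties of `m = [[a, b], D]` that lead to its centrality. -/
theorem cross_aux (h : IsSandwichClosed S) (ha : a ∈ S) (hb : b ∈ S) (hc : c ∈ S) :
    Commute a (crossComm a b c) ∧ Commute c (crossComm a b c) ∧
      Commute (gcomm a b) (crossComm a b c) ∧ Commute (reducedComm a b c) (crossComm a b c) ∧
      Commute (pairComm a b c) (reducedComm a b c) := by
  -- The known commutation rules for pair commutators are applied to `a ^ b`, `b`, `c`. Since `[a ^
  -- b, b] = [a, b]` and `[a ^ b, c] = q * D`, the new pair commutator is `p⁻¹ * (w * p) ^ D`.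
  have hS := h.mul_gcomm_mem ha b
  have e1 : gcomm (a * gcomm a b) b = gcomm a b := by
    rw [gcomm_mul_left, gcomm_eq_one_iff.2 (h.comm_right ha hb).symm]; group
  have t1 := h.left_pair hS hb hc
  have t2 := h.gcomm_pair hS hb hc
  have t3 := h.gcomm_pair_right hS hb hc
  rw [e1] at t2
  rw [gcomm_mul_gcomm] at t3
  have e2 : pairComm (a * gcomm a b) b c = (gcomm a b)⁻¹ * ((reducedComm a b c)⁻¹ *
      (pairComm a b c * gcomm a b) * reducedComm a b c) := by
    rw [pairComm, e1, gcomm_mul_gcomm, ← (h.gcomm_pair ha hb hc).eq]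
    simp only [pairComm]
    generalize reducedComm a b c = D
    generalize gcomm a b = p
    generalize gcomm a c = q
    simp only [gcomm]; group
  have hap := h.comm_left ha hb
  have haq := h.comm_left ha hc
  have hwp := h.gcomm_pair ha hb hc
  have hwq := h.gcomm_pair_right ha hb hc
  have hcD : Commute c (reducedComm a b c) := h.right_reduced ha hc
  have hk := h.right_conj_reduced ha hb hc
  have hpr := gcomm_eq_pair_mul_reduced a b c
  have hwdef : pairComm a b c = gcomm (gcomm a b) (gcomm a c) := rfl
  have hqdef : Commute a (gcomm a b) := hap
  rw [e2] at t1 t2 t3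
  rw [crossComm]
  have hac : ∀ t, Commute a t → Commute c t → Commute (gcomm a c) t :=
    fun t h1 h2 => (Commute.gcomm_right h1.symm h2.symm).symm
  have hpc : ∀ t, Commute (gcomm a b) t → Commute c t → Commute (gcomm (gcomm a b) c) t :=
    fun t h1 h2 => (Commute.gcomm_right h1.symm h2.symm).symm
  have hpq : ∀ t, Commute (gcomm a b) t → Commute (gcomm a c) t → Commute (pairComm a b c) t :=
    fun t h1 h2 => (Commute.gcomm_right h1.symm h2.symm).symm
  generalize pairComm a b c = w at *
  generalize reducedComm a b c = D at *
  rw [hpr] at hpc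
  generalize gcomm a b = p at *
  generalize gcomm a c = q at *
  have en : p * (p⁻¹ * (D⁻¹ * (w * p) * D)) = D⁻¹ * (w * p) * D := by group
  have hpn : Commute p (D⁻¹ * (w * p) * D) := by
    rw [← en]; exact (Commute.refl p).mul_right t2
  have han : Commute a (D⁻¹ * (w * p) * D) := by
    have : Commute a (p⁻¹ * (D⁻¹ * (w * p) * D)) := by
      have := t1.mul_left t2.inv_left
      rwa [mul_inv_cancel_right] at this
    rw [← en]; exact hap.mul_right this
  -- This `m` equals `[p, D]` once `w` and `D` are known to commute. Grouped one way it commutes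
  -- with `a` and `p`; grouped as `D⁻¹` times a conjugate of `D` it commutes with `c`. The elements
  -- `q`, `w`, `D` are built from `a`, `p`, `c` and inherit this.
  obtain ⟨m, hm⟩ : ∃ m, m = (D⁻¹ * (w * p) * D) * (w * p)⁻¹ := ⟨_, rfl⟩
  have haw : Commute a w := by rw [hwdef]; exact hap.gcomm_right haq
  have ham : Commute a m := by
    rw [hm]; exact han.mul_right (haw.mul_right hap).inv_right
  have hpm : Commute p m := by
    rw [hm]; exact hpn.mul_right (hwp.mul_right (Commute.refl p)).inv_right
  have hcm : Commute c m := by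
    rw [hm]
    have : D⁻¹ * (w * p) * D * (w * p)⁻¹ = D⁻¹ * (w * p * D * (w * p)⁻¹) := by group
    rw [this]
    exact hcD.inv_right.mul_right hk
  have hqm := hac m ham hcm
  have hwm := hpq m hpm hqm
  have hDm : Commute D m := (hpc m hpm hcm).of_mul_left hwm
  have e3 : p⁻¹ * (D⁻¹ * (w * p) * D) = m * w := by
    have : D⁻¹ * (w * p) * D = m * w * p := by rw [hm]; group
    rw [this, (hpm.mul_right hwp).symm.eq]; group
  rw [e3] at t3
  have hwD : Commute D w := by
    have h1 : Commute (q * D) w := t3.of_mul_right (hqm.mul_left hDm)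
    exact h1.of_mul_left hwq
  have e4 : gcomm p D = m := by
    have : D⁻¹ * (w * p) * D = w * (D⁻¹ * p * D) := by
      rw [← mul_assoc, hwD.inv_left.eq]; group
    rw [this] at hm
    have hm' : m = w * (D⁻¹ * p * D * p⁻¹) * w⁻¹ := by rw [hm]; group
    have hm2 : D⁻¹ * p * D * p⁻¹ = m := by
      have : D⁻¹ * p * D * p⁻¹ = w⁻¹ * m * w := by rw [hm']; group
      rw [this, mul_assoc, hwm.symm.eq]; group
    have : gcomm p D = p⁻¹ * (D⁻¹ * p * D * p⁻¹) * p := by simp only [gcomm]; group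
    rw [this, hm2, mul_assoc, hpm.symm.eq]; group
  rw [e4]
  exact ⟨ham, hcm, hpm, hDm, hwD.symm⟩

/-- The relation `(a * p) * (q * D) = (q * D) * (a * p)`, which says that `a ^ b` commutes with `[a
^ b, c]`, is solved for the conjugate of `D` by `a`. -/
theorem gcomm_reduced_left (h : IsSandwichClosed S) (ha : a ∈ S) (hb : b ∈ S) (hc : c ∈ S) :
    gcomm (reducedComm a b c) a = pairComm a b c * crossComm a b c := by
  obtain ⟨-, -, hpm, hDm, hwD⟩ := h.cross_aux ha hb hc
  have h1 : _ * (_ * reducedComm a b c) = _ := (h.mul_gcomm_commute ha hc).eq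
  have haq := (h.comm_left ha hc)
  have hwp := h.gcomm_pair ha hb hc
  have hm : crossComm a b c = gcomm (gcomm a b) (reducedComm a b c) := rfl
  have hw : pairComm a b c = gcomm (gcomm a b) (gcomm a c) := rfl
  generalize crossComm a b c = m at *
  generalize pairComm a b c = w at *
  generalize reducedComm a b c = D at *
  generalize gcomm a b = p at *
  generalize gcomm a c = q at *
  have e1 : p * D * p⁻¹ = D * m := by
    have : p * D * p⁻¹ = D * (p * m * p⁻¹) := by rw [hm]; simp only [gcomm]; group
    rw [this, hpm.eq]; group
  have e2 : p⁻¹ * q * p = q * w⁻¹ := by rw [hw]; simp only [gcomm]; group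
  have e3 : q⁻¹ * a⁻¹ * q = a⁻¹ := by rw [mul_assoc, haq.inv_left.eq]; group
  have e4 : a⁻¹ * D * a = w * (D * m) := by
    calc a⁻¹ * D * a = (q⁻¹ * a⁻¹ * q) * D * a := by rw [e3]
      _ = q⁻¹ * a⁻¹ * ((q * D) * (a * p)) * p⁻¹ := by group
      _ = q⁻¹ * a⁻¹ * ((a * p) * (q * D)) * p⁻¹ := by rw [h1]
      _ = q⁻¹ * p * q * D * p⁻¹ := by group
      _ = p * (p⁻¹ * q * p)⁻¹ * q * D * p⁻¹ := by group
      _ = (p * w) * D * p⁻¹ := by rw [e2]; group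
      _ = w * (p * D * p⁻¹) := by rw [hwp.eq]; group
      _ = _ := by rw [e1]
  have e5 : gcomm D a = D⁻¹ * (a⁻¹ * D * a) := by simp only [gcomm]; group
  rw [e5, e4, ← mul_assoc w, hwD.eq]; group

/-- The properties of `s = [[a, b], [a, c], c]` that lead to its centrality. -/
theorem top_aux (h : IsSandwichClosed S) (ha : a ∈ S) (hb : b ∈ S) (hc : c ∈ S) :
    Commute a (topComm a b c) ∧ Commute c (topComm a b c) ∧ Commute (gcomm a b) (topComm a b c) ∧
      Commute (pairComm a b c) (topComm a b c) := by
  obtain ⟨-, -, hpm, hDm, hwD⟩ := h.cross_aux ha hb hc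
  have haq := h.comm_left ha hc
  have hcq := h.comm_right ha hc
  have hcD : Commute c (reducedComm a b c) := h.right_reduced ha hc
  have haw := h.left_pair ha hb hc
  have hpw := h.gcomm_pair ha hb hc
  have hqw := h.gcomm_pair_right ha hb hc
  -- Known relations are conjugated by `c`, which fixes `q` and `D` and sends `a` to `a * q`, `p` to
  -- `p * w * D` and `w` to `w * s`. The reduced commutator formed with `c⁻¹` becomes `s * D⁻¹` in
  -- this way, so `c` commutes with `s`.
  have h1 : Commute c⁻¹ (reducedComm a b c⁻¹) := h.right_reduced ha (h.inv_mem c hc)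
  rw [reducedComm, h.pairComm_inv_right ha hb hc] at h1
  have hp : c⁻¹ * gcomm a b * c = gcomm a b * (pairComm a b c * reducedComm a b c) := by
    rw [← gcomm_eq_pair_mul_reduced, conj_eq_mul_gcomm]
  have hac : c⁻¹ * a * c = a * gcomm a c := conj_eq_mul_gcomm a c
  have hwc : c⁻¹ * pairComm a b c * c = pairComm a b c * topComm a b c :=
    conj_eq_mul_gcomm _ c
  have hw : pairComm a b c = gcomm (gcomm a b) (gcomm a c) := rfl
  generalize topComm a b c = s at *
  generalize pairComm a b c = w at *
  generalize reducedComm a b c = D at *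
  generalize gcomm a b = p at *
  generalize gcomm a c = q at *
  have hqc : c⁻¹ * q * c = q := by rw [mul_assoc, ← hcq.eq]; group
  have hwsD : Commute (w * s) D := by
    have := hwD.conj_conj c
    rwa [hwc, show c⁻¹ * D * c = D by rw [mul_assoc, ← hcD.eq]; group] at this
  have hsD : Commute s D := hwsD.of_mul_left hwD
  have hwws : Commute w (w * s) := by
    have e : w * s = gcomm (p * (w * D)) q := by
      calc w * s = gcomm (c⁻¹ * p * c) (c⁻¹ * q * c) := by
            rw [← hwc, hw]; simp only [gcomm]; group
        _ = _ := by rw [hp, hqc]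
    rw [e]
    exact (hpw.symm.mul_right ((Commute.refl w).mul_right hwD)).gcomm_right hqw.symm
  have hws : Commute w s := hwws.of_mul_right (Commute.refl w)
  have hcs : Commute c s := by
    have e : c⁻¹ * (w⁻¹⁻¹ * gcomm p c⁻¹) * c = s * D⁻¹ := by
      have : c⁻¹ * (w⁻¹⁻¹ * gcomm p c⁻¹) * c = (c⁻¹ * w * c) * (c⁻¹ * p * c)⁻¹ * p := by
        simp only [gcomm]; group
      rw [this, hwc, hp]
      calc w * s * (p * (w * D))⁻¹ * p = w * (s * D⁻¹) * w⁻¹ := by group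
        _ = s * D⁻¹ := by rw [(hws.mul_right hwD.inv_right).eq]; group
    have h2 := (h1.inv_left.conj_conj c)
    rw [e, inv_inv, show c⁻¹ * c * c = c by group] at h2
    exact h2.of_mul_right' hcD.inv_right
  have hawc : Commute (w * s) a := by
    have h3 := (haw.symm.mul_right hqw.symm.inv_right).conj_conj c
    have e : c⁻¹ * (a * q⁻¹) * c = a := by
      calc _ = (c⁻¹ * a * c) * (c⁻¹ * q * c)⁻¹ := by group
        _ = a := by rw [hac, hqc]; group
    rwa [e, hwc] at h3
  have hpwc : Commute (w * s) p := by
    have h3 := hpw.symm.conj_conj c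
    rw [hwc, hp] at h3
    exact h3.of_mul_right' ((hwws.symm).mul_right hwsD)
  exact ⟨(hawc.of_mul_left haw.symm).symm, hcs, (hpwc.of_mul_left hpw.symm).symm, hws⟩

/-- `[[a, b]⁻¹, c]` in terms of `w`, `D` and `m`. -/
theorem gcomm_inv_gcomm (h : IsSandwichClosed S) (ha : a ∈ S) (hb : b ∈ S) (hc : c ∈ S) :
    gcomm (gcomm b a) c =
      (reducedComm a b c)⁻¹ * ((crossComm a b c)⁻¹ * (pairComm a b c)⁻¹) := by
  obtain ⟨-, -, hpm, hDm, hwD⟩ := h.cross_aux ha hb hc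
  have hpw := h.gcomm_pair ha hb hc
  have hr := gcomm_eq_pair_mul_reduced a b c
  have hm : crossComm a b c = gcomm (gcomm a b) (reducedComm a b c) := rfl
  rw [← gcomm_inv a b]
  generalize crossComm a b c = m at *
  generalize pairComm a b c = w at *
  generalize reducedComm a b c = D at *
  generalize gcomm a b = p at *
  have e1 : p * D * p⁻¹ = D * m := by
    have : p * D * p⁻¹ = D * (p * m * p⁻¹) := by rw [hm]; simp only [gcomm]; group
    rw [this, hpm.eq]; group
  calc gcomm p⁻¹ c = p * (gcomm p c)⁻¹ * p⁻¹ := by simp only [gcomm]; group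
    _ = p * (D⁻¹ * w⁻¹) * p⁻¹ := by rw [hr, mul_inv_rev]
    _ = (p * D * p⁻¹)⁻¹ * (p * w⁻¹ * p⁻¹) := by group
    _ = m⁻¹ * D⁻¹ * w⁻¹ := by rw [e1, hpw.inv_right.eq]; group
    _ = _ := by rw [hDm.inv_inv.symm.eq]; group

/-- `w = [[a, b], [a, c]]` and `v = [[b, a], [b, c]]`: `c` commutes with `w v`. -/
theorem right_pair_mul_pair (h : IsSandwichClosed S) (ha : a ∈ S) (hb : b ∈ S) (hc : c ∈ S) :
    Commute c (pairComm a b c * pairComm b a c) := by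
  obtain ⟨-, hcm, hpm, hDm, hwD⟩ := h.cross_aux ha hb hc
  have hcD : Commute c (reducedComm a b c) := h.right_reduced ha hc
  -- Written in terms of `a`, `b`, `c`, the reduced commutator of `b`, `a`, `c` is `(w * v)⁻¹ * (D⁻¹
  -- * m⁻¹)`, and `c` commutes with `D` and `m`.
  have h1 : Commute c (reducedComm b a c) := h.right_reduced hb hc
  rw [reducedComm, h.gcomm_inv_gcomm ha hb hc] at h1
  have hwm : Commute (crossComm a b c) (pairComm a b c) := by
    refine Commute.gcomm_right hpm.symm ?_
    exact Commute.gcomm_right (h.cross_aux ha hb hc).1.symm hcm.symm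
  generalize crossComm a b c = m at *
  generalize pairComm a b c = w at *
  generalize pairComm b a c = v at *
  generalize reducedComm a b c = D at *
  have e : v⁻¹ * (D⁻¹ * (m⁻¹ * w⁻¹)) = (w * v)⁻¹ * (D⁻¹ * m⁻¹) := by
    rw [← mul_assoc D⁻¹, ((hwD.symm.inv_left.mul_left hwm.inv_left).inv_right).eq]; group
  rw [e] at h1
  have := h1.of_mul_right' (hcD.inv_right.mul_right hcm.inv_right)
  simpa using this.inv_right

/-- Conjugation by `c` fixes `w * v` and multiplies its factors by the two top commutators, which
must therefore cancel. -/
theorem top_swap (h : IsSandwichClosed S) (ha : a ∈ S) (hb : b ∈ S) (hc : c ∈ S) :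
    topComm b a c = (topComm a b c)⁻¹ := by
  have h1 := (h.right_pair_mul_pair ha hb hc).eq
  obtain ⟨-, -, -, hs'⟩ := h.top_aux hb ha hc
  have e1 : c⁻¹ * pairComm a b c * c = pairComm a b c * topComm a b c :=
    conj_eq_mul_gcomm _ c
  have e2 : c⁻¹ * pairComm b a c * c = pairComm b a c * topComm b a c :=
    conj_eq_mul_gcomm _ c
  generalize topComm a b c = s at *
  generalize topComm b a c = t at *
  generalize pairComm a b c = w at *
  generalize pairComm b a c = v at *
  have e3 : w * s * (v * t) = w * v := by
    rw [← e1, ← e2]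
    calc _ = c⁻¹ * ((w * v) * c) := by group
      _ = w * v := by rw [← h1]; group
  rw [hs'.eq] at e3
  have : w * (s * t) * v = w * v := by rw [← e3]; group
  have := mul_right_cancel this
  exact (inv_eq_of_mul_eq_one_right (mul_eq_left.1 this)).symm

/-- Inverting `b` inverts `topComm a b c` but leaves `topComm b a c` unchanged, because a pair
commutator is even in its first entry. Together with `top_swap` this makes the top commutator its
own inverse. -/
theorem top_inv (h : IsSandwichClosed S) (ha : a ∈ S) (hb : b ∈ S) (hc : c ∈ S) :
    (topComm a b c)⁻¹ = topComm a b c := by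
  have h1 := h.top_swap ha (h.inv_mem b hb) hc
  have h2 := h.top_swap ha hb hc
  have e1 : topComm a b⁻¹ c = (topComm a b c)⁻¹ := by
    rw [topComm, h.pairComm_inv_mid ha hb hc]
    exact gcomm_inv_left (h.top_aux ha hb hc).2.2.2
  rw [e1, topComm, h.pairComm_inv_left hb ha hc, inv_inv] at h1
  change topComm b a c = _ at h1
  rw [← h2, h1]

theorem top_comm (h : IsSandwichClosed S) (ha : a ∈ S) (hb : b ∈ S) (hc : c ∈ S) :
    topComm b a c = topComm a b c := by
  rw [h.top_swap ha hb hc, h.top_inv ha hb hc]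

theorem gcomm_pair_mid (h : IsSandwichClosed S) (ha : a ∈ S) (hb : b ∈ S) (hc : c ∈ S) :
    gcomm (pairComm a b c) b = topComm a c b := by
  rw [← h.top_inv ha hc hb, topComm, pairComm_swap a b c]
  rw [← gcomm_inv_left, inv_inv]
  rw [← pairComm_swap]
  exact (h.top_aux ha hc hb).2.2.2

theorem top_commute_mid (h : IsSandwichClosed S) (ha : a ∈ S) (hb : b ∈ S) (hc : c ∈ S) :
    Commute b (topComm a b c) := by
  rw [← h.top_comm ha hb hc]
  exact (h.top_aux hb ha hc).1

/-- `cross_aux` gives commutation with `a` and `c` only; the symmetry in `a` and `b` supplies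
commutation with `b`. -/
theorem cross_comm (h : IsSandwichClosed S) (ha : a ∈ S) (hb : b ∈ S) (hc : c ∈ S) :
    crossComm b a c = crossComm a b c := by
  obtain ⟨-, hcm, hpm, hDm, hwD⟩ := h.cross_aux ha hb hc
  have hpw := h.gcomm_pair ha hb hc
  have hpv := h.gcomm_pair hb ha hc
  have hwm : Commute (crossComm a b c) (pairComm a b c) := by
    refine Commute.gcomm_right hpm.symm ?_
    exact Commute.gcomm_right (h.cross_aux ha hb hc).1.symm hcm.symm
  have hm : crossComm a b c = gcomm (gcomm a b) (reducedComm a b c) := rfl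
  rw [crossComm, reducedComm, h.gcomm_inv_gcomm ha hb hc]
  rw [← gcomm_inv a b] at *
  generalize crossComm a b c = m at *
  generalize pairComm a b c = w at *
  generalize pairComm b a c = v at *
  generalize reducedComm a b c = D at *
  generalize gcomm a b = p at *
  have e1 : p * D * p⁻¹ = D * m := by
    have : p * D * p⁻¹ = D * (p * m * p⁻¹) := by rw [hm]; simp only [gcomm]; group
    rw [this, hpm.eq]; group
  have hpv' : Commute p v := by simpa using hpv.inv_left
  calc gcomm p⁻¹ (v⁻¹ * (D⁻¹ * (m⁻¹ * w⁻¹)))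
      = (p * w * p⁻¹) * (p * m * p⁻¹) * (p * D * p⁻¹) * (p * v * p⁻¹) * v⁻¹ * D⁻¹ * m⁻¹ * w⁻¹ := by
        simp only [gcomm]; group
    _ = w * m * (D * m) * D⁻¹ * m⁻¹ * w⁻¹ := by rw [e1, hpw.eq, hpm.eq, hpv'.eq]; group
    _ = w * m * w⁻¹ := by rw [hDm.eq]; group
    _ = m := by rw [← hwm.eq]; group

theorem cross_commute_mid (h : IsSandwichClosed S) (ha : a ∈ S) (hb : b ∈ S) (hc : c ∈ S) :
    Commute b (crossComm a b c) := by
  rw [← h.cross_comm ha hb hc]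
  exact (h.cross_aux hb ha hc).1
end IsSandwichClosed

/-! ### Commutators modulo the centre and three-element generating sets -/

section Central
variable {G : Type*} [Group G]

theorem gcomm_mul_left_of_central {a b c : G} (h : ∀ g, Commute g (gcomm a c)) :
    gcomm (a * b) c = gcomm a c * gcomm b c := by
  rw [gcomm_mul_left, (h b⁻¹).eq]; group

theorem gcomm_mul_right_of_central {a b c : G} (h : ∀ g, Commute g (gcomm a b)) :
    gcomm a (b * c) = gcomm a b * gcomm a c := by
  rw [gcomm_mul_right, (h c⁻¹).eq, ← (h (gcomm a c)).eq]; group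

/-- If `t` is multiplied by `e` resp. `f` under conjugation by `u` resp. `v`, with `e`, `f` central
modulo central elements, then the conjugation action of `[u, v]` on `t` is determined. -/
theorem gcomm_gcomm_eq {t u v e f i j : G}
    (hu : gcomm t u = e) (hv : gcomm t v = f) (hi : gcomm e v = i) (hj : gcomm f u = j)
    (hef : Commute e f) (hci : ∀ g, Commute g i) (hcj : ∀ g, Commute g j)
    (hek : Commute e (gcomm u v)) (hfk : Commute f (gcomm u v)) :
    gcomm t (gcomm u v) = i * j⁻¹ := by
  have e1 : u⁻¹ * t * u = t * e := by rw [conj_eq_mul_gcomm, hu]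
  have e2 : v⁻¹ * t * v = t * f := by rw [conj_eq_mul_gcomm, hv]
  have e3 : v⁻¹ * e * v = e * i := by rw [conj_eq_mul_gcomm, hi]
  have e4 : u⁻¹ * f * u = f * j := by rw [conj_eq_mul_gcomm, hj]
  have e5 : (u * v)⁻¹ * t * (u * v) = t * f * (e * i) := by
    calc _ = v⁻¹ * (u⁻¹ * t * u) * v := by group
      _ = (v⁻¹ * t * v) * (v⁻¹ * e * v) := by rw [e1]; group
      _ = _ := by rw [e2, e3]
  have e6 : (v * u)⁻¹ * t * (v * u) = t * e * (f * j) := by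
    calc _ = u⁻¹ * (v⁻¹ * t * v) * u := by group
      _ = (u⁻¹ * t * u) * (u⁻¹ * f * u) := by rw [e2]; group
      _ = _ := by rw [e1, e4]
  have e7 : (gcomm u v)⁻¹ * (t * e * (f * j)) * gcomm u v = t * f * (e * i) := by
    rw [← e5, ← e6]; simp only [gcomm]; group
  have hk : Commute (e * (f * j)) (gcomm u v) := hek.mul_left (hfk.mul_left (hcj _).symm)
  generalize gcomm u v = k at *
  have e8 : k⁻¹ * t * k * (e * (f * j)) = t * f * (e * i) := by
    rw [← e7]
    calc _ = k⁻¹ * t * (k * (e * (f * j))) := by group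
      _ = _ := by rw [← hk.eq]; group
  calc gcomm t k = t⁻¹ * (k⁻¹ * t * k * (e * (f * j))) * (e * (f * j))⁻¹ := by
        simp only [gcomm]; group
    _ = (f * e) * (i * j⁻¹) * (e * f)⁻¹ := by rw [e8]; group
    _ = (f * e) * ((e * f)⁻¹ * (i * j⁻¹)) := by
        rw [mul_assoc, ((hci _).mul_right (hcj _).inv_right).eq]
    _ = _ := by rw [hef.eq]; group

/-- Every subgroup containing `a`, `b` and `c` is everything. -/
def Generates (a b c : G) : Prop := ∀ H : Subgroup G, a ∈ H → b ∈ H → c ∈ H → ∀ g, g ∈ H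

namespace Generates
variable {a b c : G}

theorem swap_left (hg : Generates a b c) : Generates b a c := fun H hb ha hc => hg H ha hb hc
theorem swap_right (hg : Generates a b c) : Generates a c b := fun H ha hc hb => hg H ha hb hc
theorem rotate (hg : Generates a b c) : Generates b c a := fun H hb hc ha => hg H ha hb hc

theorem central (hg : Generates a b c) {t : G} (ha : Commute a t) (hb : Commute b t)
    (hc : Commute c t) (g : G) : Commute g t := by
  have := hg (Subgroup.centralizer {t}) (Subgroup.mem_centralizer_singleton_iff.2 ha.eq)
    (Subgroup.mem_centralizer_singleton_iff.2 hb.eq)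
    (Subgroup.mem_centralizer_singleton_iff.2 hc.eq) g
  exact Subgroup.mem_centralizer_singleton_iff.1 this

theorem central_gcomm (hg : Generates a b c) {w : G} (ha : ∀ g, Commute g (gcomm w a))
    (hb : ∀ g, Commute g (gcomm w b)) (hc : ∀ g, Commute g (gcomm w c)) (t g : G) :
    Commute g (gcomm w t) := by
  let H : Subgroup G :=
    { carrier := {t | ∀ g, Commute g (gcomm w t)}
      one_mem' := fun g => by simp [gcomm]
      mul_mem' := fun {x y} hx hy g => by
        rw [gcomm_mul_right_of_central hx]
        exact (hx g).mul_right (hy g)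
      inv_mem' := fun {x} hx g => by
        rw [gcomm_inv_right (hx x)]
        exact (hx g).inv_right }
  exact hg H ha hb hc t g

/-- The hypotheses place `w` in the second centre, which centralizes the derived subgroup. -/
theorem commute_gcomm (hg : Generates a b c) {w : G} (ha : ∀ g, Commute g (gcomm w a))
    (hb : ∀ g, Commute g (gcomm w b)) (hc : ∀ g, Commute g (gcomm w c)) (x y : G) :
    Commute w (gcomm x y) := by
  have hx := hg.central_gcomm ha hb hc x
  have hy := hg.central_gcomm ha hb hc y
  rw [← gcomm_eq_one_iff]
  rw [gcomm_gcomm_eq rfl rfl rfl rfl (hy _) _ _ (hx _).symm (hy _).symm,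
    gcomm_eq_one_iff.2 (hx _).symm, gcomm_eq_one_iff.2 (hy _).symm]
  · simp
  · rw [gcomm_eq_one_iff.2 (hx _).symm]; exact fun g => Commute.one_right g
  · rw [gcomm_eq_one_iff.2 (hy _).symm]; exact fun g => Commute.one_right g

end Generates
end Central

/-! ### Commutator table of a three-generator sandwich group -/

namespace IsSandwichClosed
variable {G : Type*} [Group G] {S : Set G} {a b c : G}

theorem central_top (h : IsSandwichClosed S) (ha : a ∈ S) (hb : b ∈ S) (hc : c ∈ S)
    (hg : Generates a b c) (g : G) : Commute g (topComm a b c) :=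
  hg.central (h.top_aux ha hb hc).1 (h.top_commute_mid ha hb hc) (h.top_aux ha hb hc).2.1 g

theorem central_cross (h : IsSandwichClosed S) (ha : a ∈ S) (hb : b ∈ S) (hc : c ∈ S)
    (hg : Generates a b c) (g : G) : Commute g (crossComm a b c) :=
  hg.central (h.cross_aux ha hb hc).1 (h.cross_commute_mid ha hb hc) (h.cross_aux ha hb hc).2.1 g

theorem gcomm_pair_left (h : IsSandwichClosed S) (ha : a ∈ S) (hb : b ∈ S) (hc : c ∈ S) :
    gcomm (pairComm a b c) a = 1 := gcomm_eq_one_iff.2 (h.left_pair ha hb hc).symm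

theorem pair_commute_gcomm (h : IsSandwichClosed S) (ha : a ∈ S) (hb : b ∈ S) (hc : c ∈ S)
    (hg : Generates a b c) (x y : G) : Commute (pairComm a b c) (gcomm x y) := by
  refine hg.commute_gcomm ?_ ?_ ?_ x y
  · rw [h.gcomm_pair_left ha hb hc]; exact fun g => Commute.one_right g
  · rw [h.gcomm_pair_mid ha hb hc]; exact h.central_top ha hc hb hg.swap_right
  · exact h.central_top ha hb hc hg

theorem gcomm_triple_right (h : IsSandwichClosed S) (ha : a ∈ S) (hb : b ∈ S) (hc : c ∈ S)
    (hg : Generates a b c) : gcomm (gcomm (gcomm a b) c) c = topComm a b c := by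
  rw [gcomm_eq_pair_mul_reduced a b c, gcomm_mul_left_of_central (h.central_top ha hb hc hg),
    gcomm_eq_one_iff.2 (h.right_reduced ha hc).symm, mul_one, topComm]

theorem gcomm_triple_left (h : IsSandwichClosed S) (ha : a ∈ S) (hb : b ∈ S) (hc : c ∈ S) :
    gcomm (gcomm (gcomm a b) c) a = pairComm a b c * crossComm a b c := by
  rw [gcomm_eq_pair_mul_reduced a b c, gcomm_mul_left, h.gcomm_pair_left ha hb hc,
    h.gcomm_reduced_left ha hb hc]
  group

/-- Since `[a, b] = [b, a]⁻¹`, the commutator `[a, b, c]` is a conjugate of `[b, a, c]⁻¹`. The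
formula is thus `gcomm_triple_left` with `a` and `b` exchanged, the cross commutator being
symmetric. -/
theorem gcomm_triple_mid (h : IsSandwichClosed S) (ha : a ∈ S) (hb : b ∈ S) (hc : c ∈ S)
    (hg : Generates a b c) :
    gcomm (gcomm (gcomm a b) c) b = (pairComm b a c)⁻¹ * (crossComm a b c)⁻¹ := by
  have h1 := h.gcomm_triple_left hb ha hc
  rw [h.cross_comm ha hb hc] at h1
  have hpb := (h.comm_right ha hb)
  have hv := h.pair_commute_gcomm hb ha hc hg.swap_left
  have hm := h.central_cross ha hb hc hg
  have hvp := (hv a b).mul_left (hm (gcomm a b)).symm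
  have hvy := (hv (gcomm b a) c).mul_left (hm (gcomm (gcomm b a) c)).symm
  have e1 : gcomm (gcomm a b) c = (gcomm a b)⁻¹ * (gcomm (gcomm b a) c)⁻¹ * gcomm a b := by
    rw [← gcomm_inv a b]
    generalize gcomm a b = p
    simp only [gcomm]; group
  rw [e1]
  generalize gcomm (gcomm b a) c = y at *
  generalize gcomm a b = p at *
  have hbp : p⁻¹ * b * p = b := by rw [mul_assoc, hpb.eq]; group
  have e2 : gcomm (p⁻¹ * y⁻¹ * p) b = p⁻¹ * (y * (gcomm y b)⁻¹ * y⁻¹) * p := by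
    calc _ = p⁻¹ * y * p * b⁻¹ * (p⁻¹ * y⁻¹ * p) * b := by simp only [gcomm]; group
      _ = p⁻¹ * y * p * (p⁻¹ * b * p)⁻¹ * (p⁻¹ * y⁻¹ * p) * (p⁻¹ * b * p) := by rw [hbp]
      _ = _ := by simp only [gcomm]; group
  rw [e2, h1]
  rw [← hvy.inv_left.eq, mul_inv_cancel_right, mul_assoc, hvp.inv_left.eq, inv_mul_cancel_left,
    mul_inv_rev, ((hm _).symm.inv_left).eq]

theorem gcomm_pair_central (h : IsSandwichClosed S) (ha : a ∈ S) (hb : b ∈ S) (hc : c ∈ S)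
    {m : G} (hm : ∀ g, Commute g m) :
    gcomm (pairComm a b c * m) b = topComm a c b := by
  have : gcomm m b = 1 := gcomm_eq_one_iff.2 (hm b).symm
  rw [gcomm_mul_left, this, h.gcomm_pair_mid ha hb hc, mul_one, (hm _).symm.inv_left.eq]
  group

/-- `[[a, b], [a, b, c]]` is a product of two of the central commutators. -/
theorem cross_eq (h : IsSandwichClosed S) (ha : a ∈ S) (hb : b ∈ S) (hc : c ∈ S)
    (hg : Generates a b c) : crossComm a b c = topComm b c a * topComm a c b := by
  have hm := h.central_cross ha hb hc hg
  have hw := h.pair_commute_gcomm ha hb hc hg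
  have hv := h.pair_commute_gcomm hb ha hc hg.swap_left
  have hsb := h.central_top ha hc hb hg.swap_right
  have hsa := h.central_top hb hc ha hg.rotate
  have i1 := h.gcomm_pair_central ha hb hc hm
  have j1 : gcomm ((pairComm b a c)⁻¹ * (crossComm a b c)⁻¹) a = topComm b c a := by
    have : gcomm (crossComm a b c)⁻¹ a = 1 := gcomm_eq_one_iff.2 (hm a).symm.inv_left
    rw [gcomm_mul_left, this, mul_one, gcomm_inv_left, h.gcomm_pair_mid hb ha hc,
      h.top_inv hb hc ha, mul_assoc, (hsa _).symm.eq]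
    · group
    · rw [h.gcomm_pair_mid hb ha hc]; exact hsa _
  -- The actions of `a` and `b` on `[a, b, c]` determine the action of `[a, b]`; the same commutator
  -- is also the inverse of the cross commutator.
  have key := gcomm_gcomm_eq (h.gcomm_triple_left ha hb hc) (h.gcomm_triple_mid ha hb hc hg) i1 j1
    (Commute.mul_left (Commute.mul_right ((hw _ _).inv_right) (hm _).inv_right)
      (Commute.symm (hm _))) hsb hsa ((hw _ _).mul_left (hm _).symm)
    ((hv _ _).inv_left.mul_left (hm _).symm.inv_left)
  have e : crossComm a b c = (gcomm (gcomm (gcomm a b) c) (gcomm a b))⁻¹ := by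
    rw [gcomm_inv, gcomm_eq_pair_mul_reduced a b c, gcomm_mul_right,
      gcomm_eq_one_iff.2 (h.gcomm_pair ha hb hc), crossComm]
    group
  rw [e, key, mul_inv_rev, inv_inv, h.top_inv ha hc hb]

end IsSandwichClosed

namespace IsSandwichClosed
variable {G : Type*} [Group G] {S : Set G} {a b c : G}

/-- `[[a, b, c], [a, b]]`. -/
theorem gcomm_triple_gcomm (h : IsSandwichClosed S) (ha : a ∈ S) (hb : b ∈ S) (hc : c ∈ S)
    (hg : Generates a b c) :
    gcomm (gcomm (gcomm a b) c) (gcomm a b) = topComm a c b * topComm b c a := by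
  have e : crossComm a b c = (gcomm (gcomm (gcomm a b) c) (gcomm a b))⁻¹ := by
    rw [gcomm_inv, gcomm_eq_pair_mul_reduced a b c, gcomm_mul_right,
      gcomm_eq_one_iff.2 (h.gcomm_pair ha hb hc), crossComm]
    group
  rw [← inv_inv (gcomm _ _), ← e, h.cross_eq ha hb hc hg, mul_inv_rev, h.top_inv ha hc hb,
    h.top_inv hb hc ha]

/-- `[[a, b, c], [a, c]]`. -/
theorem gcomm_triple_gcomm_right (h : IsSandwichClosed S) (ha : a ∈ S) (hb : b ∈ S) (hc : c ∈ S)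
    (hg : Generates a b c) :
    gcomm (gcomm (gcomm a b) c) (gcomm a c) = topComm a b c := by
  have hm := h.central_cross ha hb hc hg
  have hs := h.central_top ha hb hc hg
  have hw := h.pair_commute_gcomm ha hb hc hg
  have hi : gcomm (pairComm a b c * crossComm a b c) c = topComm a b c := by
    rw [gcomm_mul_left_of_central hs, gcomm_eq_one_iff.2 (hm c).symm, mul_one, topComm]
  have hj : gcomm (topComm a b c) a = 1 := gcomm_eq_one_iff.2 (hs a).symm
  rw [gcomm_gcomm_eq (h.gcomm_triple_left ha hb hc) (h.gcomm_triple_right ha hb hc hg) hi hj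
    (hs _) hs (fun g => Commute.one_right g) ((hw _ _).mul_left (hm _).symm) (hs _).symm]
  simp

/-- `[[a, b, c], [b, c]]`. -/
theorem gcomm_triple_gcomm_mid (h : IsSandwichClosed S) (ha : a ∈ S) (hb : b ∈ S) (hc : c ∈ S)
    (hg : Generates a b c) :
    gcomm (gcomm (gcomm a b) c) (gcomm b c) = topComm a b c := by
  have hm := h.central_cross ha hb hc hg
  have hs := h.central_top ha hb hc hg
  have hs' := h.central_top hb ha hc hg.swap_left
  have hv := h.pair_commute_gcomm hb ha hc hg.swap_left
  have hi : gcomm ((pairComm b a c)⁻¹ * (crossComm a b c)⁻¹) c = topComm a b c := by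
    have e : gcomm (pairComm b a c)⁻¹ c = topComm a b c := by
      rw [gcomm_inv_left (hs' _)]
      exact (h.top_inv hb ha hc).trans (h.top_comm ha hb hc)
    rw [gcomm_mul_left_of_central (by rw [e]; exact hs), e,
      gcomm_eq_one_iff.2 (hm c).symm.inv_left, mul_one]
  have hj : gcomm (topComm a b c) b = 1 := gcomm_eq_one_iff.2 (hs b).symm
  rw [gcomm_gcomm_eq (h.gcomm_triple_mid ha hb hc hg) (h.gcomm_triple_right ha hb hc hg) hi hj
    (hs _) hs (fun g => Commute.one_right g) ((hv _ _).inv_left.mul_left (hm _).symm.inv_left)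
    (hs _).symm]
  simp

/-- `[a, b, c]` and `[a, c, b]` commute. -/
theorem triple_commute_triple (h : IsSandwichClosed S) (ha : a ∈ S) (hb : b ∈ S) (hc : c ∈ S)
    (hg : Generates a b c) :
    Commute (gcomm (gcomm a b) c) (gcomm (gcomm a c) b) := by
  have hm := h.central_cross ha hb hc hg
  have hs := h.central_top ha hb hc hg
  have hv := h.pair_commute_gcomm hb ha hc hg.swap_left
  have hi : gcomm (topComm a b c) b = 1 := gcomm_eq_one_iff.2 (hs b).symm
  have hj : gcomm ((pairComm b a c)⁻¹ * (crossComm a b c)⁻¹) (gcomm a c) = 1 :=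
    gcomm_eq_one_iff.2 ((hv _ _).inv_left.mul_left (hm _).symm.inv_left)
  rw [← gcomm_eq_one_iff, gcomm_gcomm_eq (h.gcomm_triple_gcomm_right ha hb hc hg)
    (h.gcomm_triple_mid ha hb hc hg) hi hj (hs _).symm (fun g => Commute.one_right g)
    (fun g => Commute.one_right g) (hs _).symm
    ((hv _ _).inv_left.mul_left (hm _).symm.inv_left)]
  simp

theorem gcomm_gcomm_pair (h : IsSandwichClosed S) (ha : a ∈ S) (hb : b ∈ S) (hc : c ∈ S) :
    gcomm (gcomm a b) (gcomm b c) = pairComm b c a := by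
  rw [pairComm, ← gcomm_inv b a, gcomm_inv_left, gcomm_inv]
  exact h.gcomm_pair hb ha hc

theorem gcomm_gcomm_pair_right (h : IsSandwichClosed S) (ha : a ∈ S) (hb : b ∈ S) (hc : c ∈ S) :
    gcomm (gcomm a c) (gcomm b c) = pairComm c a b := by
  have h1 : gcomm (gcomm c a)⁻¹ (gcomm c b) = (pairComm c a b)⁻¹ :=
    gcomm_inv_left (h.gcomm_pair hc ha hb)
  rw [← gcomm_inv c a, ← gcomm_inv c b, gcomm_inv_right, h1, inv_inv]
  rw [h1]
  exact (h.gcomm_pair_right hc ha hb).inv_right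

theorem pairComm_rotate (a b c : G) : pairComm b a c = (pairComm b c a)⁻¹ := pairComm_swap b c a

/-- The Hall–Witt identity, which expresses `[b, c, a]` through `[a, b, c]` and `[a, c, b]`. -/
theorem gcomm_hall_witt (h : IsSandwichClosed S) (ha : a ∈ S) (hb : b ∈ S) (hc : c ∈ S)
    (hg : Generates a b c) :
    gcomm (gcomm b c) a = gcomm (gcomm a c) b * (gcomm (gcomm a b) c)⁻¹ * pairComm c a b *
      pairComm b c a * pairComm a b c * topComm a c b := by
  have hsb := h.central_top ha hc hb hg.swap_right
  have h4 := h.pair_commute_gcomm ha hb hc hg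
  have h5 := h.pair_commute_gcomm hb hc ha hg.rotate
  have h6 := h.pair_commute_gcomm hc ha hb hg.rotate.rotate
  have hp : (gcomm b c)⁻¹ * gcomm a b * gcomm b c = gcomm a b * pairComm b c a := by
    rw [conj_eq_mul_gcomm, h.gcomm_gcomm_pair ha hb hc]
  have hq : (gcomm b c)⁻¹ * gcomm a c * gcomm b c = gcomm a c * pairComm c a b := by
    rw [conj_eq_mul_gcomm, h.gcomm_gcomm_pair_right ha hb hc]
  have hx : (gcomm b c)⁻¹ * gcomm (gcomm a c) b * gcomm b c =
      gcomm (gcomm a c) b * topComm a c b := by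
    have e := h.gcomm_triple_gcomm_mid ha hc hb hg.swap_right
    rw [conj_eq_mul_gcomm, ← gcomm_inv c b, gcomm_inv_right, e, h.top_inv ha hc hb]
    rw [e]; exact hsb _
  -- Both triple commutators have the same commutator with `[a, c] * [a, b]`, namely the product of
  -- the three central elements, so it cancels in their quotient.
  have hy : Commute (gcomm a c * gcomm a b) (gcomm (gcomm a c) b * (gcomm (gcomm a b) c)⁻¹) := by
    have e1 : gcomm (gcomm (gcomm a c) b) (gcomm a c * gcomm a b) =
        topComm a b c * topComm b c a * topComm a c b := by
      have e := h.gcomm_triple_gcomm ha hc hb hg.swap_right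
      have e' := h.gcomm_triple_gcomm_right ha hc hb hg.swap_right
      rw [gcomm_mul_right_of_central, e, e', ← h.top_comm hb hc ha]
      rw [e]
      exact fun g => (h.central_top ha hb hc hg g).mul_right
        (h.central_top hc hb ha hg.rotate.swap_left g)
    have e2 : gcomm (gcomm (gcomm a b) c) (gcomm a c * gcomm a b) =
        topComm a b c * topComm b c a * topComm a c b := by
      have e := h.gcomm_triple_gcomm ha hb hc hg
      have e' := h.gcomm_triple_gcomm_right ha hb hc hg
      rw [gcomm_mul_right_of_central, e, e', (hsb _).symm.eq, mul_assoc]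
      rw [e']
      exact h.central_top ha hb hc hg
    have hcen : ∀ g, Commute g (topComm a b c * topComm b c a * topComm a c b) := fun g =>
      ((h.central_top ha hb hc hg g).mul_right (h.central_top hb hc ha hg.rotate g)).mul_right
        (hsb g)
    generalize topComm a b c * topComm b c a * topComm a c b = s at *
    generalize gcomm a c * gcomm a b = k at *
    generalize gcomm (gcomm a c) b = x at *
    generalize gcomm (gcomm a b) c = y at *
    refine Commute.symm (gcomm_eq_one_iff.1 ?_)
    have e3 : gcomm y⁻¹ k = s⁻¹ := by
      rw [← e2]; exact gcomm_inv_left (by rw [e2]; exact hcen y)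
    rw [gcomm_mul_left_of_central (by rw [e1]; exact hcen), e1, e3, mul_inv_cancel]
  have hap := h.comm_left ha hb
  have haq := h.comm_left ha hc
  -- This is `(a ^ (c * b)) ^ [b, c] = a ^ (b * c)`, both sides expanded in commutators.
  have key : (gcomm b c)⁻¹ * (a * gcomm a b * (gcomm a c * gcomm (gcomm a c) b)) * gcomm b c =
      a * gcomm a c * (gcomm a b * gcomm (gcomm a b) c) := by
    simp only [gcomm]; group
  have hw : gcomm a b * gcomm a c = gcomm a c * gcomm a b * pairComm a b c := by
    simp only [pairComm]
    generalize gcomm a b = p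
    generalize gcomm a c = q
    simp only [gcomm]; group
  have c4y := (h4 (gcomm a c) b).mul_right (h4 (gcomm a b) c).inv_right
  have c45 : Commute (pairComm b c a) (pairComm a b c) := h5 _ _
  have c46 : Commute (pairComm c a b) (pairComm a b c) := h6 _ _
  have c5 := (h5 a c).mul_right (h5 (gcomm a c) b)
  have c56 : Commute (pairComm b c a) (pairComm c a b) := h5 _ _
  have c6 := h6 (gcomm a c) b
  have k4 := (h4 a c).mul_right (h4 a b)
  have k5 : Commute (pairComm b c a) ((gcomm (gcomm a b) c)⁻¹ * (gcomm a b)⁻¹ * (gcomm a c)⁻¹) :=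
    ((h5 _ _).inv_right.mul_right (h5 _ _).inv_right).mul_right (h5 _ _).inv_right
  have k6 : Commute (pairComm c a b) ((gcomm (gcomm a b) c)⁻¹ * (gcomm a b)⁻¹ * (gcomm a c)⁻¹) :=
    ((h6 _ _).inv_right.mul_right (h6 _ _).inv_right).mul_right (h6 _ _).inv_right
  have e0 : gcomm (gcomm b c) a =
      (gcomm b c)⁻¹ * (gcomm a b * (gcomm a c * gcomm (gcomm a c) b)) * gcomm b c *
        (gcomm a c * (gcomm a b * gcomm (gcomm a b) c))⁻¹ := by
    have e : (gcomm b c)⁻¹ * (gcomm a b * (gcomm a c * gcomm (gcomm a c) b)) * gcomm b c =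
        ((gcomm b c)⁻¹ * a * gcomm b c)⁻¹ *
          (a * gcomm a c * (gcomm a b * gcomm (gcomm a b) c)) := by
      rw [← key]; group
    rw [e]
    generalize gcomm b c = o
    simp only [gcomm]; group
  have e1 : (gcomm b c)⁻¹ * (gcomm a b * (gcomm a c * gcomm (gcomm a c) b)) * gcomm b c =
      gcomm a b * pairComm b c a * (gcomm a c * pairComm c a b *
        (gcomm (gcomm a c) b * topComm a c b)) := by
    rw [← hp, ← hq, ← hx]; group
  rw [e0, e1]
  generalize pairComm a b c = w at *
  generalize pairComm b c a = v at *
  generalize pairComm c a b = u at *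
  generalize gcomm (gcomm a c) b = x at *
  generalize gcomm (gcomm a b) c = y at *
  generalize topComm a c b = s at *
  generalize gcomm a c = q at *
  generalize gcomm a b = p at *
  calc p * v * (q * u * (x * s)) * (q * (p * y))⁻¹
      = p * v * (q * (u * x) * s) * (y⁻¹ * p⁻¹ * q⁻¹) := by group
    _ = p * (v * (q * x)) * (u * s) * (y⁻¹ * p⁻¹ * q⁻¹) := by rw [c6.eq]; group
    _ = p * q * x * (v * (u * (s * (y⁻¹ * p⁻¹ * q⁻¹)))) := by rw [c5.eq]; group
    _ = p * q * x * (v * (u * (y⁻¹ * p⁻¹ * q⁻¹))) * s := by rw [← (hsb _).eq]; group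
    _ = p * q * x * (v * (y⁻¹ * p⁻¹ * q⁻¹)) * u * s := by rw [k6.eq]; group
    _ = p * q * (x * y⁻¹) * p⁻¹ * q⁻¹ * v * u * s := by rw [k5.eq]; group
    _ = q * p * (w * (x * y⁻¹)) * p⁻¹ * q⁻¹ * v * u * s := by rw [hw]; group
    _ = (q * p * (x * y⁻¹)) * w * p⁻¹ * q⁻¹ * v * u * s := by rw [c4y.eq]; group
    _ = x * y⁻¹ * (q * p * w) * p⁻¹ * q⁻¹ * v * u * s := by rw [hy.eq]; group
    _ = x * y⁻¹ * (w * (q * p)) * p⁻¹ * q⁻¹ * v * u * s := by rw [k4.eq]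
    _ = x * y⁻¹ * (w * (v * u)) * s := by group
    _ = x * y⁻¹ * (v * u * w) * s := by rw [(c45.mul_left c46).symm.eq]
    _ = _ := by rw [c56.eq]; group


/-- The element `a` commutes with the reduced form of `[b, c, a]`. After the Hall–Witt formula is
inserted, `a` must commute with `x * y⁻¹ * u`, where `x = [a, c, b]`, `y = [a, b, c]` and `u = [[c,
a], [c, b]]`. Conjugation by `a` multiplies this product by `w⁻¹ * w⁻¹` and central elements, which
therefore cancel. -/
theorem pair_sq (h : IsSandwichClosed S) (ha : a ∈ S) (hb : b ∈ S) (hc : c ∈ S)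
    (hg : Generates a b c) :
    pairComm a b c * pairComm a b c = topComm a c b * topComm b c a * topComm a b c := by
  have hsa := h.central_top hb hc ha hg.rotate
  have hsb := h.central_top ha hc hb hg.swap_right
  have hsc := h.central_top ha hb hc hg
  have h4 := h.pair_commute_gcomm ha hb hc hg
  have h5 := h.pair_commute_gcomm hb hc ha hg.rotate
  have h6 := h.pair_commute_gcomm hc ha hb hg.rotate.rotate
  have haw := h.left_pair ha hb hc
  have h1 : Commute a (reducedComm b c a) := h.right_reduced hb ha
  have c46 : Commute (pairComm c a b) (pairComm a b c) := h6 _ _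
  have c56 : Commute (pairComm b c a) (pairComm c a b) := h5 _ _
  have c4y := h4 (gcomm a b) c
  have c4x := h4 (gcomm a c) b
  have c5 := ((h5 (gcomm a c) b).mul_right (h5 (gcomm a b) c).inv_right).mul_right c56
  have hy : a⁻¹ * gcomm (gcomm a b) c * a = gcomm (gcomm a b) c *
      (pairComm a b c * (topComm b c a * topComm a c b)) := by
    rw [conj_eq_mul_gcomm, h.gcomm_triple_left ha hb hc, h.cross_eq ha hb hc hg]
  have hx : a⁻¹ * gcomm (gcomm a c) b * a = gcomm (gcomm a c) b *
      ((pairComm a b c)⁻¹ * (topComm b c a * topComm a b c)) := by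
    rw [conj_eq_mul_gcomm, h.gcomm_triple_left ha hc hb, h.cross_eq ha hc hb hg.swap_right,
      h.top_comm hb hc ha, pairComm_swap]
  have hu : a⁻¹ * pairComm c a b * a = pairComm c a b * topComm b c a := by
    rw [conj_eq_mul_gcomm, h.gcomm_pair_mid hc ha hb, h.top_comm hb hc ha]
  rw [reducedComm, h.gcomm_hall_witt ha hb hc hg] at h1
  have ib := h.top_inv ha hc hb
  generalize pairComm a b c = w at *
  generalize pairComm b c a = v at *
  generalize pairComm c a b = u at *
  generalize gcomm (gcomm a c) b = x at *
  generalize gcomm (gcomm a b) c = y at *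
  generalize topComm a c b = sb at *
  generalize topComm b c a = sa at *
  generalize topComm a b c = sc at *
  have e1 : v⁻¹ * (x * y⁻¹ * u * v * w * sb) = x * y⁻¹ * u * (w * sb) := by
    calc v⁻¹ * (x * y⁻¹ * u * v * w * sb) = v⁻¹ * ((x * y⁻¹ * u) * v) * w * sb := by group
      _ = _ := by rw [c5.symm.eq]; group
  rw [e1] at h1
  have h2 : Commute a (x * y⁻¹ * u) :=
    h1.of_mul_right' (haw.mul_right (hsb a))
  have e2 : a⁻¹ * (x * y⁻¹ * u) * a = x * y⁻¹ * u := by rw [mul_assoc, h2.symm.eq]; group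
  have e3 : a⁻¹ * (x * y⁻¹ * u) * a =
      x * (w⁻¹ * (sa * sc)) * (y * (w * (sa * sb)))⁻¹ * (u * sa) := by
    rw [← hx, ← hy, ← hu]; group
  have e4 : x * (w⁻¹ * (sa * sc)) * (y * (w * (sa * sb)))⁻¹ * (u * sa) =
      x * y⁻¹ * u * (w⁻¹ * w⁻¹) * (sb⁻¹ * sa * sc) := by
    have cu : Commute (w⁻¹ * w⁻¹) (y⁻¹ * u) :=
      (c4y.inv_right.mul_right c46.symm).inv_left.mul_left
        (c4y.inv_right.mul_right c46.symm).inv_left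
    calc _ = x * w⁻¹ * (sa * (sc * (sb⁻¹ * sa⁻¹))) * w⁻¹ * (y⁻¹ * u) * sa := by group
      _ = x * w⁻¹ * (w⁻¹ * (sa * (sc * (sb⁻¹ * sa⁻¹)))) * (y⁻¹ * u) * sa := by
        rw [mul_assoc (x * w⁻¹), ((hsa _).mul_right ((hsc _).mul_right
          ((hsb _).inv_right.mul_right (hsa _).inv_right))).eq]
      _ = x * w⁻¹ * w⁻¹ * ((sa * (sc * (sb⁻¹ * sa⁻¹))) * (y⁻¹ * u)) * sa := by group
      _ = x * ((w⁻¹ * w⁻¹) * (y⁻¹ * u)) * (sa * (sc * (sb⁻¹ * sa⁻¹))) * sa := by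
        rw [← ((hsa _).mul_right ((hsc _).mul_right
          ((hsb _).inv_right.mul_right (hsa _).inv_right))).eq]; group
      _ = x * y⁻¹ * u * (w⁻¹ * w⁻¹) * (sa * (sc * sb⁻¹)) := by rw [cu.eq]; group
      _ = _ := by
        rw [← mul_assoc sa, ((hsb (sa * sc)).inv_right).eq]; group
  rw [e3, e4, mul_assoc] at e2
  have e5 := mul_eq_left.1 e2
  rw [ib] at e5
  calc w * w = (w⁻¹ * w⁻¹)⁻¹ := by simp only [mul_inv_rev, inv_inv]
    _ = _ := inv_eq_of_mul_eq_one_right e5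

end IsSandwichClosed

/-! ### The relations of the presentation hold in every sandwich group -/

theorem lift_pcGen {G : Type*} [Group G] (X : Fin 14 → G) (k : ℕ) :
    FreeGroup.lift X (pcGen k) = X (Fin.ofNat 14 (k - 1)) := FreeGroup.lift_apply_of

namespace IsSandwichClosed
variable {G : Type*} [Group G] {S : Set G} {x y z : G}

theorem lift_commutatorList (h : IsSandwichClosed S) (hx : x ∈ S) (hy : y ∈ S) (hz : z ∈ S)
    (hg : Generates z x y) : ∀ r ∈ pcRels, FreeGroup.lift (commutatorList x y z) r = 1 := by
  -- The general formulas are used with `(a, b, c) = (z, x, y)` and its permutations. The elements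
  -- `x_1`, `x_2`, `x_3` are the top commutators and `x_4`, `x_5`, `x_6` the pair commutators.
  have c1 := h.central_top hz hx hy hg
  have c2 := h.central_top hx hy hz hg.rotate
  have c3 := h.central_top hz hy hx hg.swap_right
  have c4 := h.pair_commute_gcomm hz hx hy hg
  have c5 := h.pair_commute_gcomm hx hy hz hg.rotate
  have c6 := h.pair_commute_gcomm hy hz hx hg.rotate.rotate
  have s1 : topComm z x y * topComm z x y = 1 := by
    nth_rewrite 1 [← h.top_inv hz hx hy]
    group
  have s2 : topComm x y z * topComm x y z = 1 := by
    nth_rewrite 1 [← h.top_inv hx hy hz]; group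
  have s3 : topComm z y x * topComm z y x = 1 := by
    nth_rewrite 1 [← h.top_inv hz hy hx]; group
  have i1 := h.top_inv hz hx hy
  have i2 := h.top_inv hx hy hz
  have i3 := h.top_inv hz hy hx
  have q4 := h.pair_sq hz hx hy hg
  have q5 := h.pair_sq hx hy hz hg.rotate
  have q6 := h.pair_sq hy hz hx hg.rotate.rotate
  have t1 := h.top_comm hz hx hy
  have t2 := h.top_comm hx hy hz
  have t3 := h.top_comm hz hy hx
  rw [t1] at q5
  rw [t2, t3] at q6
  have m412 := h.gcomm_pair_mid hz hx hy
  have m413 : gcomm (pairComm z x y) y = topComm z x y := rfl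
  have m414 := h.gcomm_pair_left hz hx hy
  have m512 := h.gcomm_pair_left hx hy hz
  have m513 := h.gcomm_pair_mid hx hy hz
  have m514 : gcomm (pairComm x y z) z = topComm x y z := rfl
  have m612 : gcomm (pairComm y z x) x = topComm y z x := rfl
  have m613 := h.gcomm_pair_left hy hz hx
  have m614 := h.gcomm_pair_mid hy hz hx
  rw [t1] at m513
  rw [t3] at m612
  rw [t2] at m614
  -- The digits in these names are the indices `k`, `l` of the commutator `[x_k, x_l]` being
  -- evaluated; `m1114` is the Hall–Witt formula.
  have m78 := gcomm_eq_one_iff.2 (h.triple_commute_triple hz hx hy hg)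
  have m79 := h.gcomm_triple_gcomm hz hx hy hg
  have m710 := h.gcomm_triple_gcomm_right hz hx hy hg
  have m711 := h.gcomm_triple_gcomm_mid hz hx hy hg
  have m712 := h.gcomm_triple_mid hz hx hy hg
  have m713 := h.gcomm_triple_right hz hx hy hg
  have m714 := h.gcomm_triple_left hz hx hy
  rw [h.cross_eq hz hx hy hg, pairComm_rotate, inv_inv, mul_inv_rev, i2, i3] at m712
  rw [h.cross_eq hz hx hy hg] at m714
  have m810 := h.gcomm_triple_gcomm hz hy hx hg.swap_right
  have m89 := h.gcomm_triple_gcomm_right hz hy hx hg.swap_right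
  have m811' := h.gcomm_triple_gcomm_mid hz hy hx hg.swap_right
  have m811 : gcomm (gcomm (gcomm z y) x) (gcomm x y) = topComm z y x := by
    rw [← gcomm_inv y x, gcomm_inv_right, m811', i3]
    rw [m811']; exact c3 _
  have m813 := h.gcomm_triple_mid hz hy hx hg.swap_right
  have m812 := h.gcomm_triple_right hz hy hx hg.swap_right
  have m814 := h.gcomm_triple_left hz hy hx
  rw [h.cross_eq hz hy hx hg.swap_right, mul_inv_rev, i1, h.top_inv hy hx hz, t2] at m813
  rw [h.cross_eq hz hy hx hg.swap_right, pairComm_swap, t2] at m814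
  rw [t2] at m810
  have m910 : gcomm (gcomm z x) (gcomm z y) = pairComm z x y := rfl
  have m911 := h.gcomm_gcomm_pair hz hx hy
  have m1011 := h.gcomm_gcomm_pair_right hz hx hy
  have m1114 := h.gcomm_hall_witt hz hx hy hg
  have m912 := gcomm_eq_one_iff.2 (h.comm_right hz hx).symm
  have m914 := gcomm_eq_one_iff.2 (h.comm_left hz hx).symm
  have m1013 := gcomm_eq_one_iff.2 (h.comm_right hz hy).symm
  have m1014 := gcomm_eq_one_iff.2 (h.comm_left hz hy).symm
  have m1112 := gcomm_eq_one_iff.2 (h.comm_left hx hy).symm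
  have m1113 := gcomm_eq_one_iff.2 (h.comm_right hx hy).symm
  have m1214 := (gcomm_inv z x).symm
  have m1314 := (gcomm_inv z y).symm
  have d1 : gcomm (gcomm (gcomm z x) y) y = topComm z x y := m713
  have d2 : gcomm (gcomm (gcomm x y) z) z = topComm x y z :=
    h.gcomm_triple_right hx hy hz hg.rotate
  have d3 : gcomm (gcomm (gcomm y z) x) x = topComm z y x := by
    rw [h.gcomm_triple_right hy hz hx hg.rotate.rotate, t3]
  have d5 : gcomm (gcomm x y) (gcomm x z) = pairComm x y z := rfl
  have d6 : gcomm (gcomm y z) (gcomm y x) = pairComm y z x := rfl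
  have q4' : pairComm z x y * pairComm z x y =
      topComm z y x * (topComm x y z * topComm z x y) := by rw [q4, mul_assoc]
  have q5' : pairComm x y z * pairComm x y z =
      topComm z y x * (topComm x y z * topComm z x y) := by
    rw [q5, t3, (c3 _).eq, mul_assoc, (c1 _).symm.eq]
  have q6' : pairComm y z x * pairComm y z x =
      topComm z y x * (topComm x y z * topComm z x y) := by rw [q6, (c3 _).eq]
  have m79' : gcomm (gcomm (gcomm z x) y) (gcomm z x) = topComm x y z * topComm z y x := by
    rw [m79, (c3 _).symm.eq]
  have m714' : gcomm (gcomm (gcomm z x) y) z =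
      pairComm z x y * (topComm z y x * topComm x y z) := by rw [m714, (c3 _).eq]
  have m810' : gcomm (gcomm (gcomm z y) x) (gcomm z y) = topComm x y z * topComm z x y := by
    rw [m810, (c1 _).symm.eq]
  have m813' : gcomm (gcomm (gcomm z y) x) y = pairComm y z x * topComm z y x := by
    rw [m813, inv_mul_eq_iff_eq_mul, ← mul_assoc, q6', (c3 _).symm.eq, mul_assoc, s3, mul_one,
      (c1 _).symm.eq]
  have m814' : gcomm (gcomm (gcomm z y) x) z = pairComm z x y * topComm z y x := by
    rw [m814, inv_mul_eq_iff_eq_mul, ← mul_assoc, q4', (c3 _).symm.eq, mul_assoc, s3, mul_one]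
  clear q4 q5 q6 m79 m714 m810 m813 m814 m811'
  have k45 : gcomm (pairComm z x y) (pairComm x y z) = 1 := gcomm_eq_one_iff.2 (c4 _ _)
  have k46 : gcomm (pairComm z x y) (pairComm y z x) = 1 := gcomm_eq_one_iff.2 (c4 _ _)
  have k56 : gcomm (pairComm x y z) (pairComm y z x) = 1 := gcomm_eq_one_iff.2 (c5 _ _)
  have n4 : ∀ u v, gcomm (pairComm z x y) (gcomm u v) = 1 := fun u v => gcomm_eq_one_iff.2 (c4 u v)
  have n5 : ∀ u v, gcomm (pairComm x y z) (gcomm u v) = 1 := fun u v => gcomm_eq_one_iff.2 (c5 u v)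
  have n6 : ∀ u v, gcomm (pairComm y z x) (gcomm u v) = 1 := fun u v => gcomm_eq_one_iff.2 (c6 u v)
  have n1 : ∀ g, gcomm (topComm z x y) g = 1 := fun g => gcomm_eq_one_iff.2 (c1 g).symm
  have n2 : ∀ g, gcomm (topComm x y z) g = 1 := fun g => gcomm_eq_one_iff.2 (c2 g).symm
  have n3 : ∀ g, gcomm (topComm z y x) g = 1 := fun g => gcomm_eq_one_iff.2 (c3 g).symm
  have d4 : gcomm (gcomm z x) (gcomm z y) = pairComm z x y := rfl
  have sq1 : topComm z x y ^ 2 = 1 := by rw [pow_two, s1]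
  have sq2 : topComm x y z ^ 2 = 1 := by rw [pow_two, s2]
  have sq3 : topComm z y x ^ 2 = 1 := by rw [pow_two, s3]
  have hX : commutatorList x y z = ![topComm z x y, topComm x y z, topComm z y x,
      pairComm z x y, pairComm x y z, pairComm y z x, gcomm (gcomm z x) y, gcomm (gcomm z y) x,
      gcomm z x, gcomm z y, gcomm x y, x, y, z] := by
    rw [← d1, ← d2, ← d3]; rfl
  generalize commutatorList x y z = X at *
  have e1 : X (Fin.ofNat 14 (1 - 1)) = topComm z x y := by rw [hX]; rfl
  have e2 : X (Fin.ofNat 14 (2 - 1)) = topComm x y z := by rw [hX]; rfl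
  have e3 : X (Fin.ofNat 14 (3 - 1)) = topComm z y x := by rw [hX]; rfl
  have e4 : X (Fin.ofNat 14 (4 - 1)) = pairComm z x y := by rw [hX]; rfl
  have e5 : X (Fin.ofNat 14 (5 - 1)) = pairComm x y z := by rw [hX]; rfl
  have e6 : X (Fin.ofNat 14 (6 - 1)) = pairComm y z x := by rw [hX]; rfl
  have e7 : X (Fin.ofNat 14 (7 - 1)) = gcomm (gcomm z x) y := by rw [hX]; rfl
  have e8 : X (Fin.ofNat 14 (8 - 1)) = gcomm (gcomm z y) x := by rw [hX]; rfl
  have e9 : X (Fin.ofNat 14 (9 - 1)) = gcomm z x := by rw [hX]; rfl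
  have e10 : X (Fin.ofNat 14 (10 - 1)) = gcomm z y := by rw [hX]; rfl
  have e11 : X (Fin.ofNat 14 (11 - 1)) = gcomm x y := by rw [hX]; rfl
  have e12 : X (Fin.ofNat 14 (12 - 1)) = x := by rw [hX]; rfl
  have e13 : X (Fin.ofNat 14 (13 - 1)) = y := by rw [hX]; rfl
  have e14 : X (Fin.ofNat 14 (14 - 1)) = z := by rw [hX]; rfl
  rintro r (⟨k, hk1, hk2, rfl⟩ | ⟨k, l, hk, hkl, hl, rfl⟩)
  · rw [map_mul, map_inv, mul_inv_eq_one, map_pow, lift_pcGen]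
    interval_cases k
    · exact e1 ▸ sq1
    · exact e2 ▸ sq2
    · exact e3 ▸ sq3
    all_goals
      simp only [pcPower, map_mul, lift_pcGen, mul_assoc, pow_two, e1, e2, e3, e4, e5, e6]
    · exact q4'
    · exact q5'
    · exact q6'
  · rw [map_mul, map_inv, mul_inv_eq_one, map_mul, map_mul, map_inv, lift_pcGen, lift_pcGen,
      conj_eq_mul_gcomm]
    interval_cases l <;> interval_cases k <;>
      simp only [pcConj, map_mul, map_inv, lift_pcGen, mul_assoc, e1, e2, e3, e4, e5, e6, e7, e8, e9, e10, e11, e12, e13, e14,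
        n1, n2, n3, n4, n5, n6, k45, k46, k56, m412, m413, m414, m512, m513, m514, m612, m613, m614,
        m78, m79', m710, m711, m712, m713, m714', m89, m810', m811, m812, m813', m814',
        m910, m911, m912, m914, m1011, m1013, m1014, m1112, m1113, m1114, m1214, m1314, mul_one]
end IsSandwichClosed

/-! ### Upper central series and the class bounds 5 and 3 -/

section UpperCentral
variable {G : Type*} [Group G] {a b c : G}

theorem mem_upperCentralSeries_succ_iff_gcomm {n : ℕ} {t : G} :
    t ∈ Subgroup.upperCentralSeries G (n + 1) ↔
      ∀ g, gcomm t g ∈ Subgroup.upperCentralSeries G n := by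
  have e : ∀ g, gcomm t g = t⁻¹ * (⁅t, g⁻¹⁆)⁻¹ * t⁻¹⁻¹ := fun g => by
    simp only [gcomm, commutatorElement_def]; group
  have key : ∀ g, gcomm t g ∈ Subgroup.upperCentralSeries G n ↔
      ⁅t, g⁻¹⁆ ∈ Subgroup.upperCentralSeries G n := fun g => by
    rw [e]
    constructor
    · intro h
      have := (inferInstance : (Subgroup.upperCentralSeries G n).Normal).conj_mem _ h t
      rw [← inv_mem_iff]
      convert this using 1
      group
    · intro h
      exact (inferInstance : (Subgroup.upperCentralSeries G n).Normal).conj_mem _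
        (inv_mem h) t⁻¹
  rw [Subgroup.mem_upperCentralSeries_succ_iff]
  constructor
  · intro h g
    exact (key g).2 (h _)
  · intro h g
    have := (key g⁻¹).1 (h _)
    rwa [inv_inv] at this

theorem Generates.mem_upperCentralSeries (hg : Generates a b c) {n : ℕ} {t : G}
    (ha : gcomm t a ∈ Subgroup.upperCentralSeries G n)
    (hb : gcomm t b ∈ Subgroup.upperCentralSeries G n)
    (hc : gcomm t c ∈ Subgroup.upperCentralSeries G n) :
    t ∈ Subgroup.upperCentralSeries G (n + 1) := by
  have hn : (Subgroup.upperCentralSeries G n).Normal := inferInstance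
  rw [mem_upperCentralSeries_succ_iff_gcomm]
  let H : Subgroup G :=
    { carrier := {g | gcomm t g ∈ Subgroup.upperCentralSeries G n}
      one_mem' := by
        have : gcomm t 1 = 1 := by simp [gcomm]
        rw [Set.mem_ofPred_eq, this]; exact one_mem _
      mul_mem' := fun {x y} hx hy => by
        rw [Set.mem_ofPred_eq, gcomm_mul_right]
        refine mul_mem hy ?_
        have := hn.conj_mem _ hx y⁻¹
        rwa [inv_inv] at this
      inv_mem' := fun {x} hx => by
        have : gcomm t x⁻¹ = x * (gcomm t x)⁻¹ * x⁻¹ := by simp only [gcomm]; group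
        rw [Set.mem_ofPred_eq, this]
        exact hn.conj_mem _ (inv_mem hx) x }
  exact hg H ha hb hc

theorem mem_upperCentralSeries_one {t : G} (h : ∀ g, Commute g t) :
    t ∈ Subgroup.upperCentralSeries G 1 := by
  rw [mem_upperCentralSeries_succ_iff_gcomm]
  intro g
  rw [gcomm_eq_one_iff.2 (h g).symm]
  exact one_mem _

theorem nilpotentOfClassLE_of_eq_top {n : ℕ} (h : Subgroup.upperCentralSeries G n = ⊤) :
    NilpotentOfClassLE G n := by
  have : Group.IsNilpotent G := ⟨⟨n, h⟩⟩
  exact ⟨this, Subgroup.upperCentralSeries_eq_top_iff_nilpotencyClass_le.1 h⟩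

end UpperCentral

namespace IsSandwichClosed
variable {G : Type*} [Group G] {S : Set G} {a b c : G}

/-- Triple commutators of the generators with a repeated entry vanish, because `[a, b]` commutes
with `a` and `b`. Up to inversion of the inner commutator, only three remain to be tested. -/
theorem nilpotentOfClassLE_of_triple (h : IsSandwichClosed S) (ha : a ∈ S) (hb : b ∈ S)
    (hc : c ∈ S) (hg : Generates a b c) {n : ℕ}
    (h1 : gcomm (gcomm a b) c ∈ Subgroup.upperCentralSeries G n)
    (h2 : gcomm (gcomm a c) b ∈ Subgroup.upperCentralSeries G n)
    (h3 : gcomm (gcomm b c) a ∈ Subgroup.upperCentralSeries G n) :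
    NilpotentOfClassLE G (n + 2) := by
  have aux : ∀ {u v : G}, Commute u v → gcomm u v ∈ Subgroup.upperCentralSeries G n := by
    intro u v huv
    rw [gcomm_eq_one_iff.2 huv]
    exact one_mem _
  have aux' : ∀ u : G, gcomm u u ∈ Subgroup.upperCentralSeries G (n + 1) := by
    intro u
    rw [gcomm_eq_one_iff.2 (Commute.refl u)]
    exact one_mem _
  have hp : gcomm a b ∈ Subgroup.upperCentralSeries G (n + 1) :=
    hg.mem_upperCentralSeries (aux (h.comm_left ha hb).symm) (aux (h.comm_right ha hb).symm) h1
  have hq : gcomm a c ∈ Subgroup.upperCentralSeries G (n + 1) :=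
    hg.mem_upperCentralSeries (aux (h.comm_left ha hc).symm) h2 (aux (h.comm_right ha hc).symm)
  have ho : gcomm b c ∈ Subgroup.upperCentralSeries G (n + 1) :=
    hg.mem_upperCentralSeries h3 (aux (h.comm_left hb hc).symm) (aux (h.comm_right hb hc).symm)
  apply nilpotentOfClassLE_of_eq_top
  rw [Subgroup.eq_top_iff']
  refine hg _ (hg.mem_upperCentralSeries (aux' a) hp hq)
    (hg.mem_upperCentralSeries ?_ (aux' b) ho) (hg.mem_upperCentralSeries ?_ ?_ (aux' c))
  · rw [← gcomm_inv]; exact InvMemClass.inv_mem hp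
  · rw [← gcomm_inv]; exact InvMemClass.inv_mem hq
  · rw [← gcomm_inv]; exact InvMemClass.inv_mem ho

theorem pair_mem_upperCentralSeries (h : IsSandwichClosed S) (ha : a ∈ S) (hb : b ∈ S)
    (hc : c ∈ S) (hg : Generates a b c) :
    pairComm a b c ∈ Subgroup.upperCentralSeries G 2 := by
  refine hg.mem_upperCentralSeries ?_ ?_ ?_
  · rw [h.gcomm_pair_left ha hb hc]; exact one_mem _
  · rw [h.gcomm_pair_mid ha hb hc]
    exact mem_upperCentralSeries_one (h.central_top ha hc hb hg.swap_right)
  · exact mem_upperCentralSeries_one (h.central_top ha hb hc hg)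

theorem triple_mem_upperCentralSeries (h : IsSandwichClosed S) (ha : a ∈ S) (hb : b ∈ S)
    (hc : c ∈ S) (hg : Generates a b c) :
    gcomm (gcomm a b) c ∈ Subgroup.upperCentralSeries G 3 := by
  have hm : crossComm a b c ∈ Subgroup.upperCentralSeries G 2 :=
    Subgroup.upperCentralSeries_mono G one_le_two
      (mem_upperCentralSeries_one (h.central_cross ha hb hc hg))
  refine hg.mem_upperCentralSeries ?_ ?_ ?_
  · rw [h.gcomm_triple_left ha hb hc]
    exact mul_mem (h.pair_mem_upperCentralSeries ha hb hc hg) hm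
  · rw [h.gcomm_triple_mid ha hb hc hg]
    exact mul_mem (InvMemClass.inv_mem (h.pair_mem_upperCentralSeries hb ha hc hg.swap_left)) (InvMemClass.inv_mem hm)
  · rw [h.gcomm_triple_right ha hb hc hg]
    exact Subgroup.upperCentralSeries_mono G one_le_two
      (mem_upperCentralSeries_one (h.central_top ha hb hc hg))

theorem nilpotentOfClassLE_five (h : IsSandwichClosed S) (ha : a ∈ S) (hb : b ∈ S)
    (hc : c ∈ S) (hg : Generates a b c) : NilpotentOfClassLE G 5 :=
  h.nilpotentOfClassLE_of_triple ha hb hc hg (h.triple_mem_upperCentralSeries ha hb hc hg)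
    (h.triple_mem_upperCentralSeries ha hc hb hg.swap_right)
    (h.triple_mem_upperCentralSeries hb hc ha hg.rotate)

theorem gcomm_pow_right_of_commute {u v : G} (huv : Commute v (gcomm u v)) (n : ℕ) :
    gcomm u (v ^ n) = gcomm u v ^ n := by
  induction n with
  | zero => simp [gcomm]
  | succ n ih =>
    rw [pow_succ, gcomm_mul_right, ih, mul_assoc, ← (huv.pow_right n).eq, inv_mul_cancel_left,
      ← pow_succ']

theorem eq_one_of_sq_of_odd {s : G} (h2 : s * s = 1) {n : ℕ} (hn : Odd n) (hs : s ^ n = 1) :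
    s = 1 := by
  obtain ⟨k, rfl⟩ := hn
  rwa [pow_succ, pow_mul, pow_two, h2, one_pow, one_mul] at hs

/-- As `c` commutes with `[w, c]`, one has `[w, c] ^ n = [w, c ^ n]`, so an element of exponent 2
also has odd exponent. -/
theorem top_eq_one (h : IsSandwichClosed S) (ha : a ∈ S) (hb : b ∈ S) (hc : c ∈ S)
    (oc : Odd (orderOf c)) : topComm a b c = 1 := by
  refine eq_one_of_sq_of_odd ?_ oc ?_
  · nth_rewrite 1 [← h.top_inv ha hb hc]; group
  · rw [topComm, ← gcomm_pow_right_of_commute (h.top_aux ha hb hc).2.1, pow_orderOf_eq_one]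
    simp [gcomm]

/-- By `pair_sq` the square of `w` is a product of trivial top commutators, while `w ^ n = [[a, b],
[a, c ^ n]]` vanishes for the odd order `n` of `c`. -/
theorem pair_eq_one (h : IsSandwichClosed S) (ha : a ∈ S) (hb : b ∈ S) (hc : c ∈ S)
    (hg : Generates a b c) (oa : Odd (orderOf a)) (ob : Odd (orderOf b)) (oc : Odd (orderOf c)) :
    pairComm a b c = 1 := by
  refine eq_one_of_sq_of_odd ?_ oc ?_
  · rw [h.pair_sq ha hb hc hg, h.top_eq_one ha hb hc oc, h.top_eq_one ha hc hb ob,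
      h.top_eq_one hb hc ha oa]
    simp
  · rw [pairComm, ← gcomm_pow_right_of_commute (h.gcomm_pair_right ha hb hc),
      ← gcomm_pow_right_of_commute (h.comm_right ha hc), pow_orderOf_eq_one]
    simp only [gcomm]; group

theorem triple_mem_upperCentralSeries_one (h : IsSandwichClosed S) (ha : a ∈ S) (hb : b ∈ S)
    (hc : c ∈ S) (hg : Generates a b c) (oa : Odd (orderOf a)) (ob : Odd (orderOf b))
    (oc : Odd (orderOf c)) : gcomm (gcomm a b) c ∈ Subgroup.upperCentralSeries G 1 := by
  have hm : crossComm a b c = 1 := by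
    rw [h.cross_eq ha hb hc hg, h.top_eq_one hb hc ha oa, h.top_eq_one ha hc hb ob, one_mul]
  refine hg.mem_upperCentralSeries ?_ ?_ ?_
  · rw [h.gcomm_triple_left ha hb hc, h.pair_eq_one ha hb hc hg oa ob oc, hm, one_mul]
    exact one_mem _
  · rw [h.gcomm_triple_mid ha hb hc hg, h.pair_eq_one hb ha hc hg.swap_left ob oa oc, hm,
      inv_one, one_mul]
    exact one_mem _
  · rw [h.gcomm_triple_right ha hb hc hg, h.top_eq_one ha hb hc oc]
    exact one_mem _

theorem nilpotentOfClassLE_three (h : IsSandwichClosed S) (ha : a ∈ S) (hb : b ∈ S)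
    (hc : c ∈ S) (hg : Generates a b c) (oa : Odd (orderOf a)) (ob : Odd (orderOf b))
    (oc : Odd (orderOf c)) : NilpotentOfClassLE G 3 :=
  h.nilpotentOfClassLE_of_triple ha hb hc hg
    (h.triple_mem_upperCentralSeries_one ha hb hc hg oa ob oc)
    (h.triple_mem_upperCentralSeries_one ha hc hb hg.swap_right oa oc ob)
    (h.triple_mem_upperCentralSeries_one hb hc ha hg.rotate ob oc oa)

end IsSandwichClosed

/-! ### From sandwich sets to sandwich-closed sets -/

section SandwichSet
variable {G : Type*} [Group G]

/-- The conjugates of the elements of `X` and of their inverses. -/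
def conjugatesAndInverses (X : Set G) : Set G :=
  {u | ∃ a ∈ X, ∃ g, u = g⁻¹ * a * g ∨ u = g⁻¹ * a⁻¹ * g}

theorem subset_conjugatesAndInverses (X : Set G) : X ⊆ conjugatesAndInverses X :=
  fun a ha => ⟨a, ha, 1, Or.inl (by simp)⟩

theorem commute_conj_of_class_two {H : Subgroup G} (hH : NilpotentOfClassLE H 2) {u v : G}
    (hu : u ∈ H) (hv : v ∈ H) : Commute u (v⁻¹ * u * v) := by
  have h := (nilpotentOfClassLE_two_iff H).1 hH (⟨u, hu⟩⁻¹) (⟨v, hv⟩⁻¹) ⟨u, hu⟩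
  rw [commutatorElement_eq_one_iff_commute] at h
  have h' : Commute u ⁅u⁻¹, v⁻¹⁆ := (h.map H.subtype).symm
  have e : v⁻¹ * u * v = u * ⁅u⁻¹, v⁻¹⁆ := by simp only [commutatorElement_def]; group
  rw [e]
  exact (Commute.refl u).mul_right h'

theorem IsSandwichSet.isSandwichClosed {X : Set G} (hX : IsSandwichSet X)
    (htop : Subgroup.closure X = ⊤) : IsSandwichClosed (conjugatesAndInverses X) where
  inv_mem := by
    rintro _ ⟨a, ha, g, rfl | rfl⟩
    · exact ⟨a, ha, g, Or.inr (by group)⟩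
    · exact ⟨a, ha, g, Or.inl (by group)⟩
  conj_mem := by
    rintro _ ⟨a, ha, g, rfl | rfl⟩ k
    · exact ⟨a, ha, g * k, Or.inl (by group)⟩
    · exact ⟨a, ha, g * k, Or.inr (by group)⟩
  commute_conj := by
    have key : ∀ a ∈ X, ∀ b ∈ X, ∀ g k : G, ∀ u v : G, (u = a ∨ u = a⁻¹) → (v = b ∨ v = b⁻¹) →
        Commute (g⁻¹ * u * g) ((k⁻¹ * v * k)⁻¹ * (g⁻¹ * u * g) * (k⁻¹ * v * k)) := by
      intro a ha b hb g k u v hu hv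
      -- Conjugation by `g⁻¹` moves the pair `a ^ g`, `b ^ k` to `a`, `b ^ (k * g⁻¹)`, where the
      -- sandwich condition applies.
      have hn := hX a ha b hb (k * g⁻¹) (htop ▸ Subgroup.mem_top _)
      have mu : u ∈ Subgroup.closure ({a, (k * g⁻¹)⁻¹ * b * (k * g⁻¹)} : Set G) := by
        have := Subgroup.subset_closure
          (Set.mem_insert a {(k * g⁻¹)⁻¹ * b * (k * g⁻¹)})
        rcases hu with rfl | rfl
        · exact this
        · exact inv_mem this
      have mv : (k * g⁻¹)⁻¹ * v * (k * g⁻¹) ∈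
          Subgroup.closure ({a, (k * g⁻¹)⁻¹ * b * (k * g⁻¹)} : Set G) := by
        have := Subgroup.subset_closure
          (Set.mem_insert_of_mem a (Set.mem_singleton ((k * g⁻¹)⁻¹ * b * (k * g⁻¹))))
        rcases hv with rfl | rfl
        · exact this
        · have e : (k * g⁻¹)⁻¹ * b⁻¹ * (k * g⁻¹) = ((k * g⁻¹)⁻¹ * b * (k * g⁻¹))⁻¹ := by group
          rw [e]
          exact inv_mem this
      have := (commute_conj_of_class_two hn mu mv).conj_conj g
      convert this using 1
      group
    rintro _ ⟨a, ha, g, rfl | rfl⟩ _ ⟨b, hb, k, rfl | rfl⟩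
    · exact key a ha b hb g k a b (Or.inl rfl) (Or.inl rfl)
    · exact key a ha b hb g k a b⁻¹ (Or.inl rfl) (Or.inr rfl)
    · exact key a ha b hb g k a⁻¹ b (Or.inr rfl) (Or.inl rfl)
    · exact key a ha b hb g k a⁻¹ b⁻¹ (Or.inr rfl) (Or.inr rfl)

theorem generates_of_closure_eq_top {x y z : G}
    (h : Subgroup.closure ({x, y, z} : Set G) = ⊤) : Generates x y z := by
  intro H hx hy hz g
  have : Subgroup.closure ({x, y, z} : Set G) ≤ H := by
    rw [Subgroup.closure_le]
    rintro t (rfl | rfl | rfl) <;> assumption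
  rw [h] at this
  exact this (Subgroup.mem_top g)

theorem IsSandwichSet.nilpotentOfClassLE_three {x y z : G} (h : IsSandwichSet ({x, y, z} : Set G))
    (htop : Subgroup.closure ({x, y, z} : Set G) = ⊤) (ox : Odd (orderOf x))
    (oy : Odd (orderOf y)) (oz : Odd (orderOf z)) : NilpotentOfClassLE G 3 :=
  (h.isSandwichClosed htop).nilpotentOfClassLE_three
    (subset_conjugatesAndInverses _ (by simp)) (subset_conjugatesAndInverses _ (by simp))
    (subset_conjugatesAndInverses _ (by simp)) (generates_of_closure_eq_top htop) ox oy oz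

theorem IsSandwichSet.nilpotentOfClassLE_five {x y z : G} (h : IsSandwichSet ({x, y, z} : Set G))
    (htop : Subgroup.closure ({x, y, z} : Set G) = ⊤) : NilpotentOfClassLE G 5 :=
  (h.isSandwichClosed htop).nilpotentOfClassLE_five
    (subset_conjugatesAndInverses _ (by simp)) (subset_conjugatesAndInverses _ (by simp))
    (subset_conjugatesAndInverses _ (by simp)) (generates_of_closure_eq_top htop)

theorem IsSandwichSet.lift_commutatorList {x y z : G} (h : IsSandwichSet ({x, y, z} : Set G))
    (htop : Subgroup.closure ({x, y, z} : Set G) = ⊤) :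
    ∀ r ∈ pcRels, FreeGroup.lift (commutatorList x y z) r = 1 :=
  (h.isSandwichClosed htop).lift_commutatorList
    (subset_conjugatesAndInverses _ (by simp)) (subset_conjugatesAndInverses _ (by simp))
    (subset_conjugatesAndInverses _ (by simp)) (generates_of_closure_eq_top htop).rotate.rotate

end SandwichSet

/-! ### Models: the normal closure of `z` and its automorphisms -/

/-- The doubling map `ℤ/2 → ℤ/4`. -/
def doubling (t : ZMod 2) : ZMod 4 := 2 * (t.val : ZMod 4)

theorem doubling_add (s t : ZMod 2) : doubling (s + t) = doubling s + doubling t := by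
  revert s t; decide

theorem two_mul_doubling (t : ZMod 2) : 2 * doubling t = 0 := by
  revert t; decide

theorem doubling_zero : doubling 0 = 0 := by decide

theorem doubling_neg (t : ZMod 2) : doubling (-t) = doubling t := by
  revert t; decide

theorem doubling_intCast (n : ℤ) : doubling (n : ZMod 2) = 2 * (n : ZMod 4) := by
  have h : ∀ t : ZMod 4, doubling (ZMod.castHom (by norm_num : 2 ∣ 4) (ZMod 2) t) = 2 * t := by decide
  rw [← h (n : ZMod 4), map_intCast]

theorem four_eq_zero : (4 : ZMod 4) = 0 := by decide

theorem exists_doubling_eq (t : ZMod 2) : ∃ w : ZMod 4, doubling t = 2 * w := ⟨_, rfl⟩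

/-- The normal closure of `z`, with centre mapped to `ℤ/4` so that `x_1`, `x_2`, `x_3` and `x_4`
become `2 * e₁`, `2 * e₂`, `2 * e₃` and `1`. The element with the given coordinates is
`z ^ n14 * x_10 ^ n10 * x_9 ^ n9 * x_8 ^ n8 * x_7 ^ n7 * f_6 ^ f6 * f_5 ^ f5 * x_4 ^ c`, where
`x_5 = x_4 * f_5` and `x_6 = x_4 * f_6`. -/
@[ext] structure ZClosure (e₁ e₂ e₃ : ZMod 4) where
  n14 : ℤ
  n10 : ℤ
  n9 : ℤ
  n8 : ℤ
  n7 : ℤ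
  f6 : ZMod 2
  f5 : ZMod 2
  c : ZMod 4

namespace ZClosure
variable {e₁ e₂ e₃ : ZMod 4}

instance : DecidableEq (ZClosure e₁ e₂ e₃) := fun u v =>
  decidable_of_iff (u.n14 = v.n14 ∧ u.n10 = v.n10 ∧ u.n9 = v.n9 ∧ u.n8 = v.n8 ∧ u.n7 = v.n7 ∧
    u.f6 = v.f6 ∧ u.f5 = v.f5 ∧ u.c = v.c) ZClosure.ext_iff.symm

/-- The bilinear cocycle. -/
def cocycle (u v : ZClosure e₁ e₂ e₃) : ZMod 4 :=
  -- The coefficients are the conjugate relations in central coordinates. For example `x_7 ^ x_14 =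
  -- x_7 * x_4 * x_3 * x_2` gives `1 + 2 * e₂ + 2 * e₃`, and the terms with `doubling` come from
  -- `f_5` and `f_6`, which `z` multiplies by `x_2`.
  2 * (e₂ + e₃) * (u.n7 * v.n9) + 2 * e₁ * (u.n7 * v.n10) +
    (1 + 2 * e₂ + 2 * e₃) * (u.n7 * v.n14) + 2 * e₃ * (u.n8 * v.n9) +
    2 * (e₁ + e₂) * (u.n8 * v.n10) + (1 + 2 * e₃) * (u.n8 * v.n14) + u.n9 * v.n10 +
    e₂ * (doubling u.f5 * v.n14) + e₂ * (doubling u.f6 * v.n14)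

instance : Mul (ZClosure e₁ e₂ e₃) where
  mul u v := ⟨u.n14 + v.n14, u.n10 + v.n10, u.n9 + v.n9, u.n8 + v.n8, u.n7 + v.n7,
    u.f6 + v.f6, u.f5 + v.f5, u.c + v.c + cocycle u v⟩

instance : One (ZClosure e₁ e₂ e₃) where
  one := ⟨0, 0, 0, 0, 0, 0, 0, 0⟩

/-- Bilinearity turns the cocycle of `u⁻¹` and `u` into minus that of `u` and `u`; for the
coordinates in `ℤ/2` this uses that twice a doubled element is zero. -/
instance : Inv (ZClosure e₁ e₂ e₃) where
  inv u := ⟨-u.n14, -u.n10, -u.n9, -u.n8, -u.n7, -u.f6, -u.f5, -u.c + cocycle u u⟩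

section Simp
variable (u v : ZClosure e₁ e₂ e₃)
@[simp] theorem mul_n14 : (u * v).n14 = u.n14 + v.n14 := rfl
@[simp] theorem mul_n10 : (u * v).n10 = u.n10 + v.n10 := rfl
@[simp] theorem mul_n9 : (u * v).n9 = u.n9 + v.n9 := rfl
@[simp] theorem mul_n8 : (u * v).n8 = u.n8 + v.n8 := rfl
@[simp] theorem mul_n7 : (u * v).n7 = u.n7 + v.n7 := rfl
@[simp] theorem mul_f6 : (u * v).f6 = u.f6 + v.f6 := rfl
@[simp] theorem mul_f5 : (u * v).f5 = u.f5 + v.f5 := rfl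
@[simp] theorem mul_c : (u * v).c = u.c + v.c + cocycle u v := rfl
@[simp] theorem one_n14 : (1 : ZClosure e₁ e₂ e₃).n14 = 0 := rfl
@[simp] theorem one_n10 : (1 : ZClosure e₁ e₂ e₃).n10 = 0 := rfl
@[simp] theorem one_n9 : (1 : ZClosure e₁ e₂ e₃).n9 = 0 := rfl
@[simp] theorem one_n8 : (1 : ZClosure e₁ e₂ e₃).n8 = 0 := rfl
@[simp] theorem one_n7 : (1 : ZClosure e₁ e₂ e₃).n7 = 0 := rfl
@[simp] theorem one_f6 : (1 : ZClosure e₁ e₂ e₃).f6 = 0 := rfl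
@[simp] theorem one_f5 : (1 : ZClosure e₁ e₂ e₃).f5 = 0 := rfl
@[simp] theorem one_c : (1 : ZClosure e₁ e₂ e₃).c = 0 := rfl
@[simp] theorem inv_n14 : u⁻¹.n14 = -u.n14 := rfl
@[simp] theorem inv_n10 : u⁻¹.n10 = -u.n10 := rfl
@[simp] theorem inv_n9 : u⁻¹.n9 = -u.n9 := rfl
@[simp] theorem inv_n8 : u⁻¹.n8 = -u.n8 := rfl
@[simp] theorem inv_n7 : u⁻¹.n7 = -u.n7 := rfl
@[simp] theorem inv_f6 : u⁻¹.f6 = -u.f6 := rfl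
@[simp] theorem inv_f5 : u⁻¹.f5 = -u.f5 := rfl
@[simp] theorem inv_c : u⁻¹.c = -u.c + cocycle u u := rfl
end Simp

instance : Group (ZClosure e₁ e₂ e₃) := by
  refine Group.ofLeftAxioms ?_ ?_ ?_
  · intro u v w
    ext <;> simp [add_assoc, cocycle, doubling_add]
    ring
  · intro u
    ext <;> simp [cocycle, doubling_zero]
  · intro u
    ext <;> simp only [inv_n14, inv_n10, inv_n9, inv_n8, inv_n7, inv_f6, inv_f5, inv_c, mul_n14,
      mul_n10, mul_n9, mul_n8, mul_n7, mul_f6, mul_f5, mul_c, one_n14, one_n10, one_n9, one_n8,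
      one_n7, one_f6, one_f5, one_c, neg_add_cancel]
    simp only [cocycle, inv_n9, inv_n8, inv_n7, inv_f6, inv_f5, doubling_neg,
      Int.cast_neg]
    linear_combination e₂ * u.n14 * two_mul_doubling u.f5 + e₂ * u.n14 * two_mul_doubling u.f6

/-- The part of the central coordinate of a conjugate by `x` that does not involve the old
central coordinate. -/
def centreX (u : ZClosure e₁ e₂ e₃) : ZMod 4 :=
  -- This is `2 * (e₁ + e₂)` times a binomial coefficient, produced by collecting `(x_10 * x_8) ^
  -- n10`. The term `n14 * n10` comes from moving `x_9 ^ n14`, contributed by `z ^ x = z * x_9`,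
  -- past `x_10 ^ n10`.
  (e₁ + e₂) * (u.n10 * u.n10 - u.n10) + u.n14 * u.n10 + 2 * e₃ * (u.n10 * u.n9) +
    2 * e₃ * u.n8 + (1 + 2 * e₂ + 2 * e₃) * u.n7 + e₃ * doubling u.f5

/-- The part of the central coordinate of a conjugate by `y` that does not involve the old
central coordinate. -/
def centreY (u : ZClosure e₁ e₂ e₃) : ZMod 4 :=
  (e₂ + e₃) * (u.n9 * u.n9 - u.n9) + (1 + 2 * e₃) * u.n8 + 2 * e₁ * u.n7 + e₁ * doubling u.f6

/-- The underlying function of conjugation by `x`. -/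
def conjX (u : ZClosure e₁ e₂ e₃) : ZClosure e₁ e₂ e₃ :=
  ⟨u.n14, u.n10, u.n9 + u.n14, u.n8 + u.n10, u.n7, u.f6, u.f5 + u.n7,
    -- The relation `x_4 ^ x = x_4 * x_3` reads `1 ↦ 1 + 2 * e₃` in `ℤ/4`.
    u.c * (1 + 2 * e₃) + centreX u⟩

/-- The underlying function of conjugation by `y`. -/
def conjY (u : ZClosure e₁ e₂ e₃) : ZClosure e₁ e₂ e₃ :=
  ⟨u.n14, u.n10 + u.n14, u.n9, u.n8, u.n7 + u.n9, u.f6 + u.n8, u.f5,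
    u.c * (1 + 2 * e₁) + centreY u⟩

/-- The underlying function of conjugation by `x⁻¹`. -/
def conjXInv (u : ZClosure e₁ e₂ e₃) : ZClosure e₁ e₂ e₃ :=
  ⟨u.n14, u.n10, u.n9 - u.n14, u.n8 - u.n10, u.n7, u.f6, u.f5 - u.n7,
    (u.c - centreX (⟨u.n14, u.n10, u.n9 - u.n14, u.n8 - u.n10, u.n7, u.f6, u.f5 - u.n7, 0⟩ :
      ZClosure e₁ e₂ e₃)) *
      (1 + 2 * e₃)⟩

/-- The underlying function of conjugation by `y⁻¹`. -/
def conjYInv (u : ZClosure e₁ e₂ e₃) : ZClosure e₁ e₂ e₃ :=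
  ⟨u.n14, u.n10 - u.n14, u.n9, u.n8, u.n7 - u.n9, u.f6 - u.n8, u.f5,
    (u.c - centreY (⟨u.n14, u.n10 - u.n14, u.n9, u.n8, u.n7 - u.n9, u.f6 - u.n8, u.f5, 0⟩ :
      ZClosure e₁ e₂ e₃)) *
      (1 + 2 * e₁)⟩

theorem one_add_two_mul_sq (e : ZMod 4) : (1 + 2 * e) * (1 + 2 * e) = 1 := by
  revert e; decide

theorem conjXInv_conjX (u : ZClosure e₁ e₂ e₃) : conjXInv (conjX u) = u := by
  ext <;> simp [conjX, conjXInv, centreX]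
  linear_combination u.c * one_add_two_mul_sq e₃

theorem conjX_conjXInv (u : ZClosure e₁ e₂ e₃) : conjX (conjXInv u) = u := by
  ext <;> simp [conjX, conjXInv, centreX, mul_assoc, one_add_two_mul_sq]

theorem conjYInv_conjY (u : ZClosure e₁ e₂ e₃) : conjYInv (conjY u) = u := by
  ext <;> simp [conjY, conjYInv, centreY]
  linear_combination u.c * one_add_two_mul_sq e₁

theorem conjY_conjYInv (u : ZClosure e₁ e₂ e₃) : conjY (conjYInv u) = u := by
  ext <;> simp [conjY, conjYInv, centreY, mul_assoc, one_add_two_mul_sq]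

theorem conjX_mul (u v : ZClosure e₁ e₂ e₃) : conjX (u * v) = conjX u * conjX v := by
  ext <;> simp [conjX, centreX]
  · ring
  · ring
  · ring
  · simp only [cocycle, doubling_add, doubling_intCast, Int.cast_add]
    obtain ⟨d5, h5⟩ := exists_doubling_eq u.f5
    obtain ⟨d6, h6⟩ := exists_doubling_eq u.f6
    obtain ⟨d5', h5'⟩ := exists_doubling_eq v.f5
    simp only [h5, h6, h5']
    rw [← sub_eq_zero]
    ring_nf
    reduce_mod_char

theorem conjY_mul [hodd : Fact (e₁ + e₂ + e₃ = 1)] (u v : ZClosure e₁ e₂ e₃) : conjY (u * v) = conjY u * conjY v := by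
  have he := hodd.out
  obtain rfl : e₁ = 1 - e₂ - e₃ := by linear_combination he
  ext <;> simp [conjY, centreY]
  · ring
  · ring
  · ring
  · simp only [cocycle, doubling_add, doubling_intCast, Int.cast_add]
    obtain ⟨d5, h5⟩ := exists_doubling_eq u.f5
    obtain ⟨d6, h6⟩ := exists_doubling_eq u.f6
    obtain ⟨d5', h5'⟩ := exists_doubling_eq v.f6
    simp only [h5, h6, h5']
    rw [← sub_eq_zero]
    ring_nf
    reduce_mod_char

/-- The underlying function of conjugation by `[x, y]`. -/
def conjO (u : ZClosure e₁ e₂ e₃) : ZClosure e₁ e₂ e₃ :=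
  ⟨u.n14, u.n10, u.n9, u.n8 - u.n14, u.n7 + u.n14, u.f6 + u.n14 + u.n10, u.f5 + u.n14 + u.n9,
    u.c + (1 + 2 * e₃) * u.n14 + e₂ * (u.n14 * u.n14 - u.n14) + u.n10 + u.n9 + 2 * e₃ * u.n8 +
      2 * e₁ * u.n7 + 2 * e₂ * (u.n14 * (u.n10 + u.n9))⟩

theorem two_mul_sq_sub (t : ZMod 4) : 2 * (t * t - t) = 0 := by
  revert t; decide

/-- This reflects `x * y = y * x * [x, y]` and identifies `conjO` with the action of `[x, y]`. The
sum condition on the parameters is compatible with `x_4 ^ 2 = x_3 * x_2 * x_1`, which requires `2 =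
2 * (e₁ + e₂ + e₃)`. -/
theorem conjY_conjX [hodd : Fact (e₁ + e₂ + e₃ = 1)] (u : ZClosure e₁ e₂ e₃) :
    conjY (conjX u) = conjO (conjX (conjY u)) := by
  have he := hodd.out
  obtain rfl : e₁ = 1 - e₂ - e₃ := by linear_combination he
  ext <;> simp [conjX, conjY, conjO, centreX, centreY]
  case n8 | n7 => ring_nf
  case f6 | f5 =>
    rw [← sub_eq_zero]
    ring_nf
    try reduce_mod_char
  case c =>
    obtain ⟨d5, h5⟩ := exists_doubling_eq u.f5
    obtain ⟨d6, h6⟩ := exists_doubling_eq u.f6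
    simp only [h5, h6]
    rw [← sub_eq_zero]
    ring_nf
    reduce_mod_char
    linear_combination (e₂ * e₃ + e₃ * e₃ - e₂ + 1) * two_mul_sq_sub (u.n10 : ZMod 4) -
      (e₂ * e₃ + e₃ * e₃) * two_mul_sq_sub (u.n9 : ZMod 4) +
      (e₃ - 1) * two_mul_sq_sub (u.n14 : ZMod 4) +
      (2 * (e₂ * e₃ + e₃ * e₃ + 1) * u.n10 + 2 * e₂ * u.n10 ^ 2 +
        2 * (e₂ * e₃ + e₃ * e₃) * u.n9 ^ 2 + (2 * e₃ + 1) * u.n14 + 2 * u.n14 ^ 2) * four_eq_zero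

theorem conjX_conjO (u : ZClosure e₁ e₂ e₃) : conjX (conjO u) = conjO (conjX u) := by
  ext <;> simp [conjX, conjO, centreX]
  case n8 => ring_nf
  case f5 =>
    rw [← sub_eq_zero]
    ring_nf
    try reduce_mod_char
  case c =>
    simp only [sub_eq_add_neg, doubling_add, doubling_intCast]
    obtain ⟨d5, h5⟩ := exists_doubling_eq u.f5
    simp only [h5]
    have hq := two_mul_sq_sub (u.n14 : ZMod 4)
    rw [← sub_eq_zero]
    ring_nf
    reduce_mod_char
    linear_combination (e₂ * e₃ - e₂) * hq + (2 * e₂ * e₃ * u.n14 + 2 * e₂ * u.n14 ^ 2) * four_eq_zero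

theorem conjY_conjO [hodd : Fact (e₁ + e₂ + e₃ = 1)] (u : ZClosure e₁ e₂ e₃) : conjY (conjO u) = conjO (conjY u) := by
  ext <;> simp [conjY, conjO, centreY]
  case n7 => ring_nf
  case f6 =>
    rw [← sub_eq_zero]
    ring_nf
    try reduce_mod_char
  case c =>
    simp only [sub_eq_add_neg, doubling_add, doubling_intCast]
    obtain ⟨d6, h6⟩ := exists_doubling_eq u.f6
    simp only [h6]
    have hq := two_mul_sq_sub (u.n14 : ZMod 4)
    rw [← sub_eq_zero]
    ring_nf
    reduce_mod_char
    linear_combination (e₁ * e₂ - e₂) * hq + 2 * (u.n14 : ZMod 4) * hodd.out +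
      (2 * e₁ * e₂ * u.n14 + 2 * e₂ * u.n14 ^ 2 - u.n14 * e₂ + u.n14 * e₃ + 2 * u.n14) * four_eq_zero

end ZClosure

/-! ### The Heisenberg group generated by `x` and `y`, and its action -/

/-- The integral Heisenberg group; the element with coordinates `a`, `b`, `c` is
`y ^ b * x ^ a * [x, y] ^ c`. -/
@[ext] structure Heisenberg where
  a : ℤ
  b : ℤ
  c : ℤ

namespace Heisenberg

instance : DecidableEq Heisenberg := fun u v =>
  decidable_of_iff (u.a = v.a ∧ u.b = v.b ∧ u.c = v.c) Heisenberg.ext_iff.symm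

instance : Mul Heisenberg where
  mul u v := ⟨u.a + v.a, u.b + v.b, u.c + v.c + u.a * v.b⟩

instance : One Heisenberg where
  one := ⟨0, 0, 0⟩

instance : Inv Heisenberg where
  inv u := ⟨-u.a, -u.b, -u.c + u.a * u.b⟩

@[simp] theorem mul_a (u v : Heisenberg) : (u * v).a = u.a + v.a := rfl
@[simp] theorem mul_b (u v : Heisenberg) : (u * v).b = u.b + v.b := rfl
@[simp] theorem mul_c (u v : Heisenberg) : (u * v).c = u.c + v.c + u.a * v.b := rfl
@[simp] theorem one_a : (1 : Heisenberg).a = 0 := rfl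
@[simp] theorem one_b : (1 : Heisenberg).b = 0 := rfl
@[simp] theorem one_c : (1 : Heisenberg).c = 0 := rfl
@[simp] theorem inv_a (u : Heisenberg) : u⁻¹.a = -u.a := rfl
@[simp] theorem inv_b (u : Heisenberg) : u⁻¹.b = -u.b := rfl
@[simp] theorem inv_c (u : Heisenberg) : u⁻¹.c = -u.c + u.a * u.b := rfl

instance : Group Heisenberg := by
  refine Group.ofLeftAxioms ?_ ?_ ?_
  · intro u v w
    ext <;> simp [add_assoc]
    ring
  · intro u
    ext <;> simp
  · intro u
    ext <;> simp

theorem zpow_mul_zpow_of_commutator {H : Type*} [Group H] {A B C : H} (h : A * B = B * A * C)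
    (hA : Commute A C) (hB : Commute B C) (m n : ℤ) :
    A ^ m * B ^ n = B ^ n * A ^ m * C ^ (m * n) := by
  have h1 : B⁻¹ * A ^ m * B⁻¹⁻¹ = A ^ m * C ^ m := by
    rw [← conj_zpow, ← hA.mul_zpow, inv_inv, mul_assoc, h]
    group
  have hAm : Commute (A ^ m) (C ^ m) := hA.zpow_zpow m m
  have h2 : A ^ m * B * (A ^ m)⁻¹ = B * C ^ m := by
    have h3 : A ^ m * B = B * (A ^ m * C ^ m) := by
      rw [← h1]; group
    rw [h3, hAm.eq]; group
  have h4 : A ^ m * B ^ n * (A ^ m)⁻¹ = B ^ n * C ^ (m * n) := by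
    rw [← conj_zpow, h2, (hB.zpow_right m).mul_zpow, zpow_mul]
  rw [mul_inv_eq_iff_eq_mul] at h4
  rw [h4, mul_assoc, mul_assoc, (hA.zpow_zpow m (m * n)).eq]

/-- The homomorphism from the Heisenberg group defined by two elements whose commutator `C` is
central in the subgroup they generate. -/
def lift {H : Type*} [Group H] (A B C : H) (h : A * B = B * A * C) (hA : Commute A C)
    (hB : Commute B C) : Heisenberg →* H where
  toFun u := B ^ u.b * A ^ u.a * C ^ u.c
  map_one' := by simp
  map_mul' u v := by
    have h1 := zpow_mul_zpow_of_commutator h hA hB u.a v.b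
    have h2 : Commute (C ^ u.c) (B ^ v.b * A ^ v.a) :=
      (hB.symm.zpow_zpow _ _).mul_right (hA.symm.zpow_zpow _ _)
    have h3 : Commute (C ^ (u.a * v.b)) (A ^ v.a) := hA.symm.zpow_zpow _ _
    calc B ^ (u.b + v.b) * A ^ (u.a + v.a) * C ^ (u.c + v.c + u.a * v.b)
        = B ^ u.b * (B ^ v.b * A ^ u.a * (A ^ v.a * C ^ (u.a * v.b))) * (C ^ u.c * C ^ v.c) := by
          rw [show u.c + v.c + u.a * v.b = u.a * v.b + (u.c + v.c) by ring]
          simp only [zpow_add, mul_assoc]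
      _ = B ^ u.b * (A ^ u.a * B ^ v.b) * A ^ v.a * (C ^ u.c * C ^ v.c) := by
          rw [h1, ← h3.eq]; simp only [mul_assoc]
      _ = B ^ u.b * A ^ u.a * ((B ^ v.b * A ^ v.a) * C ^ u.c) * C ^ v.c := by
          simp only [mul_assoc]
      _ = _ := by rw [← h2.eq]; simp only [mul_assoc]

end Heisenberg

namespace ZClosure
variable {e₁ e₂ e₃ : ZMod 4}

/-- Conjugation by `x`. -/
def autX : MulAut (ZClosure e₁ e₂ e₃) where
  toFun := conjX
  invFun := conjXInv
  left_inv := conjXInv_conjX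
  right_inv := conjX_conjXInv
  map_mul' := conjX_mul

/-- Conjugation by `y`. -/
def autY [Fact (e₁ + e₂ + e₃ = 1)] : MulAut (ZClosure e₁ e₂ e₃) where
  toFun := conjY
  invFun := conjYInv
  left_inv := conjYInv_conjY
  right_inv := conjY_conjYInv
  map_mul' := conjY_mul

/-- Conjugation by `[x, y]`. -/
def autO [Fact (e₁ + e₂ + e₃ = 1)] : MulAut (ZClosure e₁ e₂ e₃) :=
  autY * autX * autY⁻¹ * autX⁻¹

/-- Defined as a composite, `autO` is an automorphism for free; the explicit `conjO` only serves to
check that it commutes with `autX` and `autY`. -/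
theorem autO_apply [Fact (e₁ + e₂ + e₃ = 1)] (u : ZClosure e₁ e₂ e₃) : autO u = conjO u := by
  obtain ⟨v, rfl⟩ := (autX * autY : MulAut (ZClosure e₁ e₂ e₃)).surjective u
  have h : autO ((autX * autY : MulAut (ZClosure e₁ e₂ e₃)) v) =
        (autY * autX : MulAut (ZClosure e₁ e₂ e₃)) v := by
    rw [← MulAut.mul_apply, autO]; congr 1; group
  exact h.trans (conjY_conjX v)

theorem commute_autX_autO [Fact (e₁ + e₂ + e₃ = 1)] :
    Commute (autX : MulAut (ZClosure e₁ e₂ e₃)) autO := by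
  ext1 u
  rw [MulAut.mul_apply, MulAut.mul_apply, autO_apply, autO_apply]
  exact conjX_conjO u

theorem commute_autY_autO [Fact (e₁ + e₂ + e₃ = 1)] :
    Commute (autY : MulAut (ZClosure e₁ e₂ e₃)) autO := by
  ext1 u
  rw [MulAut.mul_apply, MulAut.mul_apply, autO_apply, autO_apply]
  exact conjY_conjO u

/-- The action of the Heisenberg group on the normal closure of `z`. -/
def action [Fact (e₁ + e₂ + e₃ = 1)] : Heisenberg →* MulAut (ZClosure e₁ e₂ e₃) :=
  -- Inverses appear because a semidirect product acts by `h * k * h⁻¹`, whereas `conjX` is `x⁻¹ * k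
  -- * x`.
  Heisenberg.lift autX⁻¹ autY⁻¹ autO⁻¹ (by rw [autO]; group) commute_autX_autO.inv_inv
    commute_autY_autO.inv_inv

end ZClosure

/-- A quotient of the free sandwich group in which `x_4` has order `4` and the elements `x_1`,
`x_2`, `x_3` are sent into the subgroup of order `2`. -/
abbrev SandwichModel (e₁ e₂ e₃ : ZMod 4) [Fact (e₁ + e₂ + e₃ = 1)] : Type :=
  ZClosure e₁ e₂ e₃ ⋊[ZClosure.action] Heisenberg

namespace SandwichModel
variable {e₁ e₂ e₃ : ZMod 4} [Fact (e₁ + e₂ + e₃ = 1)]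

/-- The image of `x`. -/
def x : SandwichModel e₁ e₂ e₃ := SemidirectProduct.inr ⟨1, 0, 0⟩

/-- The image of `y`. -/
def y : SandwichModel e₁ e₂ e₃ := SemidirectProduct.inr ⟨0, 1, 0⟩

/-- The image of `z`. -/
def z : SandwichModel e₁ e₂ e₃ := SemidirectProduct.inl ⟨1, 0, 0, 0, 0, 0, 0, 0⟩

end SandwichModel

/-- Each choice of parameters keeps exactly one of `x_1`, `x_2`, `x_3` alive. -/
instance : Fact ((1 : ZMod 4) + 0 + 0 = 1) := ⟨by decide⟩
instance : Fact ((0 : ZMod 4) + 1 + 0 = 1) := ⟨by decide⟩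
instance : Fact ((0 : ZMod 4) + 0 + 1 = 1) := ⟨by decide⟩

/-- Indexing the relators by finite types makes their verification in a concrete group a finite
computation. -/
theorem lift_eq_one_of_pcRels {G : Type*} [Group G] (X : Fin 14 → G)
    (hp : ∀ k : Fin 6, FreeGroup.lift X (pcGen (k + 1) ^ 2) = FreeGroup.lift X (pcPower (k + 1)))
    (hc : ∀ k l : Fin 14, k < l → FreeGroup.lift X ((pcGen (l + 1))⁻¹ * pcGen (k + 1) * pcGen (l + 1)) =
      FreeGroup.lift X (pcConj (k + 1) (l + 1))) :
    ∀ r ∈ pcRels, FreeGroup.lift X r = 1 := by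
  rintro r (⟨k, hk1, hk2, rfl⟩ | ⟨k, l, hk, hkl, hl, rfl⟩)
  · obtain ⟨k, rfl⟩ : ∃ k', k = k' + 1 := ⟨k - 1, by omega⟩
    rw [map_mul, map_inv, mul_inv_eq_one]
    exact hp ⟨k, by omega⟩
  · obtain ⟨k, rfl⟩ : ∃ k', k = k' + 1 := ⟨k - 1, by omega⟩
    obtain ⟨l, rfl⟩ : ∃ l', l = l' + 1 := ⟨l - 1, by omega⟩
    rw [map_mul, map_inv, mul_inv_eq_one]
    exact hc ⟨k, by omega⟩ ⟨l, by omega⟩ (by simpa using hkl)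

namespace SandwichModel

/-- The image of `x_k`, at index `k - 1`. -/
def gen (e₁ e₂ e₃ : ZMod 4) [Fact (e₁ + e₂ + e₃ = 1)] : Fin 14 → SandwichModel e₁ e₂ e₃ :=
  ![SemidirectProduct.inl ⟨0, 0, 0, 0, 0, 0, 0, 2 * e₁⟩,
    SemidirectProduct.inl ⟨0, 0, 0, 0, 0, 0, 0, 2 * e₂⟩,
    SemidirectProduct.inl ⟨0, 0, 0, 0, 0, 0, 0, 2 * e₃⟩,
    SemidirectProduct.inl ⟨0, 0, 0, 0, 0, 0, 0, 1⟩,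
    SemidirectProduct.inl ⟨0, 0, 0, 0, 0, 0, 1, 1⟩,
    SemidirectProduct.inl ⟨0, 0, 0, 0, 0, 1, 0, 1⟩,
    SemidirectProduct.inl ⟨0, 0, 0, 0, 1, 0, 0, 0⟩,
    SemidirectProduct.inl ⟨0, 0, 0, 1, 0, 0, 0, 0⟩,
    SemidirectProduct.inl ⟨0, 0, 1, 0, 0, 0, 0, 0⟩,
    SemidirectProduct.inl ⟨0, 1, 0, 0, 0, 0, 0, 0⟩,
    SemidirectProduct.inr ⟨0, 0, 1⟩, x, y, z]

end SandwichModel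

/-- The product of three models, in which the presented group embeds. -/
abbrev JointModel : Type := SandwichModel 1 0 0 × SandwichModel 0 1 0 × SandwichModel 0 0 1

namespace JointModel

/-- The image of `x_k`, at index `k - 1`. -/
def gen (i : Fin 14) : JointModel :=
  (SandwichModel.gen 1 0 0 i, SandwichModel.gen 0 1 0 i, SandwichModel.gen 0 0 1 i)

theorem lift_gen : ∀ r ∈ pcRels, FreeGroup.lift gen r = 1 :=
  lift_eq_one_of_pcRels gen (by decide +kernel) (by decide +kernel)

theorem gen_eq_commutatorList : gen = commutatorList (gen 11) (gen 12) (gen 13) := by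
  decide +kernel

/-- The models single out `z`, so the cyclic symmetry of the generators is not visible in them and
is verified on the relators. -/
theorem lift_rotate :
    ∀ r ∈ pcRels, FreeGroup.lift (commutatorList (gen 12) (gen 13) (gen 11)) r = 1 :=
  lift_eq_one_of_pcRels _ (by decide +kernel) (by decide +kernel)

end JointModel

/-! ### Normal words in the models -/

namespace ZClosure
variable {e₁ e₂ e₃ : ZMod 4}

theorem doubling_intCast_mul (n : ℤ) (t : ZMod 2) :
    doubling (n * t) = n * doubling t := by
  have h : ∀ s : ZMod 4, ∀ t : ZMod 2,
      doubling (ZMod.castHom (by norm_num : 2 ∣ 4) (ZMod 2) s * t) = s * doubling t := by decide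
  rw [← h (n : ZMod 4), map_intCast]

/-- Powers of an element on which the cocycle vanishes. -/
theorem zpow_of_cocycle_eq_zero (u : ZClosure e₁ e₂ e₃) (hu : cocycle u u = 0) (n : ℤ) :
    u ^ n = ⟨n * u.n14, n * u.n10, n * u.n9, n * u.n8, n * u.n7, n * u.f6, n * u.f5, n * u.c⟩ := by
  let f : Multiplicative ℤ →* ZClosure e₁ e₂ e₃ :=
    { toFun := fun m =>
        have m : ℤ := m.toAdd
        ⟨m * u.n14, m * u.n10, m * u.n9, m * u.n8, m * u.n7, m * u.f6, m * u.f5, m * u.c⟩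
      map_one' := by ext <;> simp
      map_mul' := by
        intro a b
        ext <;> simp [add_mul]
        simp only [cocycle, doubling_intCast_mul, Int.cast_mul]
        rw [cocycle] at hu
        linear_combination (a.toAdd : ZMod 4) * b.toAdd * hu }
  have h1 : f (Multiplicative.ofAdd 1) = u := by
    ext <;> simp [f]
  have h2 : f (Multiplicative.ofAdd n) = u ^ n := by
    rw [← h1, ← map_zpow, ← ofAdd_zsmul]; simp
  rw [← h2]; rfl

end ZClosure

namespace Heisenberg

theorem zpow_of_mul_eq_zero (u : Heisenberg) (hu : u.a * u.b = 0) (n : ℤ) :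
    u ^ n = ⟨n * u.a, n * u.b, n * u.c⟩ := by
  let f : Multiplicative ℤ →* Heisenberg :=
    { toFun := fun m => ⟨m.toAdd * u.a, m.toAdd * u.b, m.toAdd * u.c⟩
      map_one' := by ext <;> simp
      map_mul' := by
        intro a b
        rcases mul_eq_zero.1 hu with h | h <;> ext <;> simp [h, add_mul] }
  have h1 : f (Multiplicative.ofAdd 1) = u := by
    ext <;> simp [f]
  have h2 : f (Multiplicative.ofAdd n) = u ^ n := by
    rw [← h1, ← map_zpow, ← ofAdd_zsmul]; simp
  rw [← h2]; rfl

end Heisenberg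

namespace ZClosure
variable {e₁ e₂ e₃ : ZMod 4}

theorem action_n14 [Fact (e₁ + e₂ + e₃ = 1)] (h : Heisenberg) (u : ZClosure e₁ e₂ e₃) :
    (action h u).n14 = u.n14 := by
  let S : Subgroup (MulAut (ZClosure e₁ e₂ e₃)) :=
    { carrier := {f | ∀ u, (f u).n14 = u.n14}
      one_mem' := fun u => rfl
      mul_mem' := fun {f g} hf hg u => by
        rw [MulAut.mul_apply]; exact (hf _).trans (hg u)
      inv_mem' := fun {f} hf u => by
        have h1 := hf (f⁻¹ u)
        rw [MulAut.apply_inv_self] at h1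
        exact h1.symm }
  have hX : autX ∈ S := fun u => rfl
  have hY : autY ∈ S := fun u => rfl
  have hO : autO ∈ S :=
    S.mul_mem (S.mul_mem (S.mul_mem hY hX) (S.inv_mem hY)) (S.inv_mem hX)
  exact S.mul_mem (S.mul_mem (S.zpow_mem (S.inv_mem hY) _) (S.zpow_mem (S.inv_mem hX) _))
    (S.zpow_mem (S.inv_mem hO) _) u

end ZClosure

namespace SandwichModel
variable {e₁ e₂ e₃ : ZMod 4} [Fact (e₁ + e₂ + e₃ = 1)]

theorem normalWord_eq (e : Fin 14 → ℤ) :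
    ((List.finRange 14).reverse.map fun i => gen e₁ e₂ e₃ i ^ e i).prod =
      SemidirectProduct.inl ⟨e 13, 0, 0, 0, 0, 0, 0, 0⟩ *
      SemidirectProduct.inr ⟨e 11, e 12, e 10⟩ *
      SemidirectProduct.inl ⟨0, e 9, e 8, e 7, e 6, e 5, e 4,
        -- Each of `x_4`, `x_5 = x_4 * f_5` and `x_6 = x_4 * f_6` contributes `1` to the central
        -- coordinate.
        e 5 + e 4 + e 3 + 2 * (e₃ * e 2 + e₂ * e 1 + e₁ * e 0)⟩ := by
  have hl : (List.finRange 14).reverse = [13, 12, 11, 10, 9, 8, 7, 6, 5, 4, 3, 2, 1, 0] := by decide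
  have hk : (⟨0, e 9, e 8, e 7, e 6, e 5, e 4,
        e 5 + e 4 + e 3 + 2 * (e₃ * e 2 + e₂ * e 1 + e₁ * e 0)⟩ : ZClosure e₁ e₂ e₃) =
      ⟨0, 1, 0, 0, 0, 0, 0, 0⟩ ^ e 9 * (⟨0, 0, 1, 0, 0, 0, 0, 0⟩ ^ e 8 *
      (⟨0, 0, 0, 1, 0, 0, 0, 0⟩ ^ e 7 * (⟨0, 0, 0, 0, 1, 0, 0, 0⟩ ^ e 6 *
      (⟨0, 0, 0, 0, 0, 1, 0, 1⟩ ^ e 5 * (⟨0, 0, 0, 0, 0, 0, 1, 1⟩ ^ e 4 *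
      (⟨0, 0, 0, 0, 0, 0, 0, 1⟩ ^ e 3 * (⟨0, 0, 0, 0, 0, 0, 0, 2 * e₃⟩ ^ e 2 *
      (⟨0, 0, 0, 0, 0, 0, 0, 2 * e₂⟩ ^ e 1 * ⟨0, 0, 0, 0, 0, 0, 0, 2 * e₁⟩ ^ e 0)))))))) := by
    rw [ZClosure.zpow_of_cocycle_eq_zero, ZClosure.zpow_of_cocycle_eq_zero,
      ZClosure.zpow_of_cocycle_eq_zero, ZClosure.zpow_of_cocycle_eq_zero,
      ZClosure.zpow_of_cocycle_eq_zero, ZClosure.zpow_of_cocycle_eq_zero,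
      ZClosure.zpow_of_cocycle_eq_zero, ZClosure.zpow_of_cocycle_eq_zero,
      ZClosure.zpow_of_cocycle_eq_zero, ZClosure.zpow_of_cocycle_eq_zero]
    · ext <;> simp [ZClosure.cocycle, doubling_zero]
      ring
    all_goals simp [ZClosure.cocycle, doubling_zero]
  have hh : (⟨e 11, e 12, e 10⟩ : Heisenberg) =
      ⟨0, 1, 0⟩ ^ e 12 * (⟨1, 0, 0⟩ ^ e 11 * ⟨0, 0, 1⟩ ^ e 10) := by
    rw [Heisenberg.zpow_of_mul_eq_zero, Heisenberg.zpow_of_mul_eq_zero,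
      Heisenberg.zpow_of_mul_eq_zero]
    · ext <;> simp
    all_goals simp
  have hz : (⟨e 13, 0, 0, 0, 0, 0, 0, 0⟩ : ZClosure e₁ e₂ e₃) = ⟨1, 0, 0, 0, 0, 0, 0, 0⟩ ^ e 13 := by
    rw [ZClosure.zpow_of_cocycle_eq_zero]
    · simp
    · simp [ZClosure.cocycle, doubling_zero]
  have g0 : gen e₁ e₂ e₃ 0 = SemidirectProduct.inl ⟨0, 0, 0, 0, 0, 0, 0, 2 * e₁⟩ := rfl
  have g1 : gen e₁ e₂ e₃ 1 = SemidirectProduct.inl ⟨0, 0, 0, 0, 0, 0, 0, 2 * e₂⟩ := rfl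
  have g2 : gen e₁ e₂ e₃ 2 = SemidirectProduct.inl ⟨0, 0, 0, 0, 0, 0, 0, 2 * e₃⟩ := rfl
  have g3 : gen e₁ e₂ e₃ 3 = SemidirectProduct.inl ⟨0, 0, 0, 0, 0, 0, 0, 1⟩ := rfl
  have g4 : gen e₁ e₂ e₃ 4 = SemidirectProduct.inl ⟨0, 0, 0, 0, 0, 0, 1, 1⟩ := rfl
  have g5 : gen e₁ e₂ e₃ 5 = SemidirectProduct.inl ⟨0, 0, 0, 0, 0, 1, 0, 1⟩ := rfl
  have g6 : gen e₁ e₂ e₃ 6 = SemidirectProduct.inl ⟨0, 0, 0, 0, 1, 0, 0, 0⟩ := rfl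
  have g7 : gen e₁ e₂ e₃ 7 = SemidirectProduct.inl ⟨0, 0, 0, 1, 0, 0, 0, 0⟩ := rfl
  have g8 : gen e₁ e₂ e₃ 8 = SemidirectProduct.inl ⟨0, 0, 1, 0, 0, 0, 0, 0⟩ := rfl
  have g9 : gen e₁ e₂ e₃ 9 = SemidirectProduct.inl ⟨0, 1, 0, 0, 0, 0, 0, 0⟩ := rfl
  have g10 : gen e₁ e₂ e₃ 10 = SemidirectProduct.inr ⟨0, 0, 1⟩ := rfl
  have g11 : gen e₁ e₂ e₃ 11 = SemidirectProduct.inr ⟨1, 0, 0⟩ := rfl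
  have g12 : gen e₁ e₂ e₃ 12 = SemidirectProduct.inr ⟨0, 1, 0⟩ := rfl
  have g13 : gen e₁ e₂ e₃ 13 = SemidirectProduct.inl ⟨1, 0, 0, 0, 0, 0, 0, 0⟩ := rfl
  rw [hl, hk, hh, hz]
  simp only [List.map_cons, List.map_nil, List.prod_cons, List.prod_nil, mul_one, map_mul, map_zpow,
    mul_assoc, g0, g1, g2, g3, g4, g5, g6, g7, g8, g9, g10, g11, g12, g13]

/-- The Heisenberg factor is the projection to the quotient, and the exponent of `z` can be read off
because the action preserves `n14`. -/
theorem coordinates_eq {n n' : ℤ} {h h' : Heisenberg} {k k' : ZClosure e₁ e₂ e₃}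
    (hk : k.n14 = 0) (hk' : k'.n14 = 0)
    (heq : (SemidirectProduct.inl ⟨n, 0, 0, 0, 0, 0, 0, 0⟩ * SemidirectProduct.inr h *
        SemidirectProduct.inl k : SandwichModel e₁ e₂ e₃) =
      SemidirectProduct.inl ⟨n', 0, 0, 0, 0, 0, 0, 0⟩ * SemidirectProduct.inr h' *
        SemidirectProduct.inl k') : n = n' ∧ h = h' ∧ k = k' := by
  have hr : h = h' := by simpa using congrArg SemidirectProduct.right heq
  subst hr
  have hl : (⟨n, 0, 0, 0, 0, 0, 0, 0⟩ : ZClosure e₁ e₂ e₃) * ZClosure.action h k =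
      ⟨n', 0, 0, 0, 0, 0, 0, 0⟩ * ZClosure.action h k' := by
    simpa using congrArg SemidirectProduct.left heq
  have hn : n = n' := by
    have h2 := congrArg ZClosure.n14 hl
    rw [ZClosure.mul_n14, ZClosure.mul_n14, ZClosure.action_n14, ZClosure.action_n14, hk, hk'] at h2
    simpa using h2
  subst hn
  exact ⟨rfl, rfl, (ZClosure.action h).injective (mul_left_cancel hl)⟩

end SandwichModel

namespace JointModel

theorem word_injective {e e' : Fin 14 → ℤ} (he : ∀ i : Fin 14, (i : ℕ) < 6 → e i = 0 ∨ e i = 1)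
    (he' : ∀ i : Fin 14, (i : ℕ) < 6 → e' i = 0 ∨ e' i = 1)
    (h : ((List.finRange 14).reverse.map fun i => gen i ^ e i).prod =
      ((List.finRange 14).reverse.map fun i => gen i ^ e' i).prod) : e = e' := by
  have h1 := congrArg (MonoidHom.fst _ _) h
  have h2 := congrArg (MonoidHom.fst _ _) (congrArg (MonoidHom.snd _ _) h)
  have h3 := congrArg (MonoidHom.snd _ _) (congrArg (MonoidHom.snd _ _) h)
  simp only [map_list_prod, List.map_map, Function.comp_def, map_zpow] at h1 h2 h3
  change ((List.finRange 14).reverse.map fun i => SandwichModel.gen 1 0 0 i ^ e i).prod =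
    ((List.finRange 14).reverse.map fun i => SandwichModel.gen 1 0 0 i ^ e' i).prod at h1
  change ((List.finRange 14).reverse.map fun i => SandwichModel.gen 0 1 0 i ^ e i).prod =
    ((List.finRange 14).reverse.map fun i => SandwichModel.gen 0 1 0 i ^ e' i).prod at h2
  change ((List.finRange 14).reverse.map fun i => SandwichModel.gen 0 0 1 i ^ e i).prod =
    ((List.finRange 14).reverse.map fun i => SandwichModel.gen 0 0 1 i ^ e' i).prod at h3
  rw [SandwichModel.normalWord_eq, SandwichModel.normalWord_eq] at h1 h2 h3
  obtain ⟨a13, ah, ak⟩ := SandwichModel.coordinates_eq rfl rfl h1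
  obtain ⟨-, -, bk⟩ := SandwichModel.coordinates_eq rfl rfl h2
  obtain ⟨-, -, ck⟩ := SandwichModel.coordinates_eq rfl rfl h3
  simp only [Heisenberg.mk.injEq] at ah
  simp only [ZClosure.mk.injEq, true_and, zero_mul, zero_add, one_mul, add_zero] at ak bk ck
  obtain ⟨a11, a12, a10⟩ := ah
  obtain ⟨a9, a8, a7, a6, a5, a4, ac⟩ := ak
  obtain ⟨-, -, -, -, -, -, bc⟩ := bk
  obtain ⟨-, -, -, -, -, -, cc⟩ := ck
  have key2 : ∀ s t : ℤ, (s = 0 ∨ s = 1) → (t = 0 ∨ t = 1) → (s : ZMod 2) = t → s = t := by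
    rintro s t (rfl | rfl) (rfl | rfl) <;> simp
  -- An element of `ℤ/4` determines its two binary digits. Here they are the exponent of `x_4` and
  -- that of the one among `x_1`, `x_2`, `x_3` that survives in the model.
  have key4 : ∀ s t s' t' : ℤ, (s = 0 ∨ s = 1) → (t = 0 ∨ t = 1) → (s' = 0 ∨ s' = 1) →
      (t' = 0 ∨ t' = 1) → (s : ZMod 4) + 2 * t = s' + 2 * t' → s = s' ∧ t = t' := by
    rintro s t s' t' (rfl | rfl) (rfl | rfl) (rfl | rfl) (rfl | rfl) <;> decide
  have h5 := key2 _ _ (he 5 (by decide)) (he' 5 (by decide)) a5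
  have h4 := key2 _ _ (he 4 (by decide)) (he' 4 (by decide)) a4
  rw [h5, h4, add_assoc, add_assoc (_ + _) (e' 3 : ZMod 4), add_right_inj] at ac bc cc
  obtain ⟨h3, h0⟩ := key4 _ _ _ _ (he 3 (by decide)) (he 0 (by decide)) (he' 3 (by decide))
    (he' 0 (by decide)) ac
  obtain ⟨-, h1⟩ := key4 _ _ _ _ (he 3 (by decide)) (he 1 (by decide)) (he' 3 (by decide))
    (he' 1 (by decide)) bc
  obtain ⟨-, h2⟩ := key4 _ _ _ _ (he 3 (by decide)) (he 2 (by decide)) (he' 3 (by decide))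
    (he' 2 (by decide)) cc
  funext i
  fin_cases i <;> assumption

end JointModel

/-! ### Collection: existence and uniqueness of normal words -/

namespace PCGroup

/-- Conjugation changes a generator only by earlier ones; this triangular shape drives the
collection. -/
theorem pcGen_inv_mul_pcConj_mem {k l : ℕ} :
    (pcGen k)⁻¹ * pcConj k l ∈ Subgroup.closure {g | ∃ j, 1 ≤ j ∧ j < k ∧ g = pcGen j} := by
  have key : ∀ {m : ℕ} (j : ℕ), 1 ≤ j → j < m →
      pcGen j ∈ Subgroup.closure {g | ∃ j, 1 ≤ j ∧ j < m ∧ g = pcGen j} :=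
    fun j h1 h2 => Subgroup.subset_closure ⟨j, h1, h2, rfl⟩
  unfold pcConj
  split <;> simp only [mul_assoc, inv_mul_cancel_left, inv_mul_cancel, one_mem] <;>
    repeat first
      | apply mul_mem
      | apply inv_mem
      | exact key _ (by norm_num) (by norm_num)

theorem pcPower_mem {k : ℕ} :
    pcPower k ∈ Subgroup.closure {g | ∃ j, 1 ≤ j ∧ j < k ∧ g = pcGen j} := by
  have key : ∀ {m : ℕ} (j : ℕ), 1 ≤ j → j < m →
      pcGen j ∈ Subgroup.closure {g | ∃ j, 1 ≤ j ∧ j < m ∧ g = pcGen j} :=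
    fun j h1 h2 => Subgroup.subset_closure ⟨j, h1, h2, rfl⟩
  unfold pcPower
  split <;> repeat first
      | apply mul_mem
      | apply one_mem
      | exact key _ (by norm_num) (by norm_num)

/-- The subgroup generated by `x_1, …, x_i`. -/
def initial (i : ℕ) : Subgroup PCGroup := Subgroup.closure {g | ∃ j, 1 ≤ j ∧ j ≤ i ∧ g = gen j}

theorem gen_mem_initial {i j : ℕ} (h1 : 1 ≤ j) (h2 : j ≤ i) : gen j ∈ initial i :=
  Subgroup.subset_closure ⟨j, h1, h2, rfl⟩

theorem initial_mono {i j : ℕ} (h : i ≤ j) : initial i ≤ initial j :=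
  Subgroup.closure_mono fun _ ⟨k, h1, h2, h3⟩ => ⟨k, h1, h2.trans h, h3⟩

theorem mk_mem_initial {i : ℕ} {w : FreeGroup (Fin 14)}
    (hw : w ∈ Subgroup.closure {g | ∃ j, 1 ≤ j ∧ j < i + 1 ∧ g = pcGen j}) :
    PresentedGroup.mk pcRels w ∈ initial i := by
  have h := Subgroup.mem_map_of_mem (PresentedGroup.mk pcRels) hw
  rw [MonoidHom.map_closure] at h
  refine Subgroup.closure_mono ?_ h
  rintro _ ⟨_, ⟨j, h1, h2, rfl⟩, rfl⟩
  exact ⟨j, h1, by omega, rfl⟩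

theorem gen_sq {k : ℕ} (h1 : 1 ≤ k) (h2 : k ≤ 6) :
    gen k ^ 2 = PresentedGroup.mk pcRels (pcPower k) := by
  have h : PresentedGroup.mk pcRels ((pcGen k) ^ 2 * (pcPower k)⁻¹) = 1 :=
    PresentedGroup.one_of_mem (Or.inl ⟨k, h1, h2, rfl⟩)
  rwa [map_mul, map_inv, mul_inv_eq_one, map_pow] at h

theorem gen_conj {k l : ℕ} (h1 : 1 ≤ k) (h2 : k < l) (h3 : l ≤ 14) :
    (gen l)⁻¹ * gen k * gen l = PresentedGroup.mk pcRels (pcConj k l) := by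
  have h : PresentedGroup.mk pcRels ((pcGen l)⁻¹ * pcGen k * pcGen l * (pcConj k l)⁻¹) = 1 :=
    PresentedGroup.one_of_mem (Or.inr ⟨k, l, h1, h2, h3, rfl⟩)
  rwa [map_mul, map_inv, mul_inv_eq_one, map_mul, map_mul, map_inv] at h

theorem gen_inv_mul_conj_mem {k l : ℕ} (h1 : 1 ≤ k + 1) (h2 : k + 1 < l) (h3 : l ≤ 14) :
    (gen (k + 1))⁻¹ * ((gen l)⁻¹ * gen (k + 1) * gen l) ∈ initial k := by
  rw [gen_conj h1 h2 h3, gen, ← map_inv, ← map_mul]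
  exact mk_mem_initial pcGen_inv_mul_pcConj_mem

theorem initial_induction {i : ℕ} {p : PCGroup → Prop} (hg : ∀ j, j + 1 ≤ i → p (gen (j + 1)))
    (h1 : p 1) (hm : ∀ a b, p a → p b → p (a * b)) (hi : ∀ a, p a → p a⁻¹) :
    ∀ g ∈ initial i, p g := by
  intro g hgm
  induction hgm using Subgroup.closure_induction with
  | mem x hx =>
    obtain ⟨j, h1, h2, rfl⟩ := hx
    obtain ⟨j, rfl⟩ : ∃ j', j = j' + 1 := ⟨j - 1, by omega⟩
    exact hg j h2
  | one => exact h1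
  | mul a b _ _ ha hb => exact hm a b ha hb
  | inv a _ ha => exact hi a ha

theorem conj_mem_initial {i l : ℕ} (hil : i < l) (hl : l ≤ 14) :
    ∀ g ∈ initial i, (gen l)⁻¹ * g * gen l ∈ initial i := by
  refine initial_induction ?_ (by simp) ?_ ?_
  · intro j hj
    have h := initial_mono (by omega : j ≤ i) (gen_inv_mul_conj_mem (by omega) (by omega : j + 1 < l) hl)
    simpa using mul_mem (gen_mem_initial (by omega) hj) h
  · intro a b ha hb
    simpa [mul_assoc] using mul_mem ha hb
  · intro a ha
    simpa [mul_assoc] using inv_mem ha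

theorem conj_inv_mem_initial {i l : ℕ} (hil : i < l) (hl : l ≤ 14) :
    ∀ g ∈ initial i, gen l * g * (gen l)⁻¹ ∈ initial i := by
  induction i with
  | zero =>
    refine initial_induction (fun j hj => by omega) (by simp) ?_ ?_
    · intro a b ha hb
      simpa [mul_assoc] using mul_mem ha hb
    · intro a ha
      simpa [mul_assoc] using inv_mem ha
  | succ i ih =>
    refine initial_induction ?_ (by simp) ?_ ?_
    · intro j hj
      have h := gen_inv_mul_conj_mem (by omega) (by omega : j + 1 < l) hl
      have h' := initial_mono (by omega : i ≤ i + 1)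
        -- If `x ^ g = x * t` with `t` in a smaller initial subgroup, then `g * x * g⁻¹ = x * (g * t
        -- * g⁻¹)⁻¹`, and the induction hypothesis handles `t`.
        (ih (by omega) _ (initial_mono (by omega : j ≤ i) h))
      have h2 := mul_mem (gen_mem_initial (by omega) hj) (inv_mem h')
      simpa [mul_assoc] using h2
    · intro a b ha hb
      simpa [mul_assoc] using mul_mem ha hb
    · intro a ha
      simpa [mul_assoc] using inv_mem ha

theorem exists_zpow_mul {i : ℕ} (hi : i < 14) {g : PCGroup} (hg : g ∈ initial (i + 1)) :
    ∃ n : ℤ, ∃ h ∈ initial i, g = gen (i + 1) ^ n * h := by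
  induction hg using Subgroup.closure_induction_right with
  | one => exact ⟨0, 1, one_mem _, by simp⟩
  | mul_right a b hb ha h =>
    obtain ⟨n, h, hh, rfl⟩ := h
    obtain ⟨j, h1, h2, rfl⟩ := ha
    rcases Nat.lt_or_ge j (i + 1) with hj | hj
    · exact ⟨n, h * gen j, mul_mem hh (gen_mem_initial h1 (by omega)), mul_assoc _ _ _⟩
    · obtain rfl : j = i + 1 := le_antisymm h2 hj
      refine ⟨n + 1, _, conj_mem_initial (l := i + 1) (by omega) (by omega) h hh, ?_⟩
      rw [zpow_add_one]; group
  | mul_inv_cancel a b hb ha h =>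
    obtain ⟨n, h, hh, rfl⟩ := h
    obtain ⟨j, h1, h2, rfl⟩ := ha
    rcases Nat.lt_or_ge j (i + 1) with hj | hj
    · exact ⟨n, h * (gen j)⁻¹, mul_mem hh (inv_mem (gen_mem_initial h1 (by omega))), mul_assoc _ _ _⟩
    · obtain rfl : j = i + 1 := le_antisymm h2 hj
      refine ⟨n - 1, _, conj_inv_mem_initial (l := i + 1) (by omega) (by omega) h hh, ?_⟩
      rw [zpow_sub_one]; group

theorem exists_zpow_mul_of_lt {i : ℕ} (hi : i < 14) {g : PCGroup} (hg : g ∈ initial (i + 1)) :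
    ∃ n : ℤ, (i < 6 → n = 0 ∨ n = 1) ∧ ∃ h ∈ initial i, g = gen (i + 1) ^ n * h := by
  obtain ⟨n, h, hh, rfl⟩ := exists_zpow_mul hi hg
  by_cases hi6 : i < 6
  · have hsq : gen (i + 1) ^ (2 : ℤ) ∈ initial i := by
      rw [zpow_ofNat, gen_sq (by omega) (by omega)]
      exact mk_mem_initial pcPower_mem
    refine ⟨n % 2, fun _ => Int.emod_two_eq_zero_or_one n, (gen (i + 1) ^ (2 : ℤ)) ^ (n / 2) * h,
      mul_mem (zpow_mem hsq _) hh, ?_⟩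
    rw [← mul_assoc, ← zpow_mul, ← zpow_add, Int.emod_add_mul_ediv]
  · exact ⟨n, fun h => absurd h hi6, h, hh, rfl⟩

theorem exists_word {i : ℕ} (hi : i ≤ 14) : ∀ g ∈ initial i, ∃ e : ℕ → ℤ,
    (∀ j < 6, e j = 0 ∨ e j = 1) ∧
      g = ((List.range i).reverse.map fun j => gen (j + 1) ^ e j).prod := by
  induction i with
  | zero =>
    refine initial_induction (fun j hj => by omega) ⟨0, by simp, by simp⟩ ?_ ?_
    · rintro a b ⟨_, _, ha⟩ ⟨_, _, hb⟩
      exact ⟨0, by simp, by simpa [ha] using hb⟩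
    · rintro a ⟨_, _, ha⟩
      exact ⟨0, by simp, by simp [ha]⟩
  | succ i ih =>
    intro g hg
    obtain ⟨n, hn, h, hh, rfl⟩ := exists_zpow_mul_of_lt (by omega) hg
    obtain ⟨e, he, rfl⟩ := ih (by omega) h hh
    refine ⟨Function.update e i n, fun j hj => ?_, ?_⟩
    · by_cases hji : j = i
      · subst hji; simpa using hn hj
      · simpa [hji] using he j hj
    · rw [List.range_succ, List.reverse_append, List.reverse_singleton, List.singleton_append,
        List.map_cons, List.prod_cons, Function.update_self]
      congr 2
      refine List.map_congr_left fun j hj => ?_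
      have : j < i := by simpa using hj
      rw [Function.update_of_ne this.ne]

theorem of_eq_gen (i : Fin 14) : (PresentedGroup.of i : PCGroup) = gen (i + 1) := by
  rw [gen, pcGen, Nat.add_sub_cancel]; simp; rfl

theorem initial_eq_top : initial 14 = ⊤ := by
  rw [eq_top_iff, ← PresentedGroup.closure_range_of pcRels, Subgroup.closure_le]
  rintro _ ⟨i, rfl⟩
  rw [of_eq_gen]
  exact gen_mem_initial (by omega) (by omega)

/-- The homomorphism to the joint model. -/
def toModel : PCGroup →* JointModel := PresentedGroup.toGroup JointModel.lift_gen

theorem toModel_gen (i : Fin 14) : toModel (gen (i + 1)) = JointModel.gen i := by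
  rw [← of_eq_gen]
  exact PresentedGroup.toGroup.of _

theorem toModel_normalWord (e : Fin 14 → ℤ) : toModel (normalWord e) =
    ((List.finRange 14).reverse.map fun i => JointModel.gen i ^ e i).prod := by
  rw [normalWord, map_list_prod, List.map_map]
  simp only [Function.comp_def, map_zpow, toModel_gen]

theorem exists_normalWord (g : PCGroup) : ∃ e : Fin 14 → ℤ,
    (∀ i : Fin 14, (i : ℕ) < 6 → e i = 0 ∨ e i = 1) ∧ g = normalWord e := by
  obtain ⟨e, he, rfl⟩ := exists_word le_rfl g (initial_eq_top ▸ Subgroup.mem_top g)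
  refine ⟨fun i => e i, fun i hi => he i hi, ?_⟩
  rfl

theorem consistent : Consistent := by
  intro g
  obtain ⟨e, he, rfl⟩ := exists_normalWord g
  refine ⟨e, ⟨he, rfl⟩, fun e' ⟨he', h⟩ => ?_⟩
  refine (JointModel.word_injective he he' ?_).symm
  rw [← toModel_normalWord, ← toModel_normalWord, h]

theorem toModel_injective : Function.Injective toModel := by
  intro g h hgh
  obtain ⟨e, he, rfl⟩ := exists_normalWord g
  obtain ⟨e', he', rfl⟩ := exists_normalWord h
  rw [toModel_normalWord, toModel_normalWord] at hgh
  rw [JointModel.word_injective he he' hgh]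

end PCGroup

theorem map_gcomm {G H : Type*} [Group G] [Group H] (f : G →* H) (a b : G) :
    f (gcomm a b) = gcomm (f a) (f b) := by
  simp [gcomm]

theorem map_commutatorList {G H : Type*} [Group G] [Group H] (f : G →* H) (x y z : G) :
    f ∘ commutatorList x y z = commutatorList (f x) (f y) (f z) := by
  simp only [commutatorList, ← map_gcomm]
  funext i
  fin_cases i <;> rfl

/-! ### Conjugates of `z` in the models -/

namespace ZClosure
variable {e₁ e₂ e₃ : ZMod 4}

/-- The invariant that characterizes the conjugates of `z`. -/
def ConjInvariant (u : ZClosure e₁ e₂ e₃) : Prop :=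
  u.n14 = 1 ∧ Even (u.n7 + u.n8 - u.n9 * u.n10)

theorem ConjInvariant.conj {u : ZClosure e₁ e₂ e₃} (hu : ConjInvariant u) (v : ZClosure e₁ e₂ e₃) :
    ConjInvariant (v⁻¹ * u * v) := by
  obtain ⟨h1, h2⟩ := hu
  refine ⟨by simp [h1], ?_⟩
  convert h2 using 1
  simp

/-- Once `n14 = 1`, the integer `n7 + n8 - n9 * n10` itself is unchanged. It is `0` for `z`, and
only its parity matters for commutation. -/
theorem ConjInvariant.conjX {u : ZClosure e₁ e₂ e₃} (hu : ConjInvariant u) :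
    ConjInvariant (ZClosure.conjX u) := by
  obtain ⟨h1, h2⟩ := hu
  refine ⟨h1, ?_⟩
  convert h2 using 1
  simp only [ZClosure.conjX, h1]
  ring

theorem ConjInvariant.conjXInv {u : ZClosure e₁ e₂ e₃} (hu : ConjInvariant u) :
    ConjInvariant (ZClosure.conjXInv u) := by
  obtain ⟨h1, h2⟩ := hu
  refine ⟨h1, ?_⟩
  convert h2 using 1
  simp only [ZClosure.conjXInv, h1]
  ring

theorem ConjInvariant.conjY {u : ZClosure e₁ e₂ e₃} (hu : ConjInvariant u) :
    ConjInvariant (ZClosure.conjY u) := by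
  obtain ⟨h1, h2⟩ := hu
  refine ⟨h1, ?_⟩
  convert h2 using 1
  simp only [ZClosure.conjY, h1]
  ring

theorem ConjInvariant.conjYInv {u : ZClosure e₁ e₂ e₃} (hu : ConjInvariant u) :
    ConjInvariant (ZClosure.conjYInv u) := by
  obtain ⟨h1, h2⟩ := hu
  refine ⟨h1, ?_⟩
  convert h2 using 1
  simp only [ZClosure.conjYInv, h1]
  ring

theorem ConjInvariant.action [Fact (e₁ + e₂ + e₃ = 1)] {u : ZClosure e₁ e₂ e₃}
    (hu : ConjInvariant u) (h : Heisenberg) : ConjInvariant (ZClosure.action h u) := by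
  let S : Subgroup (MulAut (ZClosure e₁ e₂ e₃)) :=
    -- Asking for `f⁻¹` as well makes the set closed under inversion.
    { carrier := {f | ∀ u, ConjInvariant u → ConjInvariant (f u) ∧ ConjInvariant (f⁻¹ u)}
      one_mem' := fun u hu => ⟨hu, hu⟩
      mul_mem' := fun {f g} hf hg u hu => by
        rw [mul_inv_rev, MulAut.mul_apply, MulAut.mul_apply]
        exact ⟨(hf _ (hg u hu).1).1, (hg _ (hf u hu).2).2⟩
      inv_mem' := fun {f} hf u hu => by
        rw [inv_inv]; exact (hf u hu).symm }
  have hX : autX ∈ S := fun u hu => ⟨hu.conjX, hu.conjXInv⟩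
  have hY : autY ∈ S := fun u hu => ⟨hu.conjY, hu.conjYInv⟩
  have hO : autO ∈ S :=
    S.mul_mem (S.mul_mem (S.mul_mem hY hX) (S.inv_mem hY)) (S.inv_mem hX)
  exact (S.mul_mem (S.mul_mem (S.zpow_mem (S.inv_mem hY) _) (S.zpow_mem (S.inv_mem hX) _))
    (S.zpow_mem (S.inv_mem hO) _) u hu).1

theorem commute_of_cocycle {u v : ZClosure e₁ e₂ e₃} (h : cocycle u v = cocycle v u) :
    Commute u v := by
  ext <;> simp [add_comm, h]

theorem ConjInvariant.intCast_n7 {u : ZClosure e₁ e₂ e₃} (hu : ConjInvariant u) :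
    ∃ r : ZMod 4, (u.n7 : ZMod 4) = 2 * r + u.n9 * u.n10 - u.n8 := by
  obtain ⟨-, r, h⟩ := hu
  refine ⟨r, ?_⟩
  have h' : u.n7 = 2 * r + u.n9 * u.n10 - u.n8 := by linear_combination h
  exact_mod_cast congrArg (Int.cast : ℤ → ZMod 4) h'

theorem ConjInvariant.commute_conjX [hodd : Fact (e₁ + e₂ + e₃ = 1)] {u : ZClosure e₁ e₂ e₃} (hu : ConjInvariant u) :
    Commute u (ZClosure.conjX u) := by
  -- The invariant eliminates `n7` modulo 4 up to an even term, after which the two cocycle values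
  -- agree.
  obtain ⟨r, h7⟩ := hu.intCast_n7
  apply commute_of_cocycle
  simp only [cocycle, ZClosure.conjX, hu.1, doubling_add, doubling_intCast, Int.cast_add, Int.cast_one]
  obtain ⟨d5, h5⟩ := exists_doubling_eq u.f5
  obtain ⟨d6, h6⟩ := exists_doubling_eq u.f6
  simp only [h5, h6, h7]
  rw [← sub_eq_zero]
  ring_nf
  reduce_mod_char
  linear_combination 3 * (e₁ + e₂) * two_mul_sq_sub (u.n10 : ZMod 4) + 6 * (u.n10 : ZMod 4) * hodd.out +
    3 * (u.n10 : ZMod 4) * four_eq_zero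

theorem ConjInvariant.commute_conjY {u : ZClosure e₁ e₂ e₃} (hu : ConjInvariant u) :
    Commute u (ZClosure.conjY u) := by
  obtain ⟨r, h7⟩ := hu.intCast_n7
  apply commute_of_cocycle
  simp only [cocycle, ZClosure.conjY, hu.1, doubling_add, doubling_intCast, Int.cast_add, Int.cast_one]
  obtain ⟨d5, h5⟩ := exists_doubling_eq u.f5
  obtain ⟨d6, h6⟩ := exists_doubling_eq u.f6
  simp only [h5, h6, h7]
  rw [← sub_eq_zero]
  ring_nf
  reduce_mod_char
  linear_combination 3 * (e₂ + e₃) * two_mul_sq_sub (u.n9 : ZMod 4) +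
    3 * (e₂ + e₃) * (u.n9 : ZMod 4) * four_eq_zero

theorem commute_conj_zpow (u : ZClosure e₁ e₂ e₃) (n : ℤ) : Commute u ((⟨n, 0, 0, 0, 0, 0, 0, 0⟩ : ZClosure e₁ e₂ e₃)⁻¹ * u *
      ⟨n, 0, 0, 0, 0, 0, 0, 0⟩) := by
  apply commute_of_cocycle
  simp [cocycle]

end ZClosure

namespace SandwichModel
variable {e₁ e₂ e₃ : ZMod 4} [Fact (e₁ + e₂ + e₃ = 1)]

theorem exists_conj_z_eq (g : SandwichModel e₁ e₂ e₃) :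
    ∃ u : ZClosure e₁ e₂ e₃, u.ConjInvariant ∧ g⁻¹ * z * g = SemidirectProduct.inl u := by
  refine ⟨ZClosure.action g.right⁻¹ (g.left⁻¹ * ⟨1, 0, 0, 0, 0, 0, 0, 0⟩ * g.left),
    ZClosure.ConjInvariant.action (ZClosure.ConjInvariant.conj ⟨rfl, by simp⟩ _) _, ?_⟩
  rw [SemidirectProduct.inl_aut, inv_inv, map_mul, map_mul, map_inv, map_inv]
  conv_lhs => rw [← SemidirectProduct.inl_left_mul_inr_right g]
  rw [mul_inv_rev, z]
  simp only [mul_assoc]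

theorem commute_conj_conj_x (g : SandwichModel e₁ e₂ e₃) :
    Commute (g⁻¹ * z * g) (x⁻¹ * (g⁻¹ * z * g) * x) := by
  obtain ⟨u, hu, h⟩ := exists_conj_z_eq g
  have h' : x⁻¹ * SemidirectProduct.inl u * x = SemidirectProduct.inl (ZClosure.conjX u) := by
    have ha : (ZClosure.action ⟨1, 0, 0⟩ : MulAut (ZClosure e₁ e₂ e₃))⁻¹ = ZClosure.autX := by
      simp [ZClosure.action, Heisenberg.lift]
    rw [x, ← map_inv, ← SemidirectProduct.inl_aut_inv, ha]
    rfl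
  rw [h, h']
  exact hu.commute_conjX.map SemidirectProduct.inl

theorem commute_conj_conj_y (g : SandwichModel e₁ e₂ e₃) :
    Commute (g⁻¹ * z * g) (y⁻¹ * (g⁻¹ * z * g) * y) := by
  obtain ⟨u, hu, h⟩ := exists_conj_z_eq g
  have h' : y⁻¹ * SemidirectProduct.inl u * y = SemidirectProduct.inl (ZClosure.conjY u) := by
    have ha : (ZClosure.action ⟨0, 1, 0⟩ : MulAut (ZClosure e₁ e₂ e₃))⁻¹ = ZClosure.autY := by
      simp [ZClosure.action, Heisenberg.lift]
    rw [y, ← map_inv, ← SemidirectProduct.inl_aut_inv, ha]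
    rfl
  rw [h, h']
  exact hu.commute_conjY.map SemidirectProduct.inl

theorem commute_conj_conj_z (g : SandwichModel e₁ e₂ e₃) :
    Commute (g⁻¹ * z * g) (z⁻¹ * (g⁻¹ * z * g) * z) := by
  obtain ⟨u, -, h⟩ := exists_conj_z_eq g
  rw [h, z, ← map_inv, ← map_mul, ← map_mul]
  exact (ZClosure.commute_conj_zpow u 1).map SemidirectProduct.inl

end SandwichModel

theorem commute_map_conj_conj {A B : Type*} [Group A] [Group B] (f : A →* B) {g s t : A}
    (h : Commute ((f g)⁻¹ * f s * f g) ((f t)⁻¹ * ((f g)⁻¹ * f s * f g) * f t)) :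
    Commute (f (g⁻¹ * s * g)) (f (t⁻¹ * (g⁻¹ * s * g) * t)) := by
  simpa using h

namespace JointModel

/-- The projection to the first model. -/
def fst : JointModel →* SandwichModel 1 0 0 := MonoidHom.fst _ _

/-- The projection to the second model. -/
def snd : JointModel →* SandwichModel 0 1 0 := (MonoidHom.fst _ _).comp (MonoidHom.snd _ _)

/-- The projection to the third model. -/
def trd : JointModel →* SandwichModel 0 0 1 := (MonoidHom.snd _ _).comp (MonoidHom.snd _ _)

theorem commute_of_components {g h : JointModel} (h1 : Commute (fst g) (fst h))
    (h2 : Commute (snd g) (snd h)) (h3 : Commute (trd g) (trd h)) : Commute g h := by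
  have key : ∀ {a b : JointModel}, fst a = fst b → snd a = snd b → trd a = trd b → a = b :=
    fun h1 h2 h3 => Prod.ext h1 (Prod.ext h2 h3)
  exact key (by rw [map_mul, map_mul, h1.eq]) (by rw [map_mul, map_mul, h2.eq])
    (by rw [map_mul, map_mul, h3.eq])

set_option maxHeartbeats 800000 in
theorem commute_conj_conj (g : JointModel) {i : Fin 14} (hi : i = 11 ∨ i = 12 ∨ i = 13) :
    Commute (g⁻¹ * gen 13 * g) ((gen i)⁻¹ * (g⁻¹ * gen 13 * g) * gen i) := by
  have x1 : fst (gen 11) = SandwichModel.x := rfl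
  have y1 : fst (gen 12) = SandwichModel.y := rfl
  have z1 : fst (gen 13) = SandwichModel.z := rfl
  have x2 : snd (gen 11) = SandwichModel.x := rfl
  have y2 : snd (gen 12) = SandwichModel.y := rfl
  have z2 : snd (gen 13) = SandwichModel.z := rfl
  have x3 : trd (gen 11) = SandwichModel.x := rfl
  have y3 : trd (gen 12) = SandwichModel.y := rfl
  have z3 : trd (gen 13) = SandwichModel.z := rfl
  rcases hi with rfl | rfl | rfl
  · exact commute_of_components
      (commute_map_conj_conj fst (by
        have h := SandwichModel.commute_conj_conj_x (fst g)
        rw [x1, z1]; with_reducible exact h))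
      (commute_map_conj_conj snd (by
        have h := SandwichModel.commute_conj_conj_x (snd g)
        rw [x2, z2]; with_reducible exact h))
      (commute_map_conj_conj trd (by
        have h := SandwichModel.commute_conj_conj_x (trd g)
        rw [x3, z3]; with_reducible exact h))
  · exact commute_of_components
      (commute_map_conj_conj fst (by
        have h := SandwichModel.commute_conj_conj_y (fst g)
        rw [y1, z1]; with_reducible exact h))
      (commute_map_conj_conj snd (by
        have h := SandwichModel.commute_conj_conj_y (snd g)
        rw [y2, z2]; with_reducible exact h))
      (commute_map_conj_conj trd (by
        have h := SandwichModel.commute_conj_conj_y (trd g)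
        rw [y3, z3]; with_reducible exact h))
  · exact commute_of_components
      (commute_map_conj_conj fst (by
        have h := SandwichModel.commute_conj_conj_z (fst g)
        rw [z1]; with_reducible exact h))
      (commute_map_conj_conj snd (by
        have h := SandwichModel.commute_conj_conj_z (snd g)
        rw [z2]; with_reducible exact h))
      (commute_map_conj_conj trd (by
        have h := SandwichModel.commute_conj_conj_z (trd g)
        rw [z3]; with_reducible exact h))

end JointModel

/-! ### Cyclic symmetry and the sandwich property of the presented group -/

namespace PCGroup

theorem toModel_x : toModel (gen 12) = JointModel.gen 11 := toModel_gen 11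
theorem toModel_y : toModel (gen 13) = JointModel.gen 12 := toModel_gen 12
theorem toModel_z : toModel (gen 14) = JointModel.gen 13 := toModel_gen 13

theorem gen_eq_commutatorList (i : Fin 14) :
    gen (i + 1) = commutatorList (gen 12) (gen 13) (gen 14) i := by
  apply toModel_injective
  have h := congrFun (map_commutatorList toModel (gen 12) (gen 13) (gen 14)) i
  rw [Function.comp_apply] at h
  rw [toModel_gen, h, toModel_x, toModel_y, toModel_z]
  exact congrFun JointModel.gen_eq_commutatorList i

theorem hom_ext {G : Type*} [Group G] {f g : PCGroup →* G} (hx : f (gen 12) = g (gen 12))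
    (hy : f (gen 13) = g (gen 13)) (hz : f (gen 14) = g (gen 14)) : f = g := by
  refine PresentedGroup.ext fun i => ?_
  rw [of_eq_gen, gen_eq_commutatorList]
  have h1 := congrFun (map_commutatorList f (gen 12) (gen 13) (gen 14)) i
  have h2 := congrFun (map_commutatorList g (gen 12) (gen 13) (gen 14)) i
  rw [Function.comp_apply] at h1 h2
  rw [h1, h2, hx, hy, hz]

theorem lift_rotate :
    ∀ r ∈ pcRels, FreeGroup.lift (commutatorList (gen 13) (gen 14) (gen 12)) r = 1 := by
  intro r hr
  apply toModel_injective
  have h : toModel.comp (FreeGroup.lift (commutatorList (gen 13) (gen 14) (gen 12))) =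
      FreeGroup.lift (commutatorList (JointModel.gen 12) (JointModel.gen 13) (JointModel.gen 11)) := by
    ext1 i
    rw [MonoidHom.comp_apply, FreeGroup.lift_apply_of, FreeGroup.lift_apply_of,
      ← toModel_x, ← toModel_y, ← toModel_z]
    exact congrFun (map_commutatorList toModel (gen 13) (gen 14) (gen 12)) i
  rw [map_one, ← MonoidHom.comp_apply, h]
  exact JointModel.lift_rotate r hr

/-- The homomorphism that permutes `x_12`, `x_13`, `x_14` cyclically. -/
def rotate : PCGroup →* PCGroup := PresentedGroup.toGroup lift_rotate

theorem rotate_gen (i : Fin 14) :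
    rotate (gen (i + 1)) = commutatorList (gen 13) (gen 14) (gen 12) i := by
  rw [← of_eq_gen]
  exact PresentedGroup.toGroup.of _

theorem rotate_x : rotate (gen 12) = gen 13 := rotate_gen 11
theorem rotate_y : rotate (gen 13) = gen 14 := rotate_gen 12
theorem rotate_z : rotate (gen 14) = gen 12 := rotate_gen 13

theorem rotate_rotate_rotate (g : PCGroup) : rotate (rotate (rotate g)) = g := by
  have h : rotate.comp (rotate.comp rotate) = MonoidHom.id PCGroup := by
    apply hom_ext <;> simp [rotate_x, rotate_y, rotate_z]
  exact DFunLike.congr_fun h g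

theorem commute_conj_conj_z (g : PCGroup) {b : PCGroup}
    (hb : b ∈ ({gen 12, gen 13, gen 14} : Set PCGroup)) :
    Commute (g⁻¹ * gen 14 * g) (b⁻¹ * (g⁻¹ * gen 14 * g) * b) := by
  obtain ⟨i, hi, h⟩ : ∃ i : Fin 14, (i = 11 ∨ i = 12 ∨ i = 13) ∧ toModel b = JointModel.gen i := by
    rcases hb with rfl | rfl | rfl
    · exact ⟨11, by decide, toModel_x⟩
    · exact ⟨12, by decide, toModel_y⟩
    · exact ⟨13, by decide, toModel_z⟩
  have h2 := commute_map_conj_conj toModel (g := g) (s := gen 14) (t := b)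
    (by
      have h3 := JointModel.commute_conj_conj (toModel g) hi
      rw [toModel_z, h]; with_reducible exact h3)
  refine toModel_injective ?_
  exact (map_mul toModel _ _).trans (h2.eq.trans (map_mul toModel _ _).symm)

/-- One or two rotations bring `a` to `x_14`, and further rotations bring the relation back, since
`rotate` has order three. -/
theorem commute_conj_conj {a : PCGroup} (ha : a ∈ ({gen 12, gen 13, gen 14} : Set PCGroup))
    (g : PCGroup) {b : PCGroup} (hb : b ∈ ({gen 12, gen 13, gen 14} : Set PCGroup)) :
    Commute (g⁻¹ * a * g) (b⁻¹ * (g⁻¹ * a * g) * b) := by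
  have hr : ∀ b ∈ ({gen 12, gen 13, gen 14} : Set PCGroup),
      rotate b ∈ ({gen 12, gen 13, gen 14} : Set PCGroup) := by
    rintro b (rfl | rfl | rfl)
    · simp [rotate_x]
    · simp [rotate_y]
    · simp [rotate_z]
  rcases ha with rfl | rfl | rfl
  · have h := (commute_conj_conj_z (rotate (rotate g)) (hr _ (hr _ hb))).map rotate
    simpa [rotate_z, rotate_rotate_rotate] using h
  · have h := ((commute_conj_conj_z (rotate g) (hr _ hb)).map rotate).map rotate
    simpa [rotate_z, rotate_x, rotate_rotate_rotate] using h
  · exact commute_conj_conj_z g hb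

end PCGroup

/-- Two elements that commute with each other's conjugates generate a group of class at most `2`. -/
theorem nilpotentOfClassLE_two_closure_pair {G : Type*} [Group G] {a b : G}
    (ha : Commute a (b⁻¹ * a * b)) (hb : Commute b (a⁻¹ * b * a)) :
    NilpotentOfClassLE (Subgroup.closure ({a, b} : Set G)) 2 := by
  have ha' : Commute (gcomm a b) a := by
    rw [conj_eq_mul_gcomm] at ha
    exact (Commute.of_mul_right ha (Commute.refl a)).symm
  have hb' : Commute (gcomm a b) b := by
    rw [conj_eq_mul_gcomm] at hb
    have h := Commute.of_mul_right hb (Commute.refl b)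
    rw [← gcomm_inv a b] at h
    exact (Commute.inv_right_iff.1 h).symm
  have mem : ∀ {c}, c ∈ ({a, b} : Set G) → c ∈ Subgroup.closure ({a, b} : Set G) :=
    fun h => Subgroup.subset_closure h
  let A : Subgroup.closure ({a, b} : Set G) := ⟨a, mem (by simp)⟩
  let B : Subgroup.closure ({a, b} : Set G) := ⟨b, mem (by simp)⟩
  have hg : Generates A B B := by
    intro H hA hB _ g
    have : Subgroup.closure ({a, b} : Set G) ≤ H.map (Subgroup.subtype _) := by
      rw [Subgroup.closure_le]
      rintro _ (rfl | rfl)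
      · exact ⟨A, hA, rfl⟩
      · exact ⟨B, hB, rfl⟩
    obtain ⟨g', hg', h⟩ := this g.2
    rwa [← Subtype.ext h]
  have hAB : gcomm A B ∈ Subgroup.upperCentralSeries (Subgroup.closure ({a, b} : Set G)) 1 := by
    have h1 : gcomm (gcomm A B) A = 1 := gcomm_eq_one_iff.2 (Subtype.ext ha')
    have h2 : gcomm (gcomm A B) B = 1 := gcomm_eq_one_iff.2 (Subtype.ext hb')
    exact hg.mem_upperCentralSeries (h1 ▸ one_mem _) (h2 ▸ one_mem _) (h2 ▸ one_mem _)
  have self : ∀ c : Subgroup.closure ({a, b} : Set G), gcomm c c = 1 := fun c => by simp [gcomm]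
  have hBA : gcomm B A ∈ Subgroup.upperCentralSeries (Subgroup.closure ({a, b} : Set G)) 1 := by
    rw [← gcomm_inv]; exact inv_mem hAB
  refine nilpotentOfClassLE_of_eq_top (eq_top_iff.2 fun g _ => ?_)
  refine hg _ ?_ ?_ ?_ g
  · exact hg.mem_upperCentralSeries (self A ▸ one_mem _) hAB hAB
  · exact hg.mem_upperCentralSeries hBA (self B ▸ one_mem _) (self B ▸ one_mem _)
  · exact hg.mem_upperCentralSeries hBA (self B ▸ one_mem _) (self B ▸ one_mem _)

theorem PCGroup.isSandwichSet : IsSandwichSet ({gen 12, gen 13, gen 14} : Set PCGroup) := by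
  intro a ha b hb g _
  apply nilpotentOfClassLE_two_closure_pair
  -- That `a` commutes with its conjugate by `b ^ g` is, after conjugation by `g⁻¹`, a statement
  -- about a conjugate of `a` and the generator `b`.
  · have h := (PCGroup.commute_conj_conj ha g⁻¹ hb).conj_conj g
    convert h using 1 <;> group
  · exact PCGroup.commute_conj_conj hb g ha

/-! ### The isomorphism with the free sandwich group -/

namespace FreeSandwichGroup

theorem range_of_eq : Set.range (of : Fin 3 → FreeSandwichGroup (Fin 3)) = {of 0, of 1, of 2} := by
  ext g
  simp only [Set.mem_range, Fin.exists_fin_succ, Set.mem_insert_iff, Set.mem_singleton_iff]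
  simp [eq_comm]

theorem isSandwichSet_of : IsSandwichSet ({of 0, of 1, of 2} : Set (FreeSandwichGroup (Fin 3))) :=
  range_of_eq ▸ isSandwichSet_range_of (Fin 3)

theorem closure_of :
    Subgroup.closure ({of 0, of 1, of 2} : Set (FreeSandwichGroup (Fin 3))) = ⊤ :=
  range_of_eq ▸ closure_range_of (Fin 3)

/-- The homomorphism from the presented group to the free sandwich group. -/
def ofPCGroup : PCGroup →* FreeSandwichGroup (Fin 3) :=
  PresentedGroup.toGroup (isSandwichSet_of.lift_commutatorList closure_of)

theorem ofPCGroup_gen (i : Fin 14) :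
    ofPCGroup (PCGroup.gen (i + 1)) = commutatorList (of 0) (of 1) (of 2) i := by
  rw [← PCGroup.of_eq_gen]
  exact PresentedGroup.toGroup.of _

theorem exists_toPCGroup : ∃ f : FreeSandwichGroup (Fin 3) →* PCGroup,
    f (of 0) = PCGroup.gen 12 ∧ f (of 1) = PCGroup.gen 13 ∧ f (of 2) = PCGroup.gen 14 := by
  obtain ⟨f, hf⟩ := exists_hom ![PCGroup.gen 12, PCGroup.gen 13, PCGroup.gen 14] (by
    have : Set.range ![PCGroup.gen 12, PCGroup.gen 13, PCGroup.gen 14] =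
        {PCGroup.gen 12, PCGroup.gen 13, PCGroup.gen 14} := by
      simp only [Matrix.range_cons, Matrix.range_empty, Set.union_empty, Set.singleton_union]
    rw [this]
    exact PCGroup.isSandwichSet)
  exact ⟨f, hf 0, hf 1, hf 2⟩

theorem exists_equiv : ∃ φ : PCGroup ≃* FreeSandwichGroup (Fin 3), ∀ i : Fin 14,
    φ (PCGroup.gen (i.val + 1)) = commutatorList (of 0) (of 1) (of 2) i := by
  obtain ⟨f, hx, hy, hz⟩ := exists_toPCGroup
  have gx : ofPCGroup (PCGroup.gen 12) = of 0 := ofPCGroup_gen 11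
  have gy : ofPCGroup (PCGroup.gen 13) = of 1 := ofPCGroup_gen 12
  have gz : ofPCGroup (PCGroup.gen 14) = of 2 := ofPCGroup_gen 13
  have h1 : f.comp ofPCGroup = MonoidHom.id _ := by
    apply PCGroup.hom_ext <;> simp [gx, gy, gz, hx, hy, hz]
  have h2 : ofPCGroup.comp f = MonoidHom.id _ := by
    refine PresentedGroup.ext fun i => ?_
    change ofPCGroup (f (of i)) = of i
    fin_cases i
    · exact (congrArg _ hx).trans gx
    · exact (congrArg _ hy).trans gy
    · exact (congrArg _ hz).trans gz
  exact ⟨MonoidHom.toMulEquiv ofPCGroup f h1 h2, ofPCGroup_gen⟩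

end FreeSandwichGroup

/-! ### A permutation representation and the exact class -/

/-- The permutations by which `x`, `y` and `z` act on sixteen points. -/
def pointPerm : Fin 3 → Equiv.Perm (Fin 16) :=
  ![⟨![2, 3, 0, 1, 6, 7, 4, 5, 10, 14, 8, 13, 15, 11, 9, 12],
      ![2, 3, 0, 1, 6, 7, 4, 5, 10, 14, 8, 13, 15, 11, 9, 12], by decide, by decide⟩,
    ⟨![0, 1, 6, 7, 4, 5, 2, 3, 11, 12, 10, 8, 9, 13, 15, 14],
      ![0, 1, 6, 7, 4, 5, 2, 3, 11, 12, 10, 8, 9, 13, 15, 14], by decide, by decide⟩,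
    ⟨![1, 0, 7, 11, 14, 13, 9, 2, 12, 6, 15, 3, 8, 5, 4, 10],
      ![1, 0, 7, 11, 14, 13, 9, 2, 12, 6, 15, 3, 8, 5, 4, 10], by decide, by decide⟩]

theorem pointPerm_sq (i : Fin 3) : pointPerm i ^ 2 = 1 := by
  revert i; decide +kernel

/-- In the presented group `[z, x, y, z] = x_4 * x_3 * x_2` and `[x_4, x] = x_3`, so this says that
`x_3` acts nontrivially. -/
theorem pointPerm_commutator_ne_one : gcomm (gcomm (gcomm (gcomm (pointPerm 2) (pointPerm 0))
    (pointPerm 1)) (pointPerm 2)) (pointPerm 0) ≠ 1 := by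
  decide +kernel

theorem lift_pointPerm :
    ∀ r ∈ pcRels, FreeGroup.lift (commutatorList (pointPerm 0) (pointPerm 1) (pointPerm 2)) r = 1 :=
  lift_eq_one_of_pcRels _ (by decide +kernel) (by decide +kernel)

theorem PCGroup.exists_hom {G : Type*} [Group G] {x y z : G}
    (h : ∀ r ∈ pcRels, FreeGroup.lift (commutatorList x y z) r = 1) :
    ∃ f : PCGroup →* G, f (gen 12) = x ∧ f (gen 13) = y ∧ f (gen 14) = z := by
  have hg : ∀ i : Fin 14, PresentedGroup.toGroup h (PCGroup.gen (i + 1)) =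
      commutatorList x y z i := by
    intro i
    rw [← PCGroup.of_eq_gen]
    exact PresentedGroup.toGroup.of _
  exact ⟨PresentedGroup.toGroup h, hg 11, hg 12, hg 13⟩

/-- The sandwich condition for the permutations is not tested directly: the representation is
defined on the presented group by its relators and pulled back to the free sandwich group. -/
theorem FreeSandwichGroup.exists_toPerm : ∃ f : FreeSandwichGroup (Fin 3) →* Equiv.Perm (Fin 16),
    ∀ i, f (of i) = pointPerm i := by
  obtain ⟨f, hx, hy, hz⟩ := exists_toPCGroup
  obtain ⟨g, gx, gy, gz⟩ := PCGroup.exists_hom lift_pointPerm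
  refine ⟨g.comp f, Fin.forall_fin_succ.2 ⟨?_, Fin.forall_fin_two.2 ⟨?_, ?_⟩⟩⟩
  · rw [MonoidHom.comp_apply, hx, gx]
  · exact (congrArg g hy).trans gy
  · exact (congrArg g hz).trans gz

theorem not_nilpotencyClass_le_four {G : Type*} [Group G] [Group.IsNilpotent G]
    (f : G →* Equiv.Perm (Fin 16)) {x y z : G} (hx : f x = pointPerm 0) (hy : f y = pointPerm 1)
    (hz : f z = pointPerm 2) : ¬ Group.nilpotencyClass G ≤ 4 := by
  intro h
  have h4 : z ∈ Subgroup.upperCentralSeries G 4 := by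
    rw [Subgroup.upperCentralSeries_eq_top_iff_nilpotencyClass_le.2 h]
    exact Subgroup.mem_top z
  have h3 := mem_upperCentralSeries_succ_iff_gcomm.1 h4 x
  have h2 := mem_upperCentralSeries_succ_iff_gcomm.1 h3 y
  have h1 := mem_upperCentralSeries_succ_iff_gcomm.1 h2 z
  have h0 := mem_upperCentralSeries_succ_iff_gcomm.1 h1 x
  rw [Subgroup.upperCentralSeries_zero, Subgroup.mem_bot] at h0
  apply pointPerm_commutator_ne_one
  rw [← hx, ← hy, ← hz, ← map_gcomm, ← map_gcomm, ← map_gcomm, ← map_gcomm, h0, map_one]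

namespace FreeSandwichGroup

theorem isNilpotent : Group.IsNilpotent (FreeSandwichGroup (Fin 3)) :=
  (isSandwichSet_of.nilpotentOfClassLE_five closure_of).1

theorem nilpotencyClass_eq_five : Group.nilpotencyClass (FreeSandwichGroup (Fin 3)) = 5 := by
  have := isNilpotent
  obtain ⟨f, hf⟩ := exists_toPerm
  have h1 := (isSandwichSet_of.nilpotentOfClassLE_five closure_of).2
  have h2 := not_nilpotencyClass_le_four f (hf 0) (hf 1) (hf 2)
  omega

theorem isNilpotent_quotient (l m n : ℕ) :
    Group.IsNilpotent (FreeSandwichGroup (Fin 3) ⧸ powerClosure l m n) := by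
  have := isNilpotent
  infer_instance

theorem nilpotencyClass_quotient_eq_five {l m n : ℕ} (hl : Even l) (hm : Even m) (hn : Even n) :
    Group.nilpotencyClass (FreeSandwichGroup (Fin 3) ⧸ powerClosure l m n) = 5 := by
  have := isNilpotent
  obtain ⟨f, hf⟩ := exists_toPerm
  have pow_eq : ∀ (i : Fin 3) {k : ℕ}, Even k → f (of i ^ k) = 1 := by
    rintro i _ ⟨k, rfl⟩
    rw [map_pow, hf, ← two_mul, pow_mul, pointPerm_sq, one_pow]
  -- The generators act as involutions, so the representation factors through every quotient with
  -- even exponents.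
  have hker : powerClosure l m n ≤ f.ker := by
    refine Subgroup.normalClosure_le_normal ?_
    rintro _ (rfl | rfl | rfl)
    · exact pow_eq 0 hl
    · exact pow_eq 1 hm
    · exact pow_eq 2 hn
  have h1 : Group.nilpotencyClass (FreeSandwichGroup (Fin 3) ⧸ powerClosure l m n) ≤ 5 :=
    (Group.nilpotencyClass_quotient_le _).trans nilpotencyClass_eq_five.le
  have h2 := not_nilpotencyClass_le_four (QuotientGroup.lift _ f hker)
    (x := QuotientGroup.mk (of 0)) (y := QuotientGroup.mk (of 1)) (z := QuotientGroup.mk (of 2))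
    (hf 0) (hf 1) (hf 2)
  omega

end FreeSandwichGroup

theorem theorem2p1 :
    -- sandwich groups generated by a sandwich set of three elements of odd order
    (∀ {G : Type*} [Group G] (x y z : G),
      IsSandwichSet ({x, y, z} : Set G) → Subgroup.closure ({x, y, z} : Set G) = ⊤ →
      Odd (orderOf x) → Odd (orderOf y) → Odd (orderOf z) →
      NilpotentOfClassLE G 3) ∧
    -- the free sandwich group of rank 3
    (Group.IsNilpotent (FreeSandwichGroup (Fin 3)) ∧
      Group.nilpotencyClass (FreeSandwichGroup (Fin 3)) = 5) ∧
    -- its largest quotients with prescribed even exponents of the generators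
    -- (`0` prescribes nothing)
    (∀ l m n : ℕ, Even l → Even m → Even n →
      Group.IsNilpotent (FreeSandwichGroup (Fin 3) ⧸ FreeSandwichGroup.powerClosure l m n) ∧
        Group.nilpotencyClass (FreeSandwichGroup (Fin 3) ⧸
          FreeSandwichGroup.powerClosure l m n) = 5) ∧
    -- the consistent power-conjugate presentation
    PCGroup.Consistent ∧
    ∃ φ : PCGroup ≃* FreeSandwichGroup (Fin 3), ∀ i : Fin 14,
      φ (PCGroup.gen (i.val + 1)) =
        commutatorList (FreeSandwichGroup.of 0 : FreeSandwichGroup (Fin 3))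
          (FreeSandwichGroup.of 1) (FreeSandwichGroup.of 2) i :=
  ⟨fun _ _ _ h htop ox oy oz => h.nilpotentOfClassLE_three htop ox oy oz,
    ⟨FreeSandwichGroup.isNilpotent, FreeSandwichGroup.nilpotencyClass_eq_five⟩,
    fun l m n hl hm hn => ⟨FreeSandwichGroup.isNilpotent_quotient l m n,
      FreeSandwichGroup.nilpotencyClass_quotient_eq_five hl hm hn⟩,
    PCGroup.consistent, FreeSandwichGroup.exists_equiv⟩
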